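/- **Setting and notation.** Let $p$ be a prime and let $\mathcal O$ be a complete discrete valuation ring of characteristic $0$ with residue field $F$ of characteristic $p$. All groups are finite. An $(\mathcal OG,\mathcal OH)$-bimodule is viewed as an $\mathcal O[G\times H]$-module via $(g,h)m=gmh^{-1}$. A $p$-permutation module is a finitely generated module whose restriction to every $p$-subgroup has a basis permuted by that subgroup. For subgroups $P\le G$, $Q\le H$ and an isomorphism $\phi\colon Q\to P$ put $\Delta(P,\phi,Q)=\{(\phi(y),y)\mid y\in Q\}\le G\times H$ (a twisted diagonal subgroup) and $\Delta(P)=\Delta(P,\mathrm{id},P)$. For an $\mathcal OG$-module $M$ and $P\le G$ let $M(P)=M^P/(\pi M^P+\sum_{Q<P}\mathrm{tr}_Q^P(M^Q))$, where $\pi$ generates the maximal ideal of $\mathcal O$, be the Brauer construction, an $F[N_G(P)]$-module, with canonical map $\mathrm{Br}_P\colon M^P\to M(P)$. A Brauer pair $(P,e)$ of $FG$ consists of a $p$-subgroup $P\le G$ and a block idempotent $e$ of $F[C_G(P)]$; $N_G(P,e)$ denotes its stabilizer in $G$ under conjugation. Let $f\mapsto f^*$ be the linear map on a group algebra with $h\mapsto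 h^{-1}$. For Brauer pairs $(P,e)$ of $FG$ and $(Q,f)$ of $FH$ put $eM(\Delta(P,\phi,Q))f=(e\otimes f^*)M(\Delta(P,\phi,Q))$, where $F[C_{G\times H}(\Delta(P,\phi,Q))]=F[C_G(P)]\otimes_F F[C_H(Q)]$; it is a module for the stabilizer $N_{G\times H}(\Delta(P,\phi,Q),e\otimes f^*)$ of $(\Delta(P,\phi,Q),e\otimes f^*)$ in $G\times H$, and we write $N_{S\times T}(\ldots)$ for the intersection of such a stabilizer, or of a normalizer, with $S\times T$. For $X\le G\times H$ and $Y\le H\times K$ let $X*Y=\{(g,k)\mid \exists h\in H\colon (g,h)\in X,\ (h,k)\in Y\}$, $k_1(X)=\{g\mid (g,1)\in X\}$, $k_2(X)=\{h\mid(1,h)\in X\}$. For an $FX$-module $M$ and an $FY$-module $N$, the extended tensor product $M\overset{X,Y}{\otimes}_{FH}N$ is the $F[X*Y]$-module with underlying space $M\otimes_{F[k_2(X)\cap k_1(Y)]}N$ and action $(g,k)(m\otimes n)=(g,h)m\otimes(h,k)n$, for any $h\in H$ with $(g,h)\in X$ and $(h,k)\in Y$. Write $c_g$ for conjugation $x\mapsto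 gxg^{-1}$ and ${}^h(Q,f)$ for the conjugate pair. **Theorem.** Let $G,H,K$ be finite groups, $(P,e)$ a Brauer pair of $FG$, $(R,d)$ a Brauer pair of $FK$, $\sigma\colon R\to P$ an isomorphism, and let $C_G(P)\le S\le N_G(P,e)$ and $C_K(R)\le T\le N_K(R,d)$. Let $\Omega$ be the set of triples $(\phi,(Q,f),\psi)$, where $(Q,f)$ is a Brauer pair of $FH$ and $\psi\colon R\to Q$, $\phi\colon Q\to P$ are isomorphisms with $\phi\psi=\sigma$. Let $M$ be a $p$-permutation $(\mathcal OG,\mathcal OH)$-bimodule and $N$ a $p$-permutation $(\mathcal OH,\mathcal OK)$-bimodule such that all indecomposable direct summands of $M$ and of $N$ have twisted diagonal vertices. (a) The group $N_{G\times K}(\Delta(P,\sigma,R))\times H$ acts on $\Omega$ via ${}^{((g,k),h)}(\phi,(Q,f),\psi)=(c_g\phi c_h^{-1},{}^h(Q,f),c_h\psi c_k^{-1})$, and $\mathrm{stab}_H(\phi,(Q,f),\psi)=C_H(Q)$. (b) For $\omega=(\phi,(Q,f),\psi)\in\Omega$ there is a well-defined homomorphism of $(F[C_G(P)]e,F[C_K(R)]d)$-bimodules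 $$\Phi_\omega\colon eM(\Delta(P,\phi,Q))f\otimes_{F[C_H(Q)]}fN(\Delta(Q,\psi,R))d\to e(M\otimes_{\mathcal OH}N)(\Delta(P,\sigma,R))d,$$ the restriction of $\mathrm{Br}_{\Delta(P,\phi,Q)}(m)\otimes\mathrm{Br}_{\Delta(Q,\psi,R)}(n)\mapsto\mathrm{Br}_{\Delta(P,\sigma,R)}(m\otimes n)$. For every set $\widetilde\Omega$ of representatives of the $H$-orbits of $\Omega$, the maps $\Phi_\omega$, $\omega\in\widetilde\Omega$, define an isomorphism $$\bigoplus_{(\phi,(Q,f),\psi)\in\widetilde\Omega}eM(\Delta(P,\phi,Q))f\otimes_{F[C_H(Q)]}fN(\Delta(Q,\psi,R))d\to e(M\otimes_{\mathcal OH}N)(\Delta(P,\sigma,R))d$$ of $(F[C_G(P)]e,F[C_K(R)]d)$-bimodules, which is natural in $M$ and $N$. (c) For $\omega=(\phi,(Q,f),\psi)\in\Omega$ put $X(\omega)=N_{S\times H}(\Delta(P,\phi,Q),e\otimes f^*)$, $Y(\omega)=N_{H\times T}(\Delta(Q,\psi,R),f\otimes d^*)$, $M(\omega)=eM(\Delta(P,\phi,Q))f$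 and $N(\omega)=fN(\Delta(Q,\psi,R))d$. Then $M(\omega)$ is a $p$-permutation $FX(\omega)$-module and $N(\omega)$ is a $p$-permutation $FY(\omega)$-module, $X(\omega)*Y(\omega)\le N_{S\times T}(\Delta(P,\sigma,R))$, and $\Phi_\omega$ is $F[X(\omega)*Y(\omega)]$-linear on $M(\omega)\overset{X(\omega),Y(\omega)}{\otimes}_{FH}N(\omega)$. For every set $\widehat\Omega$ of representatives of the $N_{S\times T}(\Delta(P,\sigma,R))\times H$-orbits of $\Omega$, the maps $\Phi_\omega$, $\omega\in\widehat\Omega$, induce an isomorphism $$\bigoplus_{\omega\in\widehat\Omega}\mathrm{Ind}_{X(\omega)*Y(\omega)}^{N_{S\times T}(\Delta(P,\sigma,R))}\Bigl(M(\omega)\overset{X(\omega),Y(\omega)}{\otimes}_{FH}N(\omega)\Bigr)\to e(M\otimes_{\mathcal OH}N)(\Delta(P,\sigma,R))d$$ of $F[N_{S\times T}(\Delta(P,\sigma,R))]$-modules, which is natural in $M$ and $N$. (d) Assume that $G=K$, $(P,e)=(R,d)$, $S=T$ and $\sigma=\mathrm{id}_P$. Let $\Lambda$ be the set of pairs $(\phi,(Q,f))$,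 where $(Q,f)$ is a Brauer pair of $FH$ and $\phi\colon Q\to P$ is an isomorphism. The group $S\times H$ acts on $\Lambda$ via ${}^{(g,h)}(\phi,(Q,f))=(c_g\phi c_h^{-1},{}^h(Q,f))$. For $\lambda=(\phi,(Q,f))\in\Lambda$ put $X(\lambda)=N_{S\times H}(\Delta(P,\phi,Q),e\otimes f^*)$, $Y(\lambda)=N_{H\times S}(\Delta(Q,\phi^{-1},P),f\otimes e^*)$, $M(\lambda)=eM(\Delta(P,\phi,Q))f$, $N(\lambda)=fN(\Delta(Q,\phi^{-1},P))e$, and let $I(\lambda)$ be the group of all $g\in S$ for which there is $h\in N_H(Q,f)$ with $c_g\phi c_h=\phi$. Then $M(\lambda)$ and $N(\lambda)$ are $p$-permutation modules for $FX(\lambda)$ and $FY(\lambda)$, respectively, $X(\lambda)*Y(\lambda)=\Delta(I(\lambda))(C_G(P)\times\{1\})$, and, for all sets $\widetilde\Lambda$ and $\widehat\Lambda$ of representatives of the $H$-orbits and of the $S\times H$-orbits of $\Lambda$, respectively, there are isomorphisms $$e(M\otimes_{\mathcal OH}N)(\Delta(P))e\cong\bigoplus_{(\phi,(Q,f))\in\widetilde\Lambda}eM(\Delta(P,\phi,Q))f\otimes_{F[C_H(Q)]}fN(\Delta(Q,\phi^{-1},P))e$$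 of $(F[C_G(P)]e,F[C_G(P)]e)$-bimodules and $$e(M\otimes_{\mathcal OH}N)(\Delta(P))e\cong\bigoplus_{\lambda\in\widehat\Lambda}\mathrm{Ind}_{\Delta(I(\lambda))(C_G(P)\times\{1\})}^{N_{S\times S}(\Delta(P))}\Bigl(M(\lambda)\overset{X(\lambda),Y(\lambda)}{\otimes}_{FH}N(\lambda)\Bigr)$$ of $F[N_{S\times S}(\Delta(P))](e\otimes e^*)$-modules. -/

import Mathlib

open scoped Pointwise TensorProduct DirectSum

noncomputable section

namespace BPDecomp

section Groups

variable {G H K : Type*} [Group G] [Group H] [Group K]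

/-- The twisted diagonal subgroup `Δ(P,φ,Q) = {(φ(y), y) | y ∈ Q}` of `G × H`. -/
def twDiag {P : Subgroup G} {Q : Subgroup H} (φ : Q ≃* P) : Subgroup (G × H) :=
  ((P.subtype.comp φ.toMonoidHom).prod Q.subtype).range

theorem mem_twDiag {P : Subgroup G} {Q : Subgroup H} {φ : Q ≃* P} {x : G × H} :
    x ∈ twDiag φ ↔ ∃ y : Q, ((φ y : G), (y : H)) = x := Iff.rfl

/-- A subgroup of `G × H` of the form `Δ(P,φ,Q)`. -/
def IsTwistedDiagonal (X : Subgroup (G × H)) : Prop :=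
  ∃ (P : Subgroup G) (Q : Subgroup H) (φ : Q ≃* P), X = twDiag φ

/-- `k₁(X) = {g | (g,1) ∈ X}`. -/
def k₁ (X : Subgroup (G × H)) : Subgroup G := X.comap (MonoidHom.inl G H)

/-- `k₂(X) = {h | (1,h) ∈ X}`. -/
def k₂ (X : Subgroup (G × H)) : Subgroup H := X.comap (MonoidHom.inr G H)

/-- The composition `X * Y = {(g,k) | ∃ h, (g,h) ∈ X ∧ (h,k) ∈ Y}`. -/
def starProd (X : Subgroup (G × H)) (Y : Subgroup (H × K)) : Subgroup (G × K) where
  carrier := {x | ∃ h : H, (x.1, h) ∈ X ∧ (h, x.2) ∈ Y}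
  one_mem' := ⟨1, X.one_mem, Y.one_mem⟩
  mul_mem' := by
    rintro a b ⟨h, h1, h2⟩ ⟨h', h1', h2'⟩
    exact ⟨h * h', X.mul_mem h1 h1', Y.mul_mem h2 h2'⟩
  inv_mem' := by
    rintro a ⟨h, h1, h2⟩
    exact ⟨h⁻¹, X.inv_mem h1, Y.inv_mem h2⟩

theorem mem_starProd {X : Subgroup (G × H)} {Y : Subgroup (H × K)} {x : G × K} :
    x ∈ starProd X Y ↔ ∃ h : H, (x.1, h) ∈ X ∧ (h, x.2) ∈ Y := Iff.rfl

/-- The subgroup `N_{(S,φ,T)}` of all `g ∈ S` for which there is `h ∈ T` normalizing `Q` with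
`c_g ∘ φ ∘ c_h = φ`. -/
def NSub {P : Subgroup G} {Q : Subgroup H} (S : Subgroup G) (φ : Q ≃* P) (T : Subgroup H) :
    Subgroup G where
  carrier := {g | g ∈ S ∧ ∃ h : Subgroup.normalizer (Q : Set H), (h : H) ∈ T ∧
    ∀ y : Q, g * (φ (Q.normalizerMonoidHom h y) : G) * g⁻¹ = φ y}
  one_mem' := ⟨S.one_mem, 1, T.one_mem, fun y => by simp⟩
  mul_mem' := by
    rintro a b ⟨ha, h, hT, h1⟩ ⟨hb, h', hT', h1'⟩
    refine ⟨S.mul_mem ha hb, h' * h, T.mul_mem hT' hT, fun y => ?_⟩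
    rw [map_mul, ← h1 y, ← h1' (Q.normalizerMonoidHom h y)]
    simp only [MulAut.mul_apply, mul_inv_rev]
    group
  inv_mem' := by
    rintro a ⟨ha, h, hT, h1⟩
    refine ⟨S.inv_mem ha, h⁻¹, T.inv_mem hT, fun y => ?_⟩
    rw [← h1, map_inv, MulAut.apply_inv_self]
    group

end Groups

section Orbits

/-- `T` is a set of representatives of the orbits of the subgroup `Γ` of `A` acting on `α`. -/
def IsOrbitReps {A α : Type*} [Group A] [MulAction A α] (Γ : Subgroup A) (T : Set α) : Prop :=
  ∀ a : α, ∃! b : α, b ∈ T ∧ b ∈ MulAction.orbit Γ a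

end Orbits

section Pairs

variable {F : Type*} [Field F] {G H K : Type*} [Group G] [Group H] [Group K]

/-- `b` is a primitive idempotent of the center of `A`. -/
structure IsBlockIdempotent {A : Type*} [Ring A] (b : A) : Prop where
  mem_center : b ∈ Subring.center A
  idem : b * b = b
  ne_zero : b ≠ 0
  primitive : ∀ c ∈ Subring.center A, c * c = c → c * b = c → c = 0 ∨ c = b

theorem mapDomain_mapDomain {A B C : Type*} (f : A → B) (g : B → C) (a : MonoidAlgebra F A) :
    MonoidAlgebra.mapDomain g (MonoidAlgebra.mapDomain f a) =
      MonoidAlgebra.mapDomain (fun x => g (f x)) a := by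
  induction a using MonoidAlgebra.induction_linear with
  | zero => simp
  | add x y hx hy => simp only [MonoidAlgebra.mapDomain_add, hx, hy]
  | single m r => simp

theorem mapDomain_eq_self {A : Type*} {f : A → A} (hf : ∀ x, f x = x) (a : MonoidAlgebra F A) :
    MonoidAlgebra.mapDomain f a = a := by
  induction a using MonoidAlgebra.induction_linear with
  | zero => simp
  | add x y hx hy => simp only [MonoidAlgebra.mapDomain_add, hx, hy]
  | single m r => simp [hf]

/-- A pair `(P,e)` of a subgroup `P` of `G` and an element `e` of `F[C_G(P)]`. -/
structure LocalPair (F : Type*) [Field F] (G : Type*) [Group G] where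
  P : Subgroup G
  e : MonoidAlgebra F (Subgroup.centralizer (P : Set G))

theorem smul_centralizer (g : G) (P : Subgroup G) :
    MulAut.conj g • Subgroup.centralizer (P : Set G) =
      Subgroup.centralizer ((MulAut.conj g • P : Subgroup G) : Set G) := by
  ext x
  rw [Subgroup.mem_pointwise_smul_iff_inv_smul_mem, Subgroup.mem_centralizer_iff,
    Subgroup.mem_centralizer_iff]
  constructor
  · rintro h _ ⟨y, hy, rfl⟩
    have := h y hy
    simp only [← map_inv, MulAut.smul_def, MulAut.conj_apply, inv_inv] at this
    simp only [MulDistribMulAction.toMonoidEnd_apply, MulDistribMulAction.toMonoidHom_apply,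
      MulAut.smul_def, MulAut.conj_apply]
    calc g * y * g⁻¹ * x = g * (y * (g⁻¹ * x * g)) * g⁻¹ := by group
      _ = x * (g * y * g⁻¹) := by rw [this]; group
  · intro h y hy
    have := h (g * y * g⁻¹) ⟨y, hy, rfl⟩
    simp only [← map_inv, MulAut.smul_def, MulAut.conj_apply, inv_inv]
    calc y * (g⁻¹ * x * g) = g⁻¹ * (g * y * g⁻¹ * x) * g := by group
      _ = g⁻¹ * x * g * y := by rw [this]; group

/-- Conjugation by `g`, as an isomorphism from `C_G(P)` to `C_G(gPg⁻¹)`. -/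
def conjCentralizer (g : G) (P : Subgroup G) :
    Subgroup.centralizer (P : Set G) ≃*
      Subgroup.centralizer ((MulAut.conj g • P : Subgroup G) : Set G) :=
  (Subgroup.equivSMul (MulAut.conj g) _).trans (MulEquiv.subgroupCongr (smul_centralizer g P))

theorem coe_conjCentralizer (g : G) (P : Subgroup G) (c : Subgroup.centralizer (P : Set G)) :
    (conjCentralizer g P c : G) = MulAut.conj g (c : G) := rfl

namespace LocalPair

/-- The image of `e` under `F[C_G(P)] ⊆ F[G]`. -/
def emb (x : LocalPair F G) : MonoidAlgebra F G :=
  MonoidAlgebra.mapDomain (Subtype.val) x.e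

theorem ext_emb {x y : LocalPair F G} (hP : x.P = y.P) (he : x.emb = y.emb) : x = y := by
  obtain ⟨P, e⟩ := x
  obtain ⟨P', e'⟩ := y
  obtain rfl : P = P' := hP
  obtain rfl : e = e' := MonoidAlgebra.mapDomain_injective Subtype.val_injective he
  rfl

/-- The conjugation action `^g(P,e) = (gPg⁻¹, geg⁻¹)`. -/
instance : SMul G (LocalPair F G) where
  smul g x := ⟨MulAut.conj g • x.P, MonoidAlgebra.mapDomain (conjCentralizer g x.P) x.e⟩

theorem smul_P (g : G) (x : LocalPair F G) : (g • x).P = MulAut.conj g • x.P := rfl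

theorem smul_emb (g : G) (x : LocalPair F G) :
    (g • x).emb = MonoidAlgebra.mapDomain (MulAut.conj g) x.emb := by
  change MonoidAlgebra.mapDomain _ (MonoidAlgebra.mapDomain _ _) =
    MonoidAlgebra.mapDomain _ (MonoidAlgebra.mapDomain _ _)
  rw [mapDomain_mapDomain, mapDomain_mapDomain]
  rfl

instance : MulAction G (LocalPair F G) where
  one_smul x := ext_emb (by rw [smul_P]; simp) (by
    rw [smul_emb]
    exact mapDomain_eq_self (fun g => by simp) _)
  mul_smul a b x := ext_emb (by rw [smul_P, smul_P, smul_P, map_mul, mul_smul]) (by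
    rw [smul_emb, smul_emb, smul_emb, mapDomain_mapDomain, map_mul]; rfl)

end LocalPair

/-- The stabilizer `N_G(P,e)` of a pair. -/
abbrev pairStab (x : LocalPair F G) : Subgroup G := MulAction.stabilizer G x

theorem mem_normalizer_iff_smul {P : Subgroup G} {g : G} :
    g ∈ Subgroup.normalizer (P : Set G) ↔ MulAut.conj g • P = P :=
  Subgroup.mem_normalizer_iff_map_conj_eq

theorem pairStab_le_normalizer (x : LocalPair F G) :
    pairStab x ≤ Subgroup.normalizer (x.P : Set G) := fun _ hg =>
  mem_normalizer_iff_smul.2 (congrArg LocalPair.P hg)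

theorem mem_pairStab {x : LocalPair F G} {g : G} : g ∈ pairStab x ↔
    g ∈ Subgroup.normalizer (x.P : Set G) ∧
      MonoidAlgebra.mapDomain (MulAut.conj g) x.emb = x.emb := by
  constructor
  · intro h
    exact ⟨pairStab_le_normalizer x h, by rw [← LocalPair.smul_emb, h]⟩
  · rintro ⟨h1, h2⟩
    exact LocalPair.ext_emb (mem_normalizer_iff_smul.1 h1) (by rw [LocalPair.smul_emb, h2])

/-- A Brauer pair `(P,e)` of `FG`: `P` is a `p`-subgroup of `G` and `e` is a block idempotent
of `F[C_G(P)]`. -/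
structure BrauerPair (F : Type*) [Field F] (p : ℕ) (G : Type*) [Group G]
    extends LocalPair F G where
  isPGroup : IsPGroup p P
  isBlock : IsBlockIdempotent e

theorem isBlockIdempotent_map {A B : Type*} [Ring A] [Ring B] (f : A ≃+* B) {b : A}
    (hb : IsBlockIdempotent b) : IsBlockIdempotent (f b) := by
  refine ⟨?_, by rw [← map_mul, hb.idem], by simpa using hb.ne_zero, ?_⟩
  · have ha := hb.mem_center
    rw [Subring.mem_center_iff] at ha ⊢
    intro y
    obtain ⟨z, rfl⟩ := f.surjective y
    rw [← map_mul, ha, map_mul]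
  · intro c hcc h1 h2
    obtain ⟨d, rfl⟩ := f.surjective c
    have hd : d ∈ Subring.center A := by
      rw [Subring.mem_center_iff] at hcc ⊢
      intro y
      apply f.injective
      rw [map_mul, hcc, map_mul]
    rw [← map_mul] at h1 h2
    rcases hb.primitive d hd (f.injective h1) (f.injective h2) with h | h
    · left; rw [h, map_zero]
    · right; rw [h]

namespace BrauerPair

variable {p : ℕ}

theorem toLocalPair_injective :
    Function.Injective (BrauerPair.toLocalPair : BrauerPair F p G → LocalPair F G) := by
  rintro ⟨x, _, _⟩ ⟨y, _, _⟩ h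
  obtain rfl : x = y := h
  rfl

/-- Conjugation of Brauer pairs. -/
instance : SMul G (BrauerPair F p G) where
  smul g x :=
    { toLocalPair := g • x.toLocalPair
      isPGroup := x.isPGroup.of_equiv (Subgroup.equivSMul (MulAut.conj g) x.P)
      isBlock := isBlockIdempotent_map
        (MonoidAlgebra.domCongr F F (conjCentralizer g x.P)).toRingEquiv x.isBlock }

theorem smul_toLocalPair (g : G) (x : BrauerPair F p G) :
    (g • x).toLocalPair = g • x.toLocalPair := rfl

instance : MulAction G (BrauerPair F p G) :=
  toLocalPair_injective.mulAction _ smul_toLocalPair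

end BrauerPair

end Pairs

end BPDecomp

namespace BPDecomp

section Reps

variable {k : Type*} [CommRing k] {Γ : Type*} [Group Γ] {V : Type*} [AddCommGroup V] [Module k V]

/-- A permutation module: a (finite) basis is permuted by the group. -/
def IsPermutationRep (ρ : Representation k Γ V) : Prop :=
  ∃ (n : ℕ) (b : Module.Basis (Fin n) k V), ∀ (g : Γ) (i : Fin n), ∃ j : Fin n, ρ g (b i) = b j

/-- A `p`-permutation module: the restriction to every `p`-subgroup is a permutation module. -/
def IsPPermutation (p : ℕ) (ρ : Representation k Γ V) : Prop :=
  ∀ P : Subgroup Γ, IsPGroup p P → IsPermutationRep (ρ.comp P.subtype)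

/-- `ρ` is relatively `Q`-projective: it is isomorphic to a direct summand of `Ind_Q Res_Q ρ`. -/
def IsRelProjective (ρ : Representation k Γ V) (Q : Subgroup Γ) : Prop :=
  ∃ (i : ρ.IntertwiningMap (Representation.ind Q.subtype (ρ.comp Q.subtype)))
    (s : (Representation.ind Q.subtype (ρ.comp Q.subtype)).IntertwiningMap ρ),
    s.comp i = Representation.IntertwiningMap.id ρ

/-- `Q` is a vertex of `ρ`: minimal such that `ρ` is relatively `Q`-projective. -/
def IsVertex (ρ : Representation k Γ V) (Q : Subgroup Γ) : Prop :=
  Minimal (IsRelProjective ρ) Q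

/-- `ρ` is indecomposable (in particular nonzero). -/
def IsIndecomposable (ρ : Representation k Γ V) : Prop :=
  Nontrivial V ∧ ∀ U W : Subrepresentation ρ, IsCompl U W → U = ⊥ ∨ W = ⊥

/-- All indecomposable direct summands of the `k[G × H]`-module have twisted diagonal vertices. -/
def HasTwistedDiagonalVertices {G H : Type*} [Group G] [Group H]
    (ρ : Representation k (G × H) V) : Prop :=
  ∀ U W : Subrepresentation ρ, IsCompl U W → IsIndecomposable U.toRepresentation →
    ∀ D : Subgroup (G × H), IsVertex U.toRepresentation D → IsTwistedDiagonal D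

/-- The fixed points `V^P`. -/
def fixedPts (ρ : Representation k Γ V) (P : Subgroup Γ) : Submodule k V where
  carrier := {v | ∀ x ∈ P, ρ x v = v}
  add_mem' := fun ha hb x hx => by rw [map_add, ha x hx, hb x hx]
  zero_mem' := fun x _ => map_zero _
  smul_mem' := fun c v hv x hx => by rw [map_smul, hv x hx]

theorem mem_fixedPts {ρ : Representation k Γ V} {P : Subgroup Γ} {v : V} :
    v ∈ fixedPts ρ P ↔ ∀ x ∈ P, ρ x v = v := Iff.rfl

/-- The relative trace `v ↦ ∑_{x ∈ [P/Q]} x v`; it is meant for `Q ≤ P` and restricted to `V^Q`,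
where it does not depend on the choice of representatives. -/
def relTrace (ρ : Representation k Γ V) (Q P : Subgroup Γ) : V →ₗ[k] V :=
  ∑ᶠ x : P ⧸ Q.subgroupOf P, ρ ((x.out : P) : Γ)

theorem relTrace_apply [Finite Γ] (ρ : Representation k Γ V) (Q P : Subgroup Γ) (v : V) :
    relTrace ρ Q P v = ∑ᶠ x : P ⧸ Q.subgroupOf P, ρ ((x.out : P) : Γ) v := by
  classical
  have := Fintype.ofFinite (P ⧸ Q.subgroupOf P)
  rw [relTrace, finsum_eq_sum_of_fintype, finsum_eq_sum_of_fintype, LinearMap.sum_apply]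

theorem map_relTrace [Finite Γ] {Γ' : Type*} [Group Γ'] [Finite Γ'] {V' : Type*} [AddCommGroup V']
    [Module k V'] {ρ : Representation k Γ V} {ρ' : Representation k Γ' V'}
    {P Q : Subgroup Γ} {P' Q' : Subgroup Γ'} (e : P ≃* P')
    (hQ : ∀ x : P, (x : Γ) ∈ Q ↔ (e x : Γ') ∈ Q') (L : V →ₗ[k] V') {v : V}
    (hL : ∀ x : P, L (ρ x v) = ρ' (e x) (L v)) (hv : v ∈ fixedPts ρ Q) :
    L (relTrace ρ Q P v) = relTrace ρ' Q' P' (L v) := by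
  classical
  have := Fintype.ofFinite (P ⧸ Q.subgroupOf P)
  have := Fintype.ofFinite (P' ⧸ Q'.subgroupOf P')
  rw [relTrace_apply, relTrace_apply, finsum_eq_sum_of_fintype, finsum_eq_sum_of_fintype, map_sum]
  let E : (P ⧸ Q.subgroupOf P) ≃ (P' ⧸ Q'.subgroupOf P') :=
    Quotient.congr e.toEquiv (fun a b => by
      rw [QuotientGroup.leftRel_apply, QuotientGroup.leftRel_apply, Subgroup.mem_subgroupOf,
        Subgroup.mem_subgroupOf, hQ, map_mul, map_inv]
      rfl)
  refine Fintype.sum_equiv E _ _ fun x => ?_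
  rw [hL]
  have hx : QuotientGroup.mk (e x.out) = E x := by
    conv_rhs => rw [← QuotientGroup.out_eq' x]
    rfl
  have h2 : (QuotientGroup.mk ((E x).out) : P' ⧸ Q'.subgroupOf P') = QuotientGroup.mk (e x.out) := by
    rw [hx, QuotientGroup.out_eq']
  rw [QuotientGroup.eq, Subgroup.mem_subgroupOf] at h2
  obtain ⟨y, hy⟩ := e.surjective (((E x).out)⁻¹ * e x.out)
  have hyQ : (y : Γ) ∈ Q := (hQ y).2 (by rw [hy]; exact h2)
  have h3 : ρ' ((((E x).out)⁻¹ * e x.out : P') : Γ') (L v) = L v := by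
    rw [← hy, ← hL, hv _ hyQ]
  have h4 : e x.out = (E x).out * (((E x).out)⁻¹ * e x.out) := by group
  rw [h4, Subgroup.coe_mul, map_mul, Module.End.mul_apply, h3]

end Reps

section Brauer

open IsLocalRing

variable {O : Type*} [CommRing O] [IsLocalRing O] {Γ : Type*} [Group Γ]
  {V : Type*} [AddCommGroup V] [Module O V]

/-- The submodule `π V^P + ∑_{Q < P} tr_Q^P(V^Q)` of `V^P`. -/
def traceSub (ρ : Representation O Γ V) (P : Subgroup Γ) : Submodule O (fixedPts ρ P) :=
  maximalIdeal O • ⊤ ⊔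
    ⨆ (Q : Subgroup Γ) (_ : Q < P),
      ((fixedPts ρ Q).map (relTrace ρ Q P)).comap (fixedPts ρ P).subtype

/-- The Brauer construction `V(P) = V^P / (π V^P + ∑_{Q < P} tr_Q^P(V^Q))`. -/
def Brauer (ρ : Representation O Γ V) (P : Subgroup Γ) : Type _ := fixedPts ρ P ⧸ traceSub ρ P

variable (ρ : Representation O Γ V) (P : Subgroup Γ)

instance : AddCommGroup (Brauer ρ P) := inferInstanceAs (AddCommGroup (_ ⧸ traceSub ρ P))

instance : Module O (Brauer ρ P) := inferInstanceAs (Module O (_ ⧸ traceSub ρ P))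

/-- The Brauer map `Br_P : V^P → V(P)`. -/
def Br : fixedPts ρ P →ₗ[O] Brauer ρ P := (traceSub ρ P).mkQ

theorem Br_surjective : Function.Surjective (Br ρ P) := (traceSub ρ P).mkQ_surjective

theorem brauer_torsion : Module.IsTorsionBySet O (Brauer ρ P) (maximalIdeal O) := by
  rintro x ⟨a, ha⟩
  obtain ⟨v, rfl⟩ := Br_surjective ρ P x
  change a • Br ρ P v = 0
  rw [← map_smul]
  exact (Submodule.Quotient.mk_eq_zero _).2
    (Submodule.mem_sup_left (Submodule.smul_mem_smul ha Submodule.mem_top))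

/-- `V(P)` is a vector space over the residue field `F`. -/
instance : Module (ResidueField O) (Brauer ρ P) :=
  Module.IsTorsionBySet.module (I := maximalIdeal O) (brauer_torsion ρ P)

theorem residue_smul (a : O) (x : Brauer ρ P) : (residue O a) • x = a • x := rfl

instance : IsScalarTower O (ResidueField O) (Brauer ρ P) where
  smul_assoc a b x := by
    obtain ⟨b, rfl⟩ := residue_surjective b
    have : a • residue O b = residue O (a * b) := by
      rw [map_mul, Algebra.smul_def]; rfl
    rw [this, residue_smul, residue_smul, mul_smul]

/-- An `O`-linear map between `F`-modules is `F`-linear. -/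
def toResidue {A B : Type*} [AddCommGroup A] [AddCommGroup B] [Module O A] [Module O B]
    [Module (ResidueField O) A] [Module (ResidueField O) B] [IsScalarTower O (ResidueField O) A]
    [IsScalarTower O (ResidueField O) B] (f : A →ₗ[O] B) : A →ₗ[ResidueField O] B :=
  LinearMap.extendScalarsOfSurjective (R := O) (S := ResidueField O) residue_surjective f

variable {ρ P} [Finite Γ] {Γ' : Type*} [Group Γ'] [Finite Γ'] {V' : Type*} [AddCommGroup V']
  [Module O V'] {ρ' : Representation O Γ' V'} {P' : Subgroup Γ'}

theorem map_mem_fixedPts (e : P ≃* P') (L : V →ₗ[O] V')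
    (hL : ∀ (x : P) (v : V), L (ρ x v) = ρ' (e x) (L v)) (v : V) (hv : v ∈ fixedPts ρ P) :
    L v ∈ fixedPts ρ' P' := fun x hx => by
  obtain ⟨y, hy⟩ := e.surjective ⟨x, hx⟩
  have := hL y v
  rwa [hv _ y.2, hy, eq_comm] at this

theorem traceSub_le_comap (e : P ≃* P') (L : V →ₗ[O] V')
    (hL : ∀ (x : P) (v : V), L (ρ x v) = ρ' (e x) (L v)) :
    traceSub ρ P ≤ (traceSub ρ' P').comap (L.restrict (map_mem_fixedPts e L hL)) := by
  refine sup_le ?_ (iSup₂_le fun Q hQ => ?_)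
  · rw [Submodule.smul_le]
    intro r hr n _
    rw [Submodule.mem_comap, map_smul]
    exact Submodule.mem_sup_left (Submodule.smul_mem_smul hr Submodule.mem_top)
  · rintro ⟨_, hm⟩ ⟨v, hv, rfl⟩
    have hinj : Function.Injective (P'.subtype.comp e.toMonoidHom) :=
      P'.subtype_injective.comp e.injective
    let Q' : Subgroup Γ' := (Q.subgroupOf P).map (P'.subtype.comp e.toMonoidHom)
    have hmem : ∀ x : P, (x : Γ) ∈ Q ↔ (e x : Γ') ∈ Q' := fun x =>
      (Subgroup.mem_map_iff_mem hinj (K := Q.subgroupOf P) (x := x)).symm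
    have hle : Q' < P' := by
      refine lt_of_le_not_ge ?_ fun hge => hQ.not_ge fun x hx => ?_
      · rintro _ ⟨x, _, rfl⟩
        exact (e x).2
      · exact (hmem ⟨x, hx⟩).2 (hge (e ⟨x, hx⟩).2)
    refine Submodule.mem_sup_right (Submodule.mem_iSup_of_mem Q' (Submodule.mem_iSup_of_mem hle ?_))
    refine ⟨L v, ?_, (map_relTrace e hmem L (fun x => hL x v) hv).symm⟩
    rintro _ ⟨x, hx, rfl⟩
    have := hL x v
    rw [show ρ (x : Γ) v = v from hv _ hx] at this
    exact this.symm

/-- The `O`-linear version of `brauerMap`. -/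
def brauerMapAux (e : P ≃* P') (L : V →ₗ[O] V')
    (hL : ∀ (x : P) (v : V), L (ρ x v) = ρ' (e x) (L v)) :
    Brauer ρ P →ₗ[O] Brauer ρ' P' :=
  (traceSub ρ P).mapQ (traceSub ρ' P') _ (traceSub_le_comap e L hL)

/-- A linear map `L : V → V'` that is equivariant along an isomorphism `e : P → P'` induces a map
`V(P) → V'(P')`, `Br_P(v) ↦ Br_{P'}(L v)`. -/
def brauerMap (e : P ≃* P') (L : V →ₗ[O] V')
    (hL : ∀ (x : P) (v : V), L (ρ x v) = ρ' (e x) (L v)) :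
    Brauer ρ P →ₗ[ResidueField O] Brauer ρ' P' :=
  toResidue (brauerMapAux e L hL)

theorem brauerMap_Br (e : P ≃* P') (L : V →ₗ[O] V')
    (hL : ∀ (x : P) (v : V), L (ρ x v) = ρ' (e x) (L v)) (v : fixedPts ρ P) :
    brauerMap e L hL (Br ρ P v) = Br ρ' P' ⟨L v, map_mem_fixedPts e L hL v v.2⟩ := rfl

variable (ρ P) in
/-- The action of `N(P)` on `V(P)`: `g Br_P(v) = Br_P(g v)`. -/
def brauerRep : Representation (ResidueField O) (Subgroup.normalizer (P : Set Γ)) (Brauer ρ P) where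
  toFun g := brauerMap (P.normalizerMonoidHom g) (ρ g) (fun x v => by
    rw [← Module.End.mul_apply, ← Module.End.mul_apply, ← map_mul, ← map_mul]
    congr 2
    simp)
  map_one' := by
    refine LinearMap.ext fun x => ?_
    obtain ⟨v, rfl⟩ := Br_surjective ρ P x
    rw [brauerMap_Br]
    simp
  map_mul' a b := by
    refine LinearMap.ext fun x => ?_
    obtain ⟨v, rfl⟩ := Br_surjective ρ P x
    rw [Module.End.mul_apply, brauerMap_Br, brauerMap_Br, brauerMap_Br]
    simp

theorem normalizer_map_mem {g : Γ} (hg : g ∈ Subgroup.normalizer (P : Set Γ)) {v : V}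
    (hv : v ∈ fixedPts ρ P) : ρ g v ∈ fixedPts ρ P := fun x hx => by
  have h := hv (g⁻¹ * x * g) ((Subgroup.mem_normalizer_iff''.1 hg x).1 hx)
  conv_rhs => rw [← h]
  rw [← Module.End.mul_apply, ← Module.End.mul_apply, ← map_mul, ← map_mul]
  congr 2
  group

theorem brauerRep_Br (g : Subgroup.normalizer (P : Set Γ)) (v : fixedPts ρ P) :
    brauerRep ρ P g (Br ρ P v) = Br ρ P ⟨ρ g v, normalizer_map_mem g.2 v.2⟩ := rfl

/-- The action of `F[C(P)]` on `V(P)`. -/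
def brauerAct (ρ : Representation O Γ V) (P : Subgroup Γ) :
    MonoidAlgebra (ResidueField O) (Subgroup.centralizer (P : Set Γ)) →ₐ[ResidueField O]
      Module.End (ResidueField O) (Brauer ρ P) :=
  Representation.asAlgebraHom
    ((brauerRep ρ P).comp (Subgroup.inclusion (Subgroup.centralizer_le_normalizer _)))

/-- The subspace `e V(P)` of `V(P)`, for `e ∈ F[C(P)]`. -/
def cut (ρ : Representation O Γ V) (x : LocalPair (ResidueField O) Γ) :
    Submodule (ResidueField O) (Brauer ρ x.P) :=
  LinearMap.range (brauerAct ρ x.P x.e)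

/-- Conjugation by an element of `N(P)` on `C(P)`. -/
def conjCent (g : Subgroup.normalizer (P : Set Γ)) :
    Subgroup.centralizer (P : Set Γ) →* Subgroup.centralizer (P : Set Γ) :=
  ((MulAut.conj (g : Γ)).toMonoidHom.comp (Subgroup.subtype _)).codRestrict _ fun c => by
    have h : ((conjCentralizer (g : Γ) P c : _) : Γ) ∈
        Subgroup.centralizer ((MulAut.conj (g : Γ) • P : Subgroup Γ) : Set Γ) :=
      (conjCentralizer (g : Γ) P c).2
    have h2 : Subgroup.centralizer ((MulAut.conj (g : Γ) • P : Subgroup Γ) : Set Γ) =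
        Subgroup.centralizer (P : Set Γ) := by rw [mem_normalizer_iff_smul.1 g.2]
    exact h2.le h

theorem brauerRep_brauerAct (g : Subgroup.normalizer (P : Set Γ))
    (a : MonoidAlgebra (ResidueField O) (Subgroup.centralizer (P : Set Γ))) (v : Brauer ρ P) :
    brauerRep ρ P g (brauerAct ρ P a v) =
      brauerAct ρ P (MonoidAlgebra.mapDomain (conjCent g) a) (brauerRep ρ P g v) := by
  induction a using MonoidAlgebra.induction_linear with
  | zero => simp
  | add x y hx hy => simp only [MonoidAlgebra.mapDomain_add, map_add, LinearMap.add_apply, hx, hy]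
  | single c r =>
    rw [MonoidAlgebra.mapDomain_single, brauerAct, Representation.asAlgebraHom_single,
      Representation.asAlgebraHom_single, LinearMap.smul_apply, LinearMap.smul_apply, map_smul]
    congr 1
    rw [MonoidHom.comp_apply, MonoidHom.comp_apply, ← Module.End.mul_apply, ← Module.End.mul_apply,
      ← map_mul, ← map_mul]
    congr 2
    ext
    simp [conjCent]

theorem mapDomain_conjCent {x : LocalPair (ResidueField O) Γ} (g : pairStab x) :
    MonoidAlgebra.mapDomain (conjCent (Subgroup.inclusion (pairStab_le_normalizer x) g)) x.e = x.e := by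
  apply MonoidAlgebra.mapDomain_injective Subtype.val_injective
  rw [mapDomain_mapDomain]
  have h := (mem_pairStab.1 g.2).2
  rw [LocalPair.emb, mapDomain_mapDomain] at h
  exact h

/-- `e V(P)` as a module for `F[N(P,e)]`. -/
def cutRep (ρ : Representation O Γ V) (x : LocalPair (ResidueField O) Γ) :
    Representation (ResidueField O) (pairStab x) (cut ρ x) :=
  Representation.subrepresentation
    ((brauerRep ρ x.P).comp (Subgroup.inclusion (pairStab_le_normalizer x))) (cut ρ x) (by
      rintro g _ ⟨v, rfl⟩
      refine ⟨brauerRep ρ x.P (Subgroup.inclusion (pairStab_le_normalizer x) g) v, ?_⟩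
      rw [MonoidHom.comp_apply, brauerRep_brauerAct]
      congr 2
      exact (mapDomain_conjCent g).symm)

theorem coe_cutRep (x : LocalPair (ResidueField O) Γ) (g : pairStab x) (v : cut ρ x) :
    (cutRep ρ x g v : Brauer ρ x.P) =
      brauerRep ρ x.P (Subgroup.inclusion (pairStab_le_normalizer x) g) v := rfl

/-- Functoriality of `V ↦ e V(P)`. -/
def cutMap {W : Type*} [AddCommGroup W] [Module O W] {τ : Representation O Γ W}
    (α : ρ.IntertwiningMap τ) (x : LocalPair (ResidueField O) Γ) :
    (cutRep ρ x).IntertwiningMap (cutRep τ x) :=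
  LinearMap.intertwiningMap_of_isIntertwiningMap _ _
    ((brauerMap (MulEquiv.refl x.P) α.toLinearMap fun y v => α.isIntertwining _ _ y v).restrict (by
      rintro _ ⟨v, rfl⟩
      refine ⟨brauerMap (MulEquiv.refl x.P) α.toLinearMap (fun y v => α.isIntertwining _ _ y v) v, ?_⟩
      generalize x.e = a
      induction a using MonoidAlgebra.induction_linear with
      | zero => simp
      | add x y hx hy => simp only [map_add, LinearMap.add_apply, hx, hy]
      | single c r =>
        rw [brauerAct, brauerAct, Representation.asAlgebraHom_single,
          Representation.asAlgebraHom_single, LinearMap.smul_apply, LinearMap.smul_apply, map_smul]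
        congr 1
        obtain ⟨v, rfl⟩ := Br_surjective ρ x.P v
        refine congrArg (Br τ x.P) (Subtype.ext ?_)
        exact (α.isIntertwining _ _ _ _).symm))
    (by
      rintro g ⟨v, hv⟩
      apply Subtype.ext
      obtain ⟨v, rfl⟩ := Br_surjective ρ x.P v
      refine congrArg (Br τ x.P) (Subtype.ext ?_)
      exact α.isIntertwining _ _ _ _)

end Brauer

end BPDecomp

namespace BPDecomp

open Representation

section Intertwining

variable {k : Type*} [CommRing k] {Γ Γ' : Type*} [Group Γ] [Group Γ']
  {V W : Type*} [AddCommGroup V] [Module k V] [AddCommGroup W] [Module k W]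

/-- Restriction of an intertwining map along a group homomorphism. -/
def resMap {ρ : Representation k Γ V} {ρ' : Representation k Γ W} (f : ρ.IntertwiningMap ρ')
    (i : Γ' →* Γ) : IntertwiningMap (ρ.comp i) (ρ'.comp i) :=
  LinearMap.intertwiningMap_of_isIntertwiningMap _ _ f.toLinearMap
    fun g v => f.isIntertwining _ _ (i g) v

/-- Frobenius reciprocity: `g ⊗ v ↦ g f(v)`. -/
def indLift {ρ : Representation k Γ V} {σ : Representation k Γ' W} (i : Γ →* Γ')
    (f : ρ.IntertwiningMap (σ.comp i)) : (ind i ρ).IntertwiningMap σ :=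
  ⟨Coinvariants.lift _
      (TensorProduct.lift <| (Finsupp.lift _ _ _ fun h => σ h⁻¹ ∘ₗ f.toLinearMap) ∘ₗ
        (MonoidAlgebra.coeffLinearEquiv k).toLinearMap)
      fun g => by
        ext h x
        have := f.isIntertwining _ _ g x
        simp only [LinearMap.coe_comp, Function.comp_apply, MonoidAlgebra.lsingle_apply]
        simp [ofMulAction_single, mul_inv_rev, this],
    fun g => by ext h x; simp⟩

theorem indLift_mk {ρ : Representation k Γ V} {σ : Representation k Γ' W} (i : Γ →* Γ')
    (f : ρ.IntertwiningMap (σ.comp i)) (g : Γ') (v : V) :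
    indLift i f (IndV.mk i ρ g v) = σ g⁻¹ (f v) := by
  simp [indLift]

/-- Functoriality of induction: `g ⊗ v ↦ g ⊗ f(v)`. -/
def indMap {ρ : Representation k Γ V} {ρ' : Representation k Γ W} (i : Γ →* Γ')
    (f : ρ.IntertwiningMap ρ') : (ind i ρ).IntertwiningMap (ind i ρ') :=
  ⟨Coinvariants.map _ _ (IntertwiningMap.lTensor _ f), fun g => by ext h x; simp⟩

theorem indMap_mk {ρ : Representation k Γ V} {ρ' : Representation k Γ W} (i : Γ →* Γ')
    (f : ρ.IntertwiningMap ρ') (g : Γ') (v : V) :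
    indMap i f (IndV.mk i ρ g v) = IndV.mk i ρ' g (f v) := by
  simp [indMap]

open Classical in
/-- The map out of a direct sum given by a family of maps. -/
def sumLift {ι : Type*} {U : ι → Type*} [∀ i, AddCommGroup (U i)] [∀ i, Module k (U i)]
    {ρ : ∀ i, Representation k Γ (U i)} {σ : Representation k Γ W}
    (f : ∀ i, (ρ i).IntertwiningMap σ) : (Representation.directSum ρ).IntertwiningMap σ :=
  ⟨DirectSum.toModule k ι W fun i => (f i).toLinearMap, fun g => by
      ext i x
      have := (f i).isIntertwining _ _ g x
      simpa using this⟩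

/-- The direct sum of a family of maps. -/
def sumMap {ι : Type*} {U U' : ι → Type*} [∀ i, AddCommGroup (U i)] [∀ i, Module k (U i)]
    [∀ i, AddCommGroup (U' i)] [∀ i, Module k (U' i)]
    {ρ : ∀ i, Representation k Γ (U i)} {ρ' : ∀ i, Representation k Γ (U' i)}
    (f : ∀ i, (ρ i).IntertwiningMap (ρ' i)) :
    (Representation.directSum ρ).IntertwiningMap (Representation.directSum ρ') :=
  ⟨DirectSum.lmap fun i => (f i).toLinearMap, fun g => by
      classical
      ext i x
      have := (f i).isIntertwining _ _ g x
      simp [this]⟩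

end Intertwining

section Tensor

variable {k : Type*} [CommRing k] {A B C : Type*} [Group A] [Group B] [Group C]
  {V W : Type*} [AddCommGroup V] [Module k V] [AddCommGroup W] [Module k W]
  {V' W' : Type*} [AddCommGroup V'] [Module k V'] [AddCommGroup W'] [Module k W']

/-- The action of `B` on `V ⊗ W`, `b (v ⊗ w) = v b⁻¹ ⊗ b w = (1,b) v ⊗ (b,1) w`. -/
abbrev midRep (ρ : Representation k (A × B) V) (τ : Representation k (B × C) W) :
    Representation k B (V ⊗[k] W) :=
  tprod (ρ.comp (MonoidHom.inr A B)) (τ.comp (MonoidHom.inl B C))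

/-- The tensor product `V ⊗_{kB} W` of a `(kA,kB)`-bimodule and a `(kB,kC)`-bimodule, that is, the
quotient of `V ⊗_k W` by the relations `v b⁻¹ ⊗ b w = v ⊗ w`. Bimodules are viewed as
left modules via `(a,b) v = a v b⁻¹`. -/
abbrev TensorOver (ρ : Representation k (A × B) V) (τ : Representation k (B × C) W) : Type _ :=
  Coinvariants (midRep ρ τ)

/-- The map `v ⊗ w ↦ (a,1) v ⊗ (1,c) w`. -/
def tensorFun (ρ : Representation k (A × B) V) (τ : Representation k (B × C) W) (x : A × C) :
    TensorOver ρ τ →ₗ[k] TensorOver ρ τ :=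
  Coinvariants.map _ _ (LinearMap.intertwiningMap_of_isIntertwiningMap _ _
    (TensorProduct.map (ρ (x.1, 1)) (τ (1, x.2))) fun b v => by
      simp only [Representation.tprod_apply, MonoidHom.comp_apply, MonoidHom.inr_apply,
        MonoidHom.inl_apply]
      rw [← LinearMap.comp_apply, ← LinearMap.comp_apply, ← TensorProduct.map_comp,
        ← TensorProduct.map_comp, ← Module.End.mul_eq_comp, ← Module.End.mul_eq_comp,
        ← Module.End.mul_eq_comp, ← Module.End.mul_eq_comp, ← map_mul, ← map_mul, ← map_mul,
        ← map_mul]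
      simp)

theorem tensorFun_mk (ρ : Representation k (A × B) V) (τ : Representation k (B × C) W) (x : A × C)
    (v : V) (w : W) : tensorFun ρ τ x (Coinvariants.mk _ (v ⊗ₜ w)) =
      Coinvariants.mk (midRep ρ τ) (ρ (x.1, 1) v ⊗ₜ τ (1, x.2) w) := rfl

/-- The `(kA,kC)`-bimodule structure of `V ⊗_{kB} W`. -/
def tensorRep (ρ : Representation k (A × B) V) (τ : Representation k (B × C) W) :
    Representation k (A × C) (TensorOver ρ τ) where
  toFun x := tensorFun ρ τ x
  map_one' := by
    ext v w
    have h1 : ρ ((1 : A), (1 : B)) = 1 := map_one ρ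
    have h2 : τ ((1 : B), (1 : C)) = 1 := map_one τ
    refine (tensorFun_mk ρ τ 1 v w).trans ?_
    change Coinvariants.mk _ (ρ ((1 : A), (1 : B)) v ⊗ₜ τ ((1 : B), (1 : C)) w) = _
    rw [h1, h2]
    rfl
  map_mul' x y := by
    ext v w
    refine (tensorFun_mk ρ τ (x * y) v w).trans ?_
    refine Eq.trans ?_ (congrArg (tensorFun ρ τ x) (tensorFun_mk ρ τ y v w).symm)
    rw [tensorFun_mk, ← Module.End.mul_apply, ← Module.End.mul_apply, ← map_mul, ← map_mul]
    simp

theorem tensorRep_mk (ρ : Representation k (A × B) V) (τ : Representation k (B × C) W)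
    (a : A) (b : B) (c : C) (v : V) (w : W) :
    tensorRep ρ τ (a, c) (Coinvariants.mk _ (v ⊗ₜ w)) =
      Coinvariants.mk (midRep ρ τ) (ρ (a, b) v ⊗ₜ τ (b, c) w) := by
  have h := Coinvariants.mk_self_apply (midRep ρ τ) b (ρ (a, 1) v ⊗ₜ τ (1, c) w)
  have e1 : ρ (1, b) (ρ (a, 1) v) = ρ (a, b) v := by
    rw [← Module.End.mul_apply, ← map_mul]; simp
  have e2 : τ (b, 1) (τ (1, c) w) = τ (b, c) w := by
    rw [← Module.End.mul_apply, ← map_mul]; simp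
  simp only [Representation.tprod_apply, MonoidHom.comp_apply, MonoidHom.inr_apply, MonoidHom.inl_apply,
    TensorProduct.map_tmul, e1, e2] at h
  rw [h]
  rfl

/-- Functoriality of `V ⊗_{kB} W`. -/
def tensorMap {ρ : Representation k (A × B) V} {τ : Representation k (B × C) W}
    {ρ' : Representation k (A × B) V'} {τ' : Representation k (B × C) W'}
    (α : ρ.IntertwiningMap ρ') (β : τ.IntertwiningMap τ') :
    (tensorRep ρ τ).IntertwiningMap (tensorRep ρ' τ') :=
  ⟨Coinvariants.map _ _ (IntertwiningMap.tensor (resMap α (MonoidHom.inr A B))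
      (resMap β (MonoidHom.inl B C))), fun x => by
      ext v w
      have h1 := α.isIntertwining _ _ (x.1, 1) v
      have h2 := β.isIntertwining _ _ (1, x.2) w
      refine (congrArg (Coinvariants.map _ _ _) (tensorFun_mk ρ τ x v w)).trans ?_
      refine Eq.trans ?_ (tensorFun_mk ρ' τ' x (α v) (β w)).symm
      rw [← h1, ← h2]
      rfl⟩

theorem tensorMap_mk {ρ : Representation k (A × B) V} {τ : Representation k (B × C) W}
    {ρ' : Representation k (A × B) V'} {τ' : Representation k (B × C) W'}
    (α : ρ.IntertwiningMap ρ') (β : τ.IntertwiningMap τ') (v : V) (w : W) :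
    tensorMap α β (Coinvariants.mk _ (v ⊗ₜ w)) = Coinvariants.mk (midRep ρ' τ') (α v ⊗ₜ β w) := rfl

variable {X : Subgroup (A × B)} {Y : Subgroup (B × C)}

/-- The inclusion `k₂(X) → X`, `b ↦ (1,b)`. -/
def inK₂ (X : Subgroup (A × B)) : k₂ X →* X where
  toFun b := ⟨(1, b), b.2⟩
  map_one' := rfl
  map_mul' _ _ := by ext <;> simp

/-- The inclusion `k₁(Y) → Y`, `b ↦ (b,1)`. -/
def inK₁ (Y : Subgroup (B × C)) : k₁ Y →* Y where
  toFun b := ⟨(b, 1), b.2⟩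
  map_one' := rfl
  map_mul' _ _ := by ext <;> simp

/-- The action of `k₂(X) ∩ k₁(Y)` on `V ⊗ W`, `b (v ⊗ w) = (1,b) v ⊗ (b,1) w`. -/
abbrev extMidRep (ρ : Representation k X V) (τ : Representation k Y W) :
    Representation k (k₂ X ⊓ k₁ Y : Subgroup B) (V ⊗[k] W) :=
  tprod (ρ.comp ((inK₂ X).comp (Subgroup.inclusion inf_le_left)))
    (τ.comp ((inK₁ Y).comp (Subgroup.inclusion inf_le_right)))

/-- The underlying module `V ⊗_{k[k₂(X) ∩ k₁(Y)]} W` of the extended tensor product. -/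
abbrev ExtTensor (ρ : Representation k X V) (τ : Representation k Y W) : Type _ :=
  Coinvariants (extMidRep ρ τ)

/-- The map `v ⊗ w ↦ (a,b) v ⊗ (b,c) w` of the extended tensor product. -/
def extTensorOp (ρ : Representation k X V) (τ : Representation k Y W) (a : A) (b : B) (c : C)
    (hX : (a, b) ∈ X) (hY : (b, c) ∈ Y) : ExtTensor ρ τ →ₗ[k] ExtTensor ρ τ :=
  Coinvariants.lift _ (Coinvariants.mk _ ∘ₗ TensorProduct.map (ρ ⟨_, hX⟩) (τ ⟨_, hY⟩)) fun l => by
    have hl2 := X.mul_mem (X.mul_mem hX l.2.1) (X.inv_mem hX)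
    have hl1 := Y.mul_mem (Y.mul_mem hY l.2.2) (Y.inv_mem hY)
    let l' : (k₂ X ⊓ k₁ Y : Subgroup B) :=
      ⟨b * l * b⁻¹, by simpa [k₂] using hl2, by simpa [k₁] using hl1⟩
    ext v w
    have h := Coinvariants.mk_self_apply (extMidRep ρ τ) l' (ρ ⟨_, hX⟩ v ⊗ₜ τ ⟨_, hY⟩ w)
    simp only [Representation.tprod_apply, MonoidHom.comp_apply, TensorProduct.map_tmul] at h
    simp only [Representation.tprod_apply, TensorProduct.AlgebraTensorModule.curry_apply,
      LinearMap.restrictScalars_self, TensorProduct.curry_apply, LinearMap.comp_apply,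
      TensorProduct.map_tmul, MonoidHom.comp_apply]
    rw [← h]
    have ex : (⟨(a, b), hX⟩ : X) * inK₂ X (Subgroup.inclusion inf_le_left l) =
        inK₂ X (Subgroup.inclusion inf_le_left l') * ⟨(a, b), hX⟩ := by
      ext <;> simp [inK₂, l']
    have ey : (⟨(b, c), hY⟩ : Y) * inK₁ Y (Subgroup.inclusion inf_le_right l) =
        inK₁ Y (Subgroup.inclusion inf_le_right l') * ⟨(b, c), hY⟩ := by
      ext <;> simp [inK₁, l']
    simp only [← Module.End.mul_apply, ← map_mul, ex, ey]

theorem extTensorOp_mk (ρ : Representation k X V) (τ : Representation k Y W) (a : A) (b : B) (c : C)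
    (hX : (a, b) ∈ X) (hY : (b, c) ∈ Y) (v : V) (w : W) :
    extTensorOp ρ τ a b c hX hY (Coinvariants.mk _ (v ⊗ₜ w)) =
      Coinvariants.mk (extMidRep ρ τ) (ρ ⟨_, hX⟩ v ⊗ₜ τ ⟨_, hY⟩ w) := rfl

theorem extTensorOp_eq (ρ : Representation k X V) (τ : Representation k Y W) (a : A) (b b' : B)
    (c : C) (hX : (a, b) ∈ X) (hY : (b, c) ∈ Y) (hX' : (a, b') ∈ X) (hY' : (b', c) ∈ Y) :
    extTensorOp ρ τ a b c hX hY = extTensorOp ρ τ a b' c hX' hY' := by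
  ext v w
  have hl2 := X.mul_mem hX' (X.inv_mem hX)
  have hl1 := Y.mul_mem hY' (Y.inv_mem hY)
  let l : (k₂ X ⊓ k₁ Y : Subgroup B) :=
    ⟨b' * b⁻¹, by simpa [k₂] using hl2, by simpa [k₁] using hl1⟩
  have h := Coinvariants.mk_self_apply (extMidRep ρ τ) l (ρ ⟨_, hX⟩ v ⊗ₜ τ ⟨_, hY⟩ w)
  simp only [Representation.tprod_apply, MonoidHom.comp_apply, TensorProduct.map_tmul] at h
  simp only [TensorProduct.AlgebraTensorModule.curry_apply,
    LinearMap.restrictScalars_self, TensorProduct.curry_apply, LinearMap.comp_apply,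
    extTensorOp_mk]
  rw [← h]
  simp only [← Module.End.mul_apply, ← map_mul]
  congr 3
  · congr 2
    ext <;> simp [inK₂, l]
  · congr 2
    ext <;> simp [inK₁, l]

/-- The action of an element of `X * Y` on the extended tensor product. -/
def extTensorFun (ρ : Representation k X V) (τ : Representation k Y W) (z : starProd X Y) :
    ExtTensor ρ τ →ₗ[k] ExtTensor ρ τ :=
  extTensorOp ρ τ (z : A × C).1 (mem_starProd.1 z.2).choose (z : A × C).2
    (mem_starProd.1 z.2).choose_spec.1 (mem_starProd.1 z.2).choose_spec.2

theorem extTensorFun_mk (ρ : Representation k X V) (τ : Representation k Y W)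
    (z : starProd X Y) (b : B) (hX : ((z : A × C).1, b) ∈ X) (hY : (b, (z : A × C).2) ∈ Y)
    (v : V) (w : W) :
    extTensorFun ρ τ z (Coinvariants.mk _ (v ⊗ₜ w)) =
      Coinvariants.mk (extMidRep ρ τ) (ρ ⟨_, hX⟩ v ⊗ₜ τ ⟨_, hY⟩ w) := by
  rw [← extTensorOp_mk]
  exact congrArg (fun f : ExtTensor ρ τ →ₗ[k] ExtTensor ρ τ => f _)
    (extTensorOp_eq ρ τ _ _ _ _ _ _ _ _)

/-- The extended tensor product: the `k[X * Y]`-module `V ⊗_{k[k₂(X) ∩ k₁(Y)]} W` with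
`(a,c)(v ⊗ w) = (a,b) v ⊗ (b,c) w` for any `b` with `(a,b) ∈ X` and `(b,c) ∈ Y`. -/
def extTensorRep (ρ : Representation k X V) (τ : Representation k Y W) :
    Representation k (starProd X Y) (ExtTensor ρ τ) where
  toFun z := extTensorFun ρ τ z
  map_one' := by
    ext v w
    have h1 : ρ ⟨((1 : A), (1 : B)), X.one_mem⟩ = 1 := map_one ρ
    have h2 : τ ⟨((1 : B), (1 : C)), Y.one_mem⟩ = 1 := map_one τ
    refine (extTensorFun_mk ρ τ 1 1 X.one_mem Y.one_mem v w).trans ?_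
    change Coinvariants.mk _ (ρ ⟨((1 : A), (1 : B)), X.one_mem⟩ v ⊗ₜ
      τ ⟨((1 : B), (1 : C)), Y.one_mem⟩ w) = _
    rw [h1, h2]
    rfl
  map_mul' z z' := by
    ext v w
    obtain ⟨b, hX, hY⟩ := mem_starProd.1 z.2
    obtain ⟨b', hX', hY'⟩ := mem_starProd.1 z'.2
    refine (extTensorFun_mk ρ τ (z * z') (b * b') (X.mul_mem hX hX') (Y.mul_mem hY hY') v w).trans ?_
    refine Eq.trans ?_ (congrArg (extTensorFun ρ τ z) (extTensorFun_mk ρ τ z' b' hX' hY' v w).symm)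
    rw [extTensorFun_mk ρ τ z b hX hY, ← Module.End.mul_apply, ← Module.End.mul_apply, ← map_mul,
      ← map_mul]
    rfl

theorem extTensorRep_mk (ρ : Representation k X V) (τ : Representation k Y W)
    (z : starProd X Y) (b : B) (hX : ((z : A × C).1, b) ∈ X) (hY : (b, (z : A × C).2) ∈ Y)
    (v : V) (w : W) :
    extTensorRep ρ τ z (Coinvariants.mk _ (v ⊗ₜ w)) =
      Coinvariants.mk (extMidRep ρ τ) (ρ ⟨_, hX⟩ v ⊗ₜ τ ⟨_, hY⟩ w) :=
  extTensorFun_mk ρ τ z b hX hY v w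

/-- Functoriality of the extended tensor product. -/
def extTensorMap {ρ : Representation k X V} {τ : Representation k Y W}
    {ρ' : Representation k X V'} {τ' : Representation k Y W'}
    (α : ρ.IntertwiningMap ρ') (β : τ.IntertwiningMap τ') :
    (extTensorRep ρ τ).IntertwiningMap (extTensorRep ρ' τ') :=
  ⟨Coinvariants.map _ _ (IntertwiningMap.tensor (resMap α _) (resMap β _)), fun x => by
      ext v w
      obtain ⟨b, hX, hY⟩ := mem_starProd.1 x.2
      have h1 := α.isIntertwining _ _ ⟨_, hX⟩ v
      have h2 := β.isIntertwining _ _ ⟨_, hY⟩ w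
      refine (congrArg (Coinvariants.map _ _ _) (extTensorRep_mk ρ τ x b hX hY v w)).trans ?_
      refine Eq.trans ?_ (extTensorRep_mk ρ' τ' x b hX hY (α v) (β w)).symm
      rw [← h1, ← h2]
      rfl⟩

theorem extTensorMap_mk {ρ : Representation k X V} {τ : Representation k Y W}
    {ρ' : Representation k X V'} {τ' : Representation k Y W'}
    (α : ρ.IntertwiningMap ρ') (β : τ.IntertwiningMap τ') (v : V) (w : W) :
    extTensorMap α β (Coinvariants.mk _ (v ⊗ₜ w)) =
      Coinvariants.mk (extMidRep ρ' τ') (α v ⊗ₜ β w) := rfl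

end Tensor

end BPDecomp

namespace BPDecomp

open Representation IsLocalRing

section TwDiag

variable {G H K : Type*} [Group G] [Group H] [Group K]
  {P : Subgroup G} {Q : Subgroup H} {R : Subgroup K}

/-- The isomorphism `Q → Δ(P,φ,Q)`, `y ↦ (φ(y), y)`. -/
def twDiagEquiv (φ : Q ≃* P) : Q ≃* twDiag φ :=
  MonoidHom.ofInjective fun _ _ h => Subtype.ext (congrArg Prod.snd h)

theorem coe_twDiagEquiv (φ : Q ≃* P) (y : Q) : (twDiagEquiv φ y : G × H) = ((φ y : G), (y : H)) :=
  rfl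

theorem mk_mem_twDiag (φ : Q ≃* P) (y : Q) : ((φ y : G), (y : H)) ∈ twDiag φ := ⟨y, rfl⟩

theorem starProd_twDiag {φ : Q ≃* P} {ψ : R ≃* Q} {σ : R ≃* P} (hσ : ψ.trans φ = σ) :
    starProd (twDiag φ) (twDiag ψ) = twDiag σ := by
  subst hσ
  ext ⟨a, c⟩
  constructor
  · rintro ⟨h, ⟨y, hy⟩, ⟨r, hr⟩⟩
    obtain ⟨rfl, rfl⟩ := Prod.mk.inj hy
    obtain ⟨h1, rfl⟩ := Prod.mk.inj hr
    refine ⟨r, Prod.ext ?_ rfl⟩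
    exact congrArg (fun y => (φ y : G)) (Subtype.ext h1)
  · rintro ⟨r, hr⟩
    obtain ⟨rfl, rfl⟩ := Prod.mk.inj hr
    exact ⟨ψ r, mk_mem_twDiag φ (ψ r), mk_mem_twDiag ψ r⟩

theorem mem_normalizer_starProd {X : Subgroup (G × H)} {Y : Subgroup (H × K)} {g : G} {h : H}
    {k : K} (hX : (g, h) ∈ Subgroup.normalizer (X : Set (G × H)))
    (hY : (h, k) ∈ Subgroup.normalizer (Y : Set (H × K))) :
    (g, k) ∈ Subgroup.normalizer (starProd X Y : Set (G × K)) := by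
  rw [Subgroup.mem_normalizer_iff] at *
  rintro ⟨a, c⟩
  constructor
  · rintro ⟨b, h1, h2⟩
    exact ⟨h * b * h⁻¹, (hX _).1 h1, (hY _).1 h2⟩
  · rintro ⟨b, h1, h2⟩
    refine ⟨h⁻¹ * b * h, (hX _).2 ?_, (hY _).2 ?_⟩
    · convert h1 using 1
      ext <;> simp [mul_assoc]
    · convert h2 using 1
      ext <;> simp [mul_assoc]

theorem mem_normalizer_twDiag {φ : Q ≃* P} {ψ : R ≃* Q} {σ : R ≃* P} (hσ : ψ.trans φ = σ) {g : G}
    {h : H} {k : K} (hX : (g, h) ∈ Subgroup.normalizer (twDiag φ : Set (G × H)))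
    (hY : (h, k) ∈ Subgroup.normalizer (twDiag ψ : Set (H × K))) :
    (g, k) ∈ Subgroup.normalizer (twDiag σ : Set (G × K)) := by
  rw [← starProd_twDiag hσ]
  exact mem_normalizer_starProd hX hY

theorem conj_of_mem_normalizer {φ : Q ≃* P} {g : G} {h : H}
    (hX : (g, h) ∈ Subgroup.normalizer (twDiag φ : Set (G × H))) (y : Q) :
    ∃ y' : Q, (y' : H) = h * y * h⁻¹ ∧ (φ y' : G) = g * φ y * g⁻¹ := by
  obtain ⟨y', hy'⟩ := (Subgroup.mem_normalizer_iff.1 hX _).1 (mk_mem_twDiag φ y)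
  obtain ⟨h1, h2⟩ := Prod.mk.inj hy'
  exact ⟨y', h2, h1⟩

theorem fst_mem_normalizer {φ : Q ≃* P} {g : G} {h : H}
    (hX : (g, h) ∈ Subgroup.normalizer (twDiag φ : Set (G × H))) :
    g ∈ Subgroup.normalizer (P : Set G) := by
  have key : ∀ (g : G) (h : H), (g, h) ∈ Subgroup.normalizer (twDiag φ : Set (G × H)) →
      ∀ x ∈ P, g * x * g⁻¹ ∈ P := fun g h hX x hx => by
    obtain ⟨y', -, h2⟩ := conj_of_mem_normalizer hX (φ.symm ⟨x, hx⟩)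
    rw [MulEquiv.apply_symm_apply] at h2
    exact h2 ▸ (φ y').2
  refine Subgroup.mem_normalizer_iff.2 fun x => ⟨key g h hX x, fun hx => ?_⟩
  have := key _ _ (Subgroup.inv_mem _ hX) _ hx
  simpa [mul_assoc] using this

theorem snd_mem_normalizer {φ : Q ≃* P} {g : G} {h : H}
    (hX : (g, h) ∈ Subgroup.normalizer (twDiag φ : Set (G × H))) :
    h ∈ Subgroup.normalizer (Q : Set H) := by
  have key : ∀ (g : G) (h : H), (g, h) ∈ Subgroup.normalizer (twDiag φ : Set (G × H)) →
      ∀ x ∈ Q, h * x * h⁻¹ ∈ Q := fun g h hX x hx => by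
    obtain ⟨y', h1, -⟩ := conj_of_mem_normalizer hX ⟨x, hx⟩
    exact h1 ▸ y'.2
  refine Subgroup.mem_normalizer_iff.2 fun x => ⟨key g h hX x, fun hx => ?_⟩
  have := key _ _ (Subgroup.inv_mem _ hX) _ hx
  simpa [mul_assoc] using this

theorem mk_mem_centralizer (φ : Q ≃* P) {g : G} {h : H}
    (hg : g ∈ Subgroup.centralizer (P : Set G)) (hh : h ∈ Subgroup.centralizer (Q : Set H)) :
    (g, h) ∈ Subgroup.centralizer (twDiag φ : Set (G × H)) := by
  rw [Subgroup.mem_centralizer_iff] at *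
  rintro _ ⟨y, rfl⟩
  exact Prod.ext (hg _ (φ y).2) (hh _ y.2)

/-- The inclusion `C_G(P) → C_{G × H}(Δ(P,φ,Q))`, `g ↦ (g,1)`. -/
def inlC (φ : Q ≃* P) :
    Subgroup.centralizer (P : Set G) →* Subgroup.centralizer (twDiag φ : Set (G × H)) where
  toFun g := ⟨((g : G), 1), mk_mem_centralizer φ g.2 (Subgroup.one_mem _)⟩
  map_one' := rfl
  map_mul' _ _ := by ext <;> simp

/-- The inclusion `C_H(Q) → C_{G × H}(Δ(P,φ,Q))`, `h ↦ (1,h)`. -/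
def inrC (φ : Q ≃* P) :
    Subgroup.centralizer (Q : Set H) →* Subgroup.centralizer (twDiag φ : Set (G × H)) where
  toFun h := ⟨(1, (h : H)), mk_mem_centralizer φ (Subgroup.one_mem _) h.2⟩
  map_one' := rfl
  map_mul' _ _ := by ext <;> simp

end TwDiag

section TensorPair

variable {F : Type*} [Field F] {G H K : Type*} [Group G] [Group H] [Group K]

/-- The antipode `f ↦ f^*` of a group algebra, that is, the linear map with `g ↦ g⁻¹`. -/
def antipode {A : Type*} [Group A] (f : MonoidAlgebra F A) : MonoidAlgebra F A :=
  MonoidAlgebra.mapDomain (fun a => a⁻¹) f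

theorem antipode_mapDomain {A B : Type*} [Group A] [Group B] (i : A →* B) (f : MonoidAlgebra F A) :
    antipode (MonoidAlgebra.mapDomain i f) = MonoidAlgebra.mapDomain i (antipode f) := by
  rw [antipode, antipode, mapDomain_mapDomain, mapDomain_mapDomain]
  simp only [map_inv]

/-- The element `e ⊗ f^*` of `F[C_{G × H}(Δ(P,φ,Q))] = F[C_G(P) × C_H(Q)]`. -/
def tensorElt {P : Subgroup G} {Q : Subgroup H} (φ : Q ≃* P)
    (e : MonoidAlgebra F (Subgroup.centralizer (P : Set G)))
    (f : MonoidAlgebra F (Subgroup.centralizer (Q : Set H))) :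
    MonoidAlgebra F (Subgroup.centralizer (twDiag φ : Set (G × H))) :=
  MonoidAlgebra.mapDomain (inlC φ) e * MonoidAlgebra.mapDomain (inrC φ) (antipode f)

/-- The pair `(Δ(P,φ,Q), e ⊗ f^*)` of `G × H`. -/
def tensorPair (x : LocalPair F G) (y : LocalPair F H) (φ : y.P ≃* x.P) : LocalPair F (G × H) :=
  ⟨twDiag φ, tensorElt φ x.e y.e⟩

theorem mapDomain_hom_mul {A B : Type*} [Group A] [Group B] (i : A →* B) (a b : MonoidAlgebra F A) :
    MonoidAlgebra.mapDomain i (a * b) =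
      MonoidAlgebra.mapDomain i a * MonoidAlgebra.mapDomain i b :=
  map_mul (MonoidAlgebra.mapDomainRingHom F i) a b

theorem emb_tensorPair (x : LocalPair F G) (y : LocalPair F H) (φ : y.P ≃* x.P) :
    (tensorPair x y φ).emb = MonoidAlgebra.mapDomain (MonoidHom.inl G H) x.emb *
      MonoidAlgebra.mapDomain (MonoidHom.inr G H) (antipode y.emb) := by
  have h := mapDomain_hom_mul (F := F)
    (Subgroup.centralizer (twDiag φ : Set (G × H))).subtype
    (MonoidAlgebra.mapDomain (inlC φ) x.e) (MonoidAlgebra.mapDomain (inrC φ) (antipode y.e))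
  refine Eq.trans h ?_
  rw [LocalPair.emb, LocalPair.emb, mapDomain_mapDomain, mapDomain_mapDomain, mapDomain_mapDomain,
    antipode, antipode, mapDomain_mapDomain, mapDomain_mapDomain, mapDomain_mapDomain]
  rfl

theorem mk_mem_pairStab {x : LocalPair F G} {y : LocalPair F H} {φ : y.P ≃* x.P} {g : G} {h : H}
    (hg : g ∈ pairStab x) (hh : h ∈ pairStab y)
    (hn : (g, h) ∈ Subgroup.normalizer (twDiag φ : Set (G × H))) :
    (g, h) ∈ pairStab (tensorPair x y φ) := by
  refine mem_pairStab.2 ⟨hn, ?_⟩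
  rw [emb_tensorPair]
  refine (mapDomain_hom_mul (MulAut.conj (g, h)).toMonoidHom _ _).trans ?_
  congr 1
  · conv_rhs => rw [← (mem_pairStab.1 hg).2]
    rw [mapDomain_mapDomain, mapDomain_mapDomain]
    congr 1
    ext a <;> simp
  · conv_rhs => rw [← (mem_pairStab.1 hh).2]
    rw [antipode, antipode, mapDomain_mapDomain, mapDomain_mapDomain, mapDomain_mapDomain,
      mapDomain_mapDomain]
    congr 1
    ext a <;> simp [mul_assoc]

theorem centralizer_le_pairStab {p : ℕ} (x : BrauerPair F p G) :
    Subgroup.centralizer (x.P : Set G) ≤ pairStab x.toLocalPair := by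
  intro c hc
  refine mem_pairStab.2 ⟨Subgroup.centralizer_le_normalizer _ hc, ?_⟩
  have h := Subring.mem_center_iff.1 x.isBlock.mem_center (MonoidAlgebra.single ⟨c, hc⟩ 1)
  have h2 : MonoidAlgebra.mapDomain (MulAut.conj (⟨c, hc⟩ : Subgroup.centralizer (x.P : Set G))) x.e
      = x.e := by
    have key : ∀ a : MonoidAlgebra F (Subgroup.centralizer (x.P : Set G)),
        MonoidAlgebra.mapDomain (MulAut.conj (⟨c, hc⟩ : Subgroup.centralizer (x.P : Set G))) a =
          MonoidAlgebra.single ⟨c, hc⟩ 1 * a * MonoidAlgebra.single ⟨c, hc⟩⁻¹ 1 := by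
      intro a
      induction a using MonoidAlgebra.induction_linear with
      | zero => simp
      | add u v hu hv => simp only [MonoidAlgebra.mapDomain_add, hu, hv, mul_add, add_mul]
      | single m r => simp [MonoidAlgebra.single_mul_single]
    rw [key, h, mul_assoc, MonoidAlgebra.single_mul_single]
    simp [← MonoidAlgebra.one_def]
  conv_rhs => rw [LocalPair.emb, ← h2]
  rw [LocalPair.emb, mapDomain_mapDomain, mapDomain_mapDomain]
  rfl

/-- The inclusion `C_G(P) × C_H(Q) → N_{G × H}(Δ(P,φ,Q), e ⊗ f^*)`. -/
def centHom {p : ℕ} (x : BrauerPair F p G) (y : BrauerPair F p H) (φ : y.P ≃* x.P) :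
    Subgroup.centralizer (x.P : Set G) × Subgroup.centralizer (y.P : Set H) →*
      pairStab (tensorPair x.toLocalPair y.toLocalPair φ) where
  toFun c := ⟨((c.1 : G), (c.2 : H)), mk_mem_pairStab (centralizer_le_pairStab x c.1.2)
    (centralizer_le_pairStab y c.2.2)
    (Subgroup.centralizer_le_normalizer _ (mk_mem_centralizer φ c.1.2 c.2.2))⟩
  map_one' := rfl
  map_mul' _ _ := rfl

/-- The group `N_{S × T}(Δ(P,σ,R))`. -/
def NST {P : Subgroup G} {R : Subgroup K} (S : Subgroup G) (σ : R ≃* P) (T : Subgroup K) :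
    Subgroup (G × K) :=
  S.prod T ⊓ Subgroup.normalizer (twDiag σ : Set (G × K))

theorem NST_le {x : LocalPair F G} {z : LocalPair F K} {S : Subgroup G} {T : Subgroup K}
    (hS : S ≤ pairStab x) (hT : T ≤ pairStab z) (σ : z.P ≃* x.P) :
    NST S σ T ≤ pairStab (tensorPair x z σ) :=
  fun _ hg => mk_mem_pairStab (hS hg.1.1) (hT hg.1.2) hg.2

end TensorPair

end BPDecomp

namespace BPDecomp

section Omega

variable {F : Type*} [Field F] {p : ℕ} {G H K : Type*} [Group G] [Group H] [Group K]

/-- The set `Ω` of triples `(φ,(Q,f),ψ)` where `(Q,f)` is a Brauer pair of `FH` and `φ : Q → P`,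
`ψ : R → Q` are isomorphisms with `φ ∘ ψ = σ`. -/
structure Omega (p : ℕ) (F : Type*) [Field F] (H : Type*) [Group H] {P : Subgroup G}
    {R : Subgroup K} (σ : R ≃* P) where
  /-- the Brauer pair `(Q,f)` -/
  y : BrauerPair F p H
  /-- the isomorphism `φ` -/
  φ : y.P ≃* P
  /-- the isomorphism `ψ` -/
  ψ : R ≃* y.P
  comp : ψ.trans φ = σ

namespace Omega

variable {P : Subgroup G} {R : Subgroup K} {σ : R ≃* P}

theorem ext_val {ω ω' : Omega p F H σ} (hy : ω.y = ω'.y)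
    (h : ∀ r : R, (ω.ψ r : H) = ω'.ψ r) : ω = ω' := by
  obtain ⟨y, φ, ψ, hc⟩ := ω
  obtain ⟨y', φ', ψ', hc'⟩ := ω'
  obtain rfl : y = y' := hy
  obtain rfl : ψ = ψ' := MulEquiv.ext fun r => Subtype.ext (h r)
  obtain rfl : φ = φ' := by
    ext q
    obtain ⟨r, rfl⟩ := ψ.surjective q
    rw [← hc'] at hc
    exact congrArg Subtype.val (DFunLike.congr_fun hc r)
  rfl

/-- The action `^{((g,k),h)}(φ,(Q,f),ψ) = (c_g φ c_h⁻¹, ^h(Q,f), c_h ψ c_k⁻¹)`. -/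
instance : SMul (Subgroup.normalizer (twDiag σ : Set (G × K)) × H) (Omega p F H σ) where
  smul a ω :=
    { y := a.2 • ω.y
      φ := (Subgroup.equivSMul (MulAut.conj a.2) ω.y.P).symm.trans
        (ω.φ.trans (P.normalizerMonoidHom ⟨(a.1 : G × K).1, fst_mem_normalizer a.1.2⟩))
      ψ := (R.normalizerMonoidHom ⟨(a.1 : G × K).2, snd_mem_normalizer a.1.2⟩)⁻¹.trans
        (ω.ψ.trans (Subgroup.equivSMul (MulAut.conj a.2) ω.y.P))
      comp := by
        ext r
        obtain ⟨r, rfl⟩ := (R.normalizerMonoidHom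
          ⟨(a.1 : G × K).2, snd_mem_normalizer a.1.2⟩).surjective r
        obtain ⟨r', h1, h2⟩ := conj_of_mem_normalizer a.1.2 r
        have h3 : R.normalizerMonoidHom ⟨(a.1 : G × K).2, snd_mem_normalizer a.1.2⟩ r = r' :=
          Subtype.ext h1.symm
        rw [h3, h2]
        have h4 : ω.φ (ω.ψ r) = σ r := DFunLike.congr_fun ω.comp r
        simp only [MulEquiv.trans_apply]
        rw [← h3]
        erw [MulAut.inv_apply_self]
        rw [MulEquiv.symm_apply_apply, h4]
        rfl }

theorem smul_y (a : Subgroup.normalizer (twDiag σ : Set (G × K)) × H) (ω : Omega p F H σ) :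
    (a • ω).y = a.2 • ω.y := rfl

theorem smul_ψ (a : Subgroup.normalizer (twDiag σ : Set (G × K)) × H) (ω : Omega p F H σ) (r : R) :
    ((a • ω).ψ r : H) = a.2 *
      ω.ψ ((R.normalizerMonoidHom ⟨(a.1 : G × K).2, snd_mem_normalizer a.1.2⟩)⁻¹ r) * a.2⁻¹ := rfl

instance : MulAction (Subgroup.normalizer (twDiag σ : Set (G × K)) × H) (Omega p F H σ) where
  one_smul ω := ext_val (one_smul H ω.y) fun r => by
    rw [smul_ψ]
    have : R.normalizerMonoidHom ⟨((1 : Subgroup.normalizer (twDiag σ : Set (G × K)) × H).1 :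
      G × K).2, snd_mem_normalizer
        (1 : Subgroup.normalizer (twDiag σ : Set (G × K)) × H).1.2⟩ = 1 :=
      map_one R.normalizerMonoidHom
    rw [this]
    simp
  mul_smul a b ω := ext_val (mul_smul a.2 b.2 ω.y) fun r => by
    rw [smul_ψ, smul_ψ, smul_ψ]
    have : (R.normalizerMonoidHom ⟨((a * b).1 : G × K).2, snd_mem_normalizer (a * b).1.2⟩) =
        R.normalizerMonoidHom ⟨(a.1 : G × K).2, snd_mem_normalizer a.1.2⟩ *
        R.normalizerMonoidHom ⟨(b.1 : G × K).2, snd_mem_normalizer b.1.2⟩ :=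
      map_mul R.normalizerMonoidHom ⟨(a.1 : G × K).2, snd_mem_normalizer a.1.2⟩
        ⟨(b.1 : G × K).2, snd_mem_normalizer b.1.2⟩
    rw [this]
    simp [mul_assoc]

end Omega

/-- The set `Λ` of pairs `(φ,(Q,f))` where `(Q,f)` is a Brauer pair of `FH` and `φ : Q → P` is an
isomorphism. -/
structure Lambda (p : ℕ) (F : Type*) [Field F] (H : Type*) [Group H] (P : Subgroup G) where
  /-- the Brauer pair `(Q,f)` -/
  y : BrauerPair F p H
  /-- the isomorphism `φ` -/
  φ : y.P ≃* P

namespace Lambda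

variable {P : Subgroup G}

/-- The triple `(φ,(Q,f),φ⁻¹)`. -/
def toOmega (l : Lambda p F H P) : Omega p F H (MulEquiv.refl P) where
  y := l.y
  φ := l.φ
  ψ := l.φ.symm
  comp := by ext; simp

theorem ext_val {l l' : Lambda p F H P} (hy : l.y = l'.y)
    (h : ∀ r : P, (l.φ.symm r : H) = l'.φ.symm r) : l = l' := by
  have h2 : l.toOmega = l'.toOmega := Omega.ext_val hy h
  exact congrArg (fun ω : Omega p F H (MulEquiv.refl P) => (⟨ω.y, ω.φ⟩ : Lambda p F H P)) h2

/-- The action `^{(g,h)}(φ,(Q,f)) = (c_g φ c_h⁻¹, ^h(Q,f))`. -/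
instance : SMul (Subgroup.normalizer (P : Set G) × H) (Lambda p F H P) where
  smul a l :=
    { y := a.2 • l.y
      φ := (Subgroup.equivSMul (MulAut.conj a.2) l.y.P).symm.trans
        (l.φ.trans (P.normalizerMonoidHom a.1)) }

theorem smul_φ (a : Subgroup.normalizer (P : Set G) × H) (l : Lambda p F H P) (r : P) :
    ((a • l).φ.symm r : H) = a.2 * l.φ.symm ((P.normalizerMonoidHom a.1)⁻¹ r) * a.2⁻¹ := rfl

instance : MulAction (Subgroup.normalizer (P : Set G) × H) (Lambda p F H P) where
  one_smul l := ext_val (one_smul H l.y) fun r => by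
    rw [smul_φ]
    simp
  mul_smul a b l := ext_val (mul_smul a.2 b.2 l.y) fun r => by
    rw [smul_φ, smul_φ, smul_φ]
    simp [mul_assoc]

end Lambda

end Omega

end BPDecomp

namespace BPDecomp

open Representation IsLocalRing

section Phi

variable {O : Type*} [CommRing O] [IsLocalRing O] {G H K : Type*} [Group G] [Group H] [Group K]
  [Finite G] [Finite H] [Finite K] {V W : Type*} [AddCommGroup V] [Module O V] [AddCommGroup W]
  [Module O W] {ρ : Representation O (G × H) V} {τ : Representation O (H × K) W}
  {P : Subgroup G} {Q : Subgroup H} {R : Subgroup K} {φ : Q ≃* P} {ψ : R ≃* Q} {σ : R ≃* P}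

theorem tensor_fixed (hσ : ψ.trans φ = σ) (r : R) (v : V) (w : W) :
    tensorRep ρ τ ((σ r : G), (r : K)) (Coinvariants.mk _ (v ⊗ₜ w)) =
      Coinvariants.mk (midRep ρ τ) (ρ ((φ (ψ r) : G), (ψ r : H)) v ⊗ₜ
        τ ((ψ r : H), (r : K)) w) := by
  rw [tensorRep_mk ρ τ _ (ψ r : H)]
  have : φ (ψ r) = σ r := DFunLike.congr_fun hσ r
  rw [this]

/-- The map `Br(m) ↦ Br(m ⊗ n)` for a fixed point `n`. -/
def phiLeft (hσ : ψ.trans φ = σ) (n : fixedPts τ (twDiag ψ)) :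
    Brauer ρ (twDiag φ) →ₗ[ResidueField O] Brauer (tensorRep ρ τ) (twDiag σ) :=
  brauerMap ((twDiagEquiv φ).symm.trans (ψ.symm.trans (twDiagEquiv σ)))
    (Coinvariants.mk (midRep ρ τ) ∘ₗ (TensorProduct.mk O V W).flip n) fun x v => by
      obtain ⟨q, rfl⟩ := (twDiagEquiv φ).surjective x
      obtain ⟨r, rfl⟩ := ψ.surjective q
      have h : τ ((ψ r : H), (r : K)) n = n := n.2 _ (mk_mem_twDiag ψ r)
      have := tensor_fixed (ρ := ρ) (τ := τ) hσ r v n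
      rw [h] at this
      simp only [MulEquiv.trans_apply, MulEquiv.symm_apply_apply, coe_twDiagEquiv]
      exact this.symm

/-- The map `Br(n) ↦ Br(m ⊗ n)` for a fixed point `m`. -/
def phiRight (hσ : ψ.trans φ = σ) (m : fixedPts ρ (twDiag φ)) :
    Brauer τ (twDiag ψ) →ₗ[ResidueField O] Brauer (tensorRep ρ τ) (twDiag σ) :=
  brauerMap ((twDiagEquiv ψ).symm.trans (twDiagEquiv σ))
    (Coinvariants.mk (midRep ρ τ) ∘ₗ TensorProduct.mk O V W m) fun x w => by
      obtain ⟨r, rfl⟩ := (twDiagEquiv ψ).surjective x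
      have h : ρ ((φ (ψ r) : G), (ψ r : H)) m = m := m.2 _ (mk_mem_twDiag φ (ψ r))
      have := tensor_fixed (ρ := ρ) (τ := τ) hσ r m w
      rw [h] at this
      simp only [MulEquiv.trans_apply, MulEquiv.symm_apply_apply, coe_twDiagEquiv]
      exact this.symm

theorem mk_mem_fixedPts (hσ : ψ.trans φ = σ) (m : fixedPts ρ (twDiag φ))
    (n : fixedPts τ (twDiag ψ)) :
    Coinvariants.mk (midRep ρ τ) ((m : V) ⊗ₜ (n : W)) ∈ fixedPts (tensorRep ρ τ) (twDiag σ) := by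
  rintro _ ⟨r, rfl⟩
  refine (tensor_fixed hσ r (m : V) (n : W)).trans ?_
  rw [m.2 _ (mk_mem_twDiag φ (ψ r)), n.2 _ (mk_mem_twDiag ψ r)]

theorem phiLeft_Br (hσ : ψ.trans φ = σ) (m : fixedPts ρ (twDiag φ))
    (n : fixedPts τ (twDiag ψ)) :
    phiLeft hσ n (Br ρ _ m) = Br (tensorRep ρ τ) (twDiag σ) ⟨_, mk_mem_fixedPts hσ m n⟩ := rfl

theorem phiRight_Br (hσ : ψ.trans φ = σ) (m : fixedPts ρ (twDiag φ))
    (n : fixedPts τ (twDiag ψ)) :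
    phiRight hσ m (Br τ _ n) = Br (tensorRep ρ τ) (twDiag σ) ⟨_, mk_mem_fixedPts hσ m n⟩ := rfl

/-- The `O`-bilinear version of `Phi`. -/
def phiAux (hσ : ψ.trans φ = σ) : Brauer τ (twDiag ψ) →ₗ[O] Brauer ρ (twDiag φ) →ₗ[O]
    Brauer (tensorRep ρ τ) (twDiag σ) :=
  (traceSub τ (twDiag ψ)).liftQ
    { toFun := fun n => (phiLeft (ρ := ρ) hσ n).restrictScalars O
      map_add' := fun n n' => by
        ext x
        obtain ⟨m, rfl⟩ := Br_surjective ρ _ x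
        exact (phiRight (τ := τ) hσ m).map_add (Br τ _ n) (Br τ _ n')
      map_smul' := fun c n => by
        ext x
        obtain ⟨m, rfl⟩ := Br_surjective ρ _ x
        exact ((phiRight (τ := τ) hσ m).restrictScalars O).map_smul c (Br τ _ n) }
    fun n hn => by
      rw [LinearMap.mem_ker]
      ext x
      obtain ⟨m, rfl⟩ := Br_surjective ρ _ x
      have h : Br τ (twDiag ψ) n = 0 := (Submodule.Quotient.mk_eq_zero _).2 hn
      change phiRight hσ m (Br τ _ n) = 0
      rw [h, map_zero]

/-- The bilinear map `M(Δ(P,φ,Q)) × N(Δ(Q,ψ,R)) → (M ⊗_{OH} N)(Δ(P,σ,R))`,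
`(Br(m), Br(n)) ↦ Br(m ⊗ n)`. -/
def Phi (hσ : ψ.trans φ = σ) :
    Brauer ρ (twDiag φ) →ₗ[ResidueField O] Brauer τ (twDiag ψ) →ₗ[ResidueField O]
      Brauer (tensorRep ρ τ) (twDiag σ) :=
  LinearMap.mk₂ _ (fun x y => phiAux hσ y x) (fun x x' y => map_add _ _ _)
    (fun c x y => by
      obtain ⟨c, rfl⟩ := residue_surjective c
      exact (phiAux hσ y).map_smul c x)
    (fun x y y' => by rw [map_add, LinearMap.add_apply])
    (fun c x y => by
      obtain ⟨c, rfl⟩ := residue_surjective c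
      exact congrArg (fun f : Brauer ρ (twDiag φ) →ₗ[O] Brauer (tensorRep ρ τ) (twDiag σ) => f x)
        ((phiAux hσ).map_smul c y))

theorem Phi_Br (hσ : ψ.trans φ = σ) (m : fixedPts ρ (twDiag φ)) (n : fixedPts τ (twDiag ψ)) :
    Phi hσ (Br ρ _ m) (Br τ _ n) =
      Br (tensorRep ρ τ) (twDiag σ) ⟨_, mk_mem_fixedPts hσ m n⟩ := rfl

theorem Phi_equivariant (hσ : ψ.trans φ = σ) {g : G} {h : H} {k : K}
    (h1 : (g, h) ∈ Subgroup.normalizer (twDiag φ : Set (G × H)))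
    (h2 : (h, k) ∈ Subgroup.normalizer (twDiag ψ : Set (H × K)))
    (h3 : (g, k) ∈ Subgroup.normalizer (twDiag σ : Set (G × K)))
    (x : Brauer ρ (twDiag φ)) (y : Brauer τ (twDiag ψ)) :
    Phi hσ (brauerRep ρ _ ⟨_, h1⟩ x) (brauerRep τ _ ⟨_, h2⟩ y) =
      brauerRep (tensorRep ρ τ) (twDiag σ) ⟨_, h3⟩ (Phi hσ x y) := by
  obtain ⟨m, rfl⟩ := Br_surjective ρ _ x
  obtain ⟨n, rfl⟩ := Br_surjective τ _ y
  rw [brauerRep_Br, brauerRep_Br, Phi_Br, Phi_Br, brauerRep_Br]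
  refine congrArg (Br _ _) (Subtype.ext ?_)
  exact (tensorRep_mk ρ τ g h k (m : V) (n : W)).symm

theorem brauerAct_single {Γ : Type*} [Group Γ] [Finite Γ] {U : Type*} [AddCommGroup U] [Module O U]
    (π : Representation O Γ U) (D : Subgroup Γ) (c : Subgroup.centralizer (D : Set Γ))
    (r : ResidueField O) (v : Brauer π D) :
    brauerAct π D (MonoidAlgebra.single c r) v =
      r • brauerRep π D ⟨c, Subgroup.centralizer_le_normalizer _ c.2⟩ v := by
  rw [brauerAct, Representation.asAlgebraHom_single]
  rfl

theorem Phi_left (hσ : ψ.trans φ = σ)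
    (a : MonoidAlgebra (ResidueField O) (Subgroup.centralizer (P : Set G)))
    (x : Brauer ρ (twDiag φ)) (y : Brauer τ (twDiag ψ)) :
    Phi hσ (brauerAct ρ _ (MonoidAlgebra.mapDomain (inlC φ) a) x) y =
      brauerAct (tensorRep ρ τ) (twDiag σ) (MonoidAlgebra.mapDomain (inlC σ) a)
        (Phi hσ x y) := by
  induction a using MonoidAlgebra.induction_linear with
  | zero => simp
  | add u v hu hv => simp only [MonoidAlgebra.mapDomain_add, map_add, LinearMap.add_apply, hu, hv]
  | single c r =>
    rw [MonoidAlgebra.mapDomain_single, MonoidAlgebra.mapDomain_single, brauerAct_single,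
      brauerAct_single, map_smul, LinearMap.smul_apply]
    congr 1
    have h := Phi_equivariant hσ (ρ := ρ) (τ := τ) (g := (c : G)) (h := 1) (k := 1)
      (Subgroup.centralizer_le_normalizer _ (inlC φ c).2) (Subgroup.one_mem _)
      (Subgroup.centralizer_le_normalizer _ (inlC σ c).2) x y
    have h1 : brauerRep τ (twDiag ψ) ⟨((1 : H), (1 : K)), Subgroup.one_mem _⟩ = 1 := map_one _
    rw [h1] at h
    exact h

theorem Phi_right (hσ : ψ.trans φ = σ)
    (a : MonoidAlgebra (ResidueField O) (Subgroup.centralizer (R : Set K)))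
    (x : Brauer ρ (twDiag φ)) (y : Brauer τ (twDiag ψ)) :
    Phi hσ x (brauerAct τ _ (MonoidAlgebra.mapDomain (inrC ψ) a) y) =
      brauerAct (tensorRep ρ τ) (twDiag σ) (MonoidAlgebra.mapDomain (inrC σ) a)
        (Phi hσ x y) := by
  induction a using MonoidAlgebra.induction_linear with
  | zero => simp
  | add u v hu hv => simp only [MonoidAlgebra.mapDomain_add, map_add, LinearMap.add_apply, hu, hv]
  | single c r =>
    rw [MonoidAlgebra.mapDomain_single, MonoidAlgebra.mapDomain_single, brauerAct_single,
      brauerAct_single, map_smul]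
    congr 1
    have h := Phi_equivariant hσ (ρ := ρ) (τ := τ) (g := 1) (h := 1) (k := (c : K))
      (Subgroup.one_mem _) (Subgroup.centralizer_le_normalizer _ (inrC ψ c).2)
      (Subgroup.centralizer_le_normalizer _ (inrC σ c).2) x y
    have h1 : brauerRep ρ (twDiag φ) ⟨((1 : G), (1 : H)), Subgroup.one_mem _⟩ = 1 := map_one _
    rw [h1] at h
    exact h

theorem inlC_mul_inrC {F : Type*} [Field F] (φ : Q ≃* P)
    (a : MonoidAlgebra F (Subgroup.centralizer (P : Set G)))
    (b : MonoidAlgebra F (Subgroup.centralizer (Q : Set H))) :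
    MonoidAlgebra.mapDomain (inlC φ) a * MonoidAlgebra.mapDomain (inrC φ) b =
      MonoidAlgebra.mapDomain (inrC φ) b * MonoidAlgebra.mapDomain (inlC φ) a := by
  induction a using MonoidAlgebra.induction_linear with
  | zero => simp
  | add u v hu hv => simp only [MonoidAlgebra.mapDomain_add, add_mul, mul_add, hu, hv]
  | single c r =>
    induction b using MonoidAlgebra.induction_linear with
    | zero => simp
    | add u v hu hv => simp only [MonoidAlgebra.mapDomain_add, add_mul, mul_add, hu, hv]
    | single d s =>
      rw [MonoidAlgebra.mapDomain_single, MonoidAlgebra.mapDomain_single,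
        MonoidAlgebra.single_mul_single, MonoidAlgebra.single_mul_single, mul_comm r s]
      congr 1
      ext <;> simp [inlC, inrC]

end Phi

end BPDecomp

namespace BPDecomp

open Representation IsLocalRing

section CutPhi

variable {O : Type*} [CommRing O] [IsLocalRing O] {G H K : Type*} [Group G] [Group H] [Group K]
  [Finite G] [Finite H] [Finite K] {V W : Type*} [AddCommGroup V] [Module O V] [AddCommGroup W]
  [Module O W] (ρ : Representation O (G × H) V) (τ : Representation O (H × K) W)
  {x : LocalPair (ResidueField O) G} {y : LocalPair (ResidueField O) H}
  {z : LocalPair (ResidueField O) K} {φ : y.P ≃* x.P} {ψ : z.P ≃* y.P} {σ : z.P ≃* x.P}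

theorem Phi_mem_cut (hσ : ψ.trans φ = σ) (a : cut ρ (tensorPair x y φ))
    (b : cut τ (tensorPair y z ψ)) :
    Phi hσ a.1 b.1 ∈
      cut (tensorRep ρ τ) (tensorPair x z σ) := by
  obtain ⟨_, a, rfl⟩ := a
  obtain ⟨_, b, rfl⟩ := b
  refine ⟨Phi hσ (brauerAct ρ _ (MonoidAlgebra.mapDomain (inrC φ) (antipode y.e)) a)
    (brauerAct τ _ (MonoidAlgebra.mapDomain (inlC ψ) y.e) b), ?_⟩
  have h1 : brauerAct ρ (twDiag φ) (tensorElt φ x.e y.e) a =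
      brauerAct ρ _ (MonoidAlgebra.mapDomain (inlC φ) x.e)
        (brauerAct ρ _ (MonoidAlgebra.mapDomain (inrC φ) (antipode y.e)) a) :=
    DFunLike.congr_fun (map_mul (brauerAct ρ (twDiag φ)) _ _) a
  have h2 : brauerAct τ (twDiag ψ) (tensorElt ψ y.e z.e) b =
      brauerAct τ _ (MonoidAlgebra.mapDomain (inrC ψ) (antipode z.e))
        (brauerAct τ _ (MonoidAlgebra.mapDomain (inlC ψ) y.e) b) := by
    refine Eq.trans ?_ (DFunLike.congr_fun (map_mul (brauerAct τ (twDiag ψ)) _ _) b)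
    rw [← inlC_mul_inrC]
    rfl
  change _ = Phi hσ (brauerAct ρ (twDiag φ) (tensorElt φ x.e y.e) a)
    (brauerAct τ (twDiag ψ) (tensorElt ψ y.e z.e) b)
  rw [h1, h2, Phi_left, Phi_right]
  exact DFunLike.congr_fun (map_mul (brauerAct (tensorRep ρ τ) (twDiag σ)) _ _) _

/-- The restriction of `Phi` to `eM(Δ(P,φ,Q))f × fN(Δ(Q,ψ,R))d`. -/
def cutPhi (hσ : ψ.trans φ = σ) :
    cut ρ (tensorPair x y φ) →ₗ[ResidueField O] cut τ (tensorPair y z ψ) →ₗ[ResidueField O]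
      cut (tensorRep ρ τ) (tensorPair x z σ) :=
  LinearMap.mk₂ _ (fun a b => ⟨Phi hσ a.1 b.1,
      Phi_mem_cut ρ τ hσ a b⟩)
    (fun a a' b => Subtype.ext (LinearMap.map_add₂ (Phi hσ) _ _ _))
    (fun c a b => Subtype.ext (LinearMap.map_smul₂ (Phi hσ) _ _ _))
    (fun a b b' => Subtype.ext (map_add (Phi hσ a.1) _ _))
    (fun c a b => Subtype.ext (map_smul (Phi hσ a.1) _ _))

variable {ρ τ} in
theorem cutPhi_equivariant (hσ : ψ.trans φ = σ) {g : G} {h : H} {k : K}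
    (h1 : (g, h) ∈ pairStab (tensorPair x y φ)) (h2 : (h, k) ∈ pairStab (tensorPair y z ψ))
    (h3 : (g, k) ∈ pairStab (tensorPair x z σ)) (a : cut ρ (tensorPair x y φ))
    (b : cut τ (tensorPair y z ψ)) :
    cutPhi ρ τ hσ (cutRep ρ _ ⟨_, h1⟩ a) (cutRep τ _ ⟨_, h2⟩ b) =
      cutRep (tensorRep ρ τ) (tensorPair x z σ) ⟨_, h3⟩ (cutPhi ρ τ hσ a b) :=
  Subtype.ext (Phi_equivariant hσ (pairStab_le_normalizer _ h1) (pairStab_le_normalizer _ h2)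
    (pairStab_le_normalizer _ h3) _ _)

end CutPhi

section Bimodules

variable {p : ℕ} {O : Type*} [CommRing O] [IsLocalRing O] {G H K : Type*} [Group G] [Group H]
  [Group K] [Finite G] [Finite H] [Finite K] {V W : Type*} [AddCommGroup V] [Module O V]
  [AddCommGroup W] [Module O W]

/-- The `(F[C_G(P)], F[C_H(Q)])`-bimodule `eM(Δ(P,φ,Q))f`. -/
def bimodRep (ρ : Representation O (G × H) V) (x : BrauerPair (ResidueField O) p G)
    (y : BrauerPair (ResidueField O) p H) (φ : y.P ≃* x.P) :
    Representation (ResidueField O)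
      (Subgroup.centralizer (x.P : Set G) × Subgroup.centralizer (y.P : Set H))
      (cut ρ (tensorPair x.toLocalPair y.toLocalPair φ)) :=
  (cutRep ρ (tensorPair x.toLocalPair y.toLocalPair φ)).comp (centHom x y φ)

variable (ρ : Representation O (G × H) V) (τ : Representation O (H × K) W)
  {x : BrauerPair (ResidueField O) p G} {z : BrauerPair (ResidueField O) p K} {σ : z.P ≃* x.P}

/-- The homomorphism `Φ_ω : eM(Δ(P,φ,Q))f ⊗_{F[C_H(Q)]} fN(Δ(Q,ψ,R))d → e(M ⊗_{OH} N)(Δ(P,σ,R))d`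
of `(F[C_G(P)], F[C_K(R)])`-bimodules, `Br(m) ⊗ Br(n) ↦ Br(m ⊗ n)`. -/
def PhiBimod (ω : Omega p (ResidueField O) H σ) :
    (tensorRep (bimodRep ρ x ω.y ω.φ) (bimodRep τ ω.y z ω.ψ)).IntertwiningMap
      (bimodRep (tensorRep ρ τ) x z σ) :=
  ⟨Coinvariants.lift _ (TensorProduct.lift (cutPhi ρ τ ω.comp)) fun c => by
      ext a b
      have h := cutPhi_equivariant (ρ := ρ) (τ := τ) ω.comp (centHom x ω.y ω.φ (1, c)).2
        (centHom ω.y z ω.ψ (c, 1)).2 (centHom x z σ (1, 1)).2 a b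
      have h1 : cutRep (tensorRep ρ τ) _ ⟨_, (centHom x z σ (1, 1)).2⟩ = 1 :=
        map_one (cutRep (tensorRep ρ τ) (tensorPair x.toLocalPair z.toLocalPair σ))
      exact congrArg Subtype.val (h.trans (DFunLike.congr_fun h1 _)),
    fun c => by
      ext a b
      have h := cutPhi_equivariant (ρ := ρ) (τ := τ) ω.comp (centHom x ω.y ω.φ (c.1, 1)).2
        (centHom ω.y z ω.ψ (1, c.2)).2 (centHom x z σ c).2 a b
      exact congrArg Subtype.val h⟩

theorem PhiBimod_mk (ω : Omega p (ResidueField O) H σ) (a : cut ρ (tensorPair _ _ ω.φ))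
    (b : cut τ (tensorPair _ _ ω.ψ)) :
    PhiBimod ρ τ ω (Coinvariants.mk _ (a ⊗ₜ b)) = cutPhi ρ τ ω.comp a b := rfl

section Big

variable (S : Subgroup G) (T : Subgroup K)

/-- The group `X(ω) = N_{S × H}(Δ(P,φ,Q), e ⊗ f^*)`. -/
def XSub (x : BrauerPair (ResidueField O) p G) (y : BrauerPair (ResidueField O) p H)
    (φ : y.P ≃* x.P) : Subgroup (G × H) :=
  S.prod ⊤ ⊓ pairStab (tensorPair x.toLocalPair y.toLocalPair φ)

/-- The group `Y(ω) = N_{H × T}(Δ(Q,ψ,R), f ⊗ d^*)`. -/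
def YSub (y : BrauerPair (ResidueField O) p H) (z : BrauerPair (ResidueField O) p K)
    (ψ : z.P ≃* y.P) : Subgroup (H × K) :=
  (⊤ : Subgroup H).prod T ⊓ pairStab (tensorPair y.toLocalPair z.toLocalPair ψ)

variable {S T} in
theorem starProd_le_NST (ω : Omega p (ResidueField O) H σ) :
    starProd (XSub S x ω.y ω.φ) (YSub T ω.y z ω.ψ) ≤ NST S σ T := by
  rintro ⟨g, k⟩ ⟨h, h1, h2⟩
  exact ⟨⟨h1.1.1, h2.1.2⟩, mem_normalizer_twDiag ω.comp (pairStab_le_normalizer _ h1.2)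
    (pairStab_le_normalizer _ h2.2)⟩

/-- The `FX(ω)`-module `M(ω) = eM(Δ(P,φ,Q))f`. -/
def MRep (x : BrauerPair (ResidueField O) p G) (y : BrauerPair (ResidueField O) p H)
    (φ : y.P ≃* x.P) : Representation (ResidueField O) (XSub S x y φ)
      (cut ρ (tensorPair x.toLocalPair y.toLocalPair φ)) :=
  (cutRep ρ (tensorPair x.toLocalPair y.toLocalPair φ)).comp (Subgroup.inclusion inf_le_right)

/-- The `FY(ω)`-module `N(ω) = fN(Δ(Q,ψ,R))d`. -/
def NRep (y : BrauerPair (ResidueField O) p H) (z : BrauerPair (ResidueField O) p K)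
    (ψ : z.P ≃* y.P) : Representation (ResidueField O) (YSub T y z ψ)
      (cut τ (tensorPair y.toLocalPair z.toLocalPair ψ)) :=
  (cutRep τ (tensorPair y.toLocalPair z.toLocalPair ψ)).comp (Subgroup.inclusion inf_le_right)

variable {S T}

/-- `eL(Δ(P,σ,R))d` as a module for `F[N_{S × T}(Δ(P,σ,R))]`. -/
def NSTRep {U : Type*} [AddCommGroup U] [Module O U] (π : Representation O (G × K) U)
    (hS : S ≤ pairStab x.toLocalPair) (hT : T ≤ pairStab z.toLocalPair) (σ : z.P ≃* x.P) :
    Representation (ResidueField O) (NST S σ T)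
      (cut π (tensorPair x.toLocalPair z.toLocalPair σ)) :=
  (cutRep π (tensorPair x.toLocalPair z.toLocalPair σ)).comp (Subgroup.inclusion (NST_le hS hT σ))

variable {ρ τ} in
theorem phiExt_aux (ω : Omega p (ResidueField O) H σ)
    (c : (k₂ (XSub S x ω.y ω.φ) ⊓ k₁ (YSub T ω.y z ω.ψ) : Subgroup H)) :
    TensorProduct.lift (cutPhi ρ τ ω.comp) ∘ₗ
      extMidRep (MRep ρ S x ω.y ω.φ) (NRep τ T ω.y z ω.ψ) c =
        TensorProduct.lift (cutPhi ρ τ ω.comp) := by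
  ext a b
  have h := cutPhi_equivariant (ρ := ρ) (τ := τ) ω.comp c.2.1.2 c.2.2.2
    (Subgroup.one_mem _) a b
  have h1 : cutRep (tensorRep ρ τ) (tensorPair x.toLocalPair z.toLocalPair σ)
    ⟨(1, 1), Subgroup.one_mem _⟩ = 1 := map_one _
  exact congrArg Subtype.val (h.trans (DFunLike.congr_fun h1 _))

/-- The homomorphism `Φ_ω : M(ω) ⊗ N(ω) → e(M ⊗_{OH} N)(Δ(P,σ,R))d` of `F[X(ω) * Y(ω)]`-modules
on the extended tensor product, `Br(m) ⊗ Br(n) ↦ Br(m ⊗ n)`. -/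
def PhiExt (hS : S ≤ pairStab x.toLocalPair) (hT : T ≤ pairStab z.toLocalPair)
    (ω : Omega p (ResidueField O) H σ) :
    (extTensorRep (MRep ρ S x ω.y ω.φ) (NRep τ T ω.y z ω.ψ)).IntertwiningMap
      ((NSTRep (tensorRep ρ τ) hS hT σ).comp (Subgroup.inclusion (starProd_le_NST ω))) :=
  ⟨Coinvariants.lift _ (TensorProduct.lift (cutPhi ρ τ ω.comp)) (phiExt_aux ω),
    fun c => by
      ext a b
      obtain ⟨⟨g, k⟩, l, hX, hY⟩ := c
      have h := cutPhi_equivariant (ρ := ρ) (τ := τ) ω.comp hX.2 hY.2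
        (NST_le hS hT σ (starProd_le_NST ω ⟨l, hX, hY⟩)) a b
      refine congrArg Subtype.val (Eq.trans ?_ h)
      exact congrArg (Coinvariants.lift _ (TensorProduct.lift (cutPhi ρ τ ω.comp)) (phiExt_aux ω))
        (extTensorRep_mk (MRep ρ S x ω.y ω.φ) (NRep τ T ω.y z ω.ψ) _ l hX hY a b)⟩

theorem PhiExt_mk (hS : S ≤ pairStab x.toLocalPair) (hT : T ≤ pairStab z.toLocalPair)
    (ω : Omega p (ResidueField O) H σ) (a : cut ρ (tensorPair _ _ ω.φ))
    (b : cut τ (tensorPair _ _ ω.ψ)) :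
    PhiExt ρ τ hS hT ω (Coinvariants.mk _ (a ⊗ₜ b)) = cutPhi ρ τ ω.comp a b := rfl

/-- The homomorphism
`Ind_{X(ω) * Y(ω)}^{N_{S × T}(Δ(P,σ,R))} (M(ω) ⊗ N(ω)) → e(M ⊗_{OH} N)(Δ(P,σ,R))d` induced by
`Φ_ω`. -/
def PhiInd (hS : S ≤ pairStab x.toLocalPair) (hT : T ≤ pairStab z.toLocalPair)
    (ω : Omega p (ResidueField O) H σ) :
    (ind (Subgroup.inclusion (starProd_le_NST (S := S) (T := T) ω))
      (extTensorRep (MRep ρ S x ω.y ω.φ) (NRep τ T ω.y z ω.ψ))).IntertwiningMap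
      (NSTRep (tensorRep ρ τ) hS hT σ) :=
  indLift _ (PhiExt ρ τ hS hT ω)

end Big

end Bimodules

end BPDecomp

namespace BPDecomp

open Representation IsLocalRing

section Functoriality

variable {p : ℕ} {O : Type*} [CommRing O] [IsLocalRing O] {G H K : Type*} [Group G] [Group H]
  [Group K] [Finite G] [Finite H] [Finite K] {V V' W W' : Type*} [AddCommGroup V] [Module O V]
  [AddCommGroup V'] [Module O V'] [AddCommGroup W] [Module O W] [AddCommGroup W'] [Module O W']
  {ρ : Representation O (G × H) V} {ρ' : Representation O (G × H) V'}
  {τ : Representation O (H × K) W} {τ' : Representation O (H × K) W'}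

/-- Functoriality of `M ↦ eM(Δ(P,φ,Q))f`, for bimodules. -/
def bimodMap (α : ρ.IntertwiningMap ρ') (x : BrauerPair (ResidueField O) p G)
    (y : BrauerPair (ResidueField O) p H) (φ : y.P ≃* x.P) :
    (bimodRep ρ x y φ).IntertwiningMap (bimodRep ρ' x y φ) :=
  resMap (cutMap α (tensorPair x.toLocalPair y.toLocalPair φ)) (centHom x y φ)

/-- Functoriality of `M ↦ M(ω)`. -/
def MMap (α : ρ.IntertwiningMap ρ') (S : Subgroup G) (x : BrauerPair (ResidueField O) p G)
    (y : BrauerPair (ResidueField O) p H) (φ : y.P ≃* x.P) :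
    (MRep ρ S x y φ).IntertwiningMap (MRep ρ' S x y φ) :=
  resMap (cutMap α (tensorPair x.toLocalPair y.toLocalPair φ)) _

/-- Functoriality of `N ↦ N(ω)`. -/
def NMap (β : τ.IntertwiningMap τ') (T : Subgroup K) (y : BrauerPair (ResidueField O) p H)
    (z : BrauerPair (ResidueField O) p K) (ψ : z.P ≃* y.P) :
    (NRep τ T y z ψ).IntertwiningMap (NRep τ' T y z ψ) :=
  resMap (cutMap β (tensorPair y.toLocalPair z.toLocalPair ψ)) _

/-- Functoriality of `L ↦ eL(Δ(P,σ,R))d`, for `F[N_{S × T}(Δ(P,σ,R))]`-modules. -/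
def NSTMap {U U' : Type*} [AddCommGroup U] [Module O U] [AddCommGroup U'] [Module O U']
    {π : Representation O (G × K) U} {π' : Representation O (G × K) U'}
    (γ : π.IntertwiningMap π') {x : BrauerPair (ResidueField O) p G}
    {z : BrauerPair (ResidueField O) p K} {S : Subgroup G} {T : Subgroup K}
    (hS : S ≤ pairStab x.toLocalPair) (hT : T ≤ pairStab z.toLocalPair) (σ : z.P ≃* x.P) :
    (NSTRep π hS hT σ).IntertwiningMap (NSTRep π' hS hT σ) :=
  resMap (cutMap γ (tensorPair x.toLocalPair z.toLocalPair σ)) _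

end Functoriality

end BPDecomp

/-! The decomposition is verified on permutation bimodules, where everything can be read off a
basis, and then handed down to direct summands.

Let `V` and `W` have finite permuted bases `b` and `c` on which `H`, respectively `K`, acts freely
from the right. The tensor product over `OH` has the `H`-orbits of pairs (b_i, c_j) as a permuted
basis (`tensorBasis`). If a p-group permutes a basis, its fixed basis elements give a basis of the
Brauer construction (`brauerBasis`). So (V ⊗ W)(Δ(P,σ,R)) has a basis indexed by the fixed orbits.
If the orbit of (b_i, c_j) is fixed, then for each r in R there is an h with (σ(r),h) b_i = b_i and
(h,r) c_j = c_j. By freeness this h is unique and r ↦ h is an injective homomorphism ψ. With Q =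
ψ(R) and φ = σψ⁻¹, the element b_i is fixed by Δ(P,φ,Q) and c_j by Δ(Q,ψ,R)
(`exists_twDiag_of_fixed`). Another pair in the same orbit replaces ψ by c_h ψ
(`conj_eq_of_mk_tmul_eq`), and h centralizes Q when ψ does not change, which is exactly the relation
of the tensor product over F[C_H(Q)]. Inserting 1 = ∑ f, the sum of the blocks of F[C_H(Q)], refines
the pairs (φ,ψ) to triples.

The outcome is stored as `PhiSplit`: each Φ_ω has a linear retraction killing the image of every
Φ_ω' with ω' outside the `H`-orbit of ω, and all images together span. The retractions need not be
equivariant, so they may be written down on a basis (`phiSplit_of_permutes`), and by naturality the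
property passes to retracts (`PhiSplit.of_retract`).

The reduction is `exists_retract_rightFree`. Let A be an indecomposable summand of V with vertex D
and let E be a Sylow p-subgroup of D. Then E permutes a basis of V and [D:E] is a unit, so the
projection onto A factors through a permutation module induced from E
(`IsRelProjective.exists_factor`). Point stabilizers there lie in conjugates of E ≤ D, and since D
is twisted diagonal they contain no (1,h) with h ≠ 1.

The bimodule isomorphism is then formal (`sumLift_bijective`). For the normalizer version,
N_{S×T}(Δ(P,σ,R)) permutes the images of the Φ_ω as it permutes Ω (`exists_cutPhi_smul`), and an
element preserving the `H`-orbit of ω lies in X(ω) * Y(ω) (`mem_starProd_of_smul_eq`), so the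
retractions extend to the induced modules. That M(ω) and N(ω) are p-permutation modules rests on
`isPermutationRep_of_retract`, the closure of permutation modules of p-groups in characteristic p
under direct summands. For σ = id a triple is determined by (φ,(Q,f)), which turns Ω into Λ; the
shape of X(λ) * Y(λ) is `starProd_XSub_YSub`. -/

namespace BPDecomp

open Representation IsLocalRing

/-! ### Bases permuted by a subgroup. -/

section PermutedBasis

variable {k : Type*} [CommRing k] {Γ : Type*} [Group Γ] {V : Type*} [AddCommGroup V] [Module k V]
  {ι : Type*}

/-- The basis `b` is permuted by the subgroup `D`. -/
def Permutes (ρ : Representation k Γ V) (D : Subgroup Γ) (b : Module.Basis ι k V) : Prop :=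
  ∀ g ∈ D, ∀ i, ∃ j, ρ g (b i) = b j

variable {ρ : Representation k Γ V} {D : Subgroup Γ} {b : Module.Basis ι k V}

theorem Permutes.mono {E : Subgroup Γ} (hb : Permutes ρ D b) (h : E ≤ D) : Permutes ρ E b :=
  fun g hg => hb g (h hg)

theorem rep_injective (ρ : Representation k Γ V) (g : Γ) : Function.Injective (ρ g) := by
  intro v w h
  simpa [← Module.End.mul_apply, ← map_mul] using congrArg (ρ g⁻¹) h

/-- It is enough to compare the two coordinate functionals on the basis, where injectivity of `ρ g`
shows that only b_i is sent to b_j. -/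
theorem Permutes.repr_rep [Nontrivial k] (hb : Permutes ρ D b) {g : Γ} (hg : g ∈ D) {i j : ι}
    (hi : ρ g (b i) = b j) (v : V) : b.repr (ρ g v) j = b.repr v i := by
  classical
  have : b.coord j ∘ₗ ρ g = b.coord i := by
    refine b.ext fun l => ?_
    obtain ⟨l', hl'⟩ := hb g hg l
    have h : l' = j ↔ l = i := by
      constructor
      · rintro rfl
        exact b.injective (rep_injective ρ g (hl'.trans hi.symm))
      · rintro rfl
        exact b.injective (hl'.symm.trans hi)
    simp [hl', Finsupp.single_apply, h]
  exact DFunLike.congr_fun this v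

/-- The action of `D` on the index set of a permuted basis. -/
@[reducible]
def Permutes.mulAction [Nontrivial k] (hb : Permutes ρ D b) : MulAction D ι where
  smul g i := (hb g g.2 i).choose
  one_smul i := b.injective <| (hb (1 : D) (1 : D).2 i).choose_spec.symm.trans (by simp)
  mul_smul g h i := b.injective <| by
    refine (hb (g * h : D) (g * h : D).2 i).choose_spec.symm.trans ?_
    refine Eq.trans ?_ (hb g g.2 _).choose_spec
    refine Eq.trans ?_ (congrArg (ρ g) (hb h h.2 i).choose_spec)
    simp

theorem Permutes.rep_apply [Nontrivial k] (hb : Permutes ρ D b) (g : D) (i : ι) :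
    letI := hb.mulAction
    ρ g (b i) = b (g • i) := (hb g g.2 i).choose_spec

end PermutedBasis

/-! ### The Brauer construction of a permutation module. -/

section BrauerBasis

variable {p : ℕ} [Fact p.Prime] {O : Type*} [CommRing O] [IsLocalRing O] [CharP (ResidueField O) p]
  {Γ : Type*} [Group Γ] [Finite Γ] {V : Type*} [AddCommGroup V] [Module O V]
  {ι : Type*} {ρ : Representation O Γ V} {D : Subgroup Γ} {b : Module.Basis ι O V}

/-- The index is a power of p different from 1. This is what makes relative traces from proper
subgroups invisible at fixed basis elements. -/
theorem index_subgroupOf_cast (hD : IsPGroup p D) {Q : Subgroup Γ} (hQ : Q < D) :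
    (Nat.card (D ⧸ Q.subgroupOf D) : ResidueField O) = 0 := by
  obtain ⟨n, hn⟩ := hD.index (Q.subgroupOf D)
  change ((Q.subgroupOf D).index : ResidueField O) = 0
  have : (Q.subgroupOf D).index ≠ 1 := fun h =>
    hQ.not_ge (Subgroup.subgroupOf_eq_top.1 (Subgroup.index_eq_one.1 h))
  rw [hn] at this ⊢
  have h0 : n ≠ 0 := by rintro rfl; simp at this
  rw [Nat.cast_pow, CharP.cast_eq_zero, zero_pow h0]

/-- The coordinate maps of a permuted basis at the fixed basis elements, on `V(D)`. -/
def brauerCoordAux (hD : IsPGroup p D) (hb : Permutes ρ D b)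
    (i : {i // b i ∈ fixedPts ρ D}) : Brauer ρ D →ₗ[O] ResidueField O :=
  (traceSub ρ D).liftQ
    ((Algebra.linearMap O (ResidueField O)) ∘ₗ b.coord i ∘ₗ (fixedPts ρ D).subtype) <| by
    refine sup_le ?_ (iSup₂_le fun Q hQ => ?_)
    · rw [Submodule.smul_le]
      intro r hr n _
      rw [LinearMap.mem_ker, map_smul]
      have : residue O r = 0 := (residue_eq_zero_iff r).2 hr
      rw [Algebra.smul_def]
      exact (congrArg (· * _) this).trans (zero_mul _)
    · rintro ⟨_, hm⟩ ⟨v, hv, rfl⟩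
      classical
      have := Fintype.ofFinite (D ⧸ Q.subgroupOf D)
      rw [LinearMap.mem_ker]
      change algebraMap O (ResidueField O) (b.repr (relTrace ρ Q D v) i) = 0
      rw [relTrace_apply, finsum_eq_sum_of_fintype, map_sum, Finsupp.finsetSum_apply]
      -- Since b_i is fixed by `D`, all translates of `v` have the same i-th coordinate. The trace
      -- therefore has [D:Q] times that coordinate, which is zero in the residue field.
      have h : ∀ x : D ⧸ Q.subgroupOf D,
          b.repr (ρ ((x.out : D) : Γ) v) i = b.repr v i := fun x =>
        hb.repr_rep x.out.2 (i.2 _ x.out.2) v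
      rw [Finset.sum_congr rfl fun x _ => h x, Finset.sum_const, Finset.card_univ,
        ← Nat.card_eq_fintype_card, nsmul_eq_mul, map_mul, map_natCast,
        index_subgroupOf_cast hD hQ, zero_mul]

/-- The coordinate maps of a permuted basis at the fixed basis elements, on `V(D)`. -/
def brauerCoord (hD : IsPGroup p D) (hb : Permutes ρ D b) :
    Brauer ρ D →ₗ[ResidueField O] ({i // b i ∈ fixedPts ρ D} → ResidueField O) :=
  LinearMap.pi fun i => toResidue (brauerCoordAux hD hb i)

theorem brauerCoord_Br (hD : IsPGroup p D) (hb : Permutes ρ D b) (v : fixedPts ρ D)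
    (i : {i // b i ∈ fixedPts ρ D}) :
    brauerCoord hD hb (Br ρ D v) i = residue O (b.repr v i) := rfl

/-- Orbit-stabilizer: `Q` is the stabilizer of `i`, whose cosets in `D` index the orbit. The case Q
= D is allowed, and the clause on `D ≤ Q` singles it out. -/
theorem sum_orbit_eq_relTrace [Fintype ι] (hb : Permutes ρ D b) (i : ι) :
    letI := hb.mulAction
    letI := Classical.decRel (MulAction.orbitRel D ι)
    ∃ Q : Subgroup Γ, (b i ∈ fixedPts ρ Q) ∧ (Q ≤ D) ∧ (D ≤ Q → b i ∈ fixedPts ρ D) ∧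
      ∑ j with MulAction.orbitRel D ι j i, b j = relTrace ρ Q D (b i) := by
  classical
  let := hb.mulAction
  have := Fintype.ofFinite (D ⧸ ((MulAction.stabilizer D i).map D.subtype).subgroupOf D)
  have hfix : b i ∈ fixedPts ρ ((MulAction.stabilizer D i).map D.subtype) := by
    rintro _ ⟨x, hx, rfl⟩
    exact (hb.rep_apply x i).trans (congrArg b hx)
  refine ⟨(MulAction.stabilizer D i).map D.subtype, hfix, ?_, fun h x hx => hfix _ (h hx), ?_⟩
  · rintro _ ⟨x, _, rfl⟩
    exact x.2
  · rw [relTrace_apply, finsum_eq_sum_of_fintype]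
    symm
    have hmem : ∀ x : D, x ∈ ((MulAction.stabilizer D i).map D.subtype).subgroupOf D ↔
        x • i = i := fun x => by
      rw [Subgroup.mem_subgroupOf]
      exact Subgroup.mem_map_iff_mem (K := MulAction.stabilizer D i) D.subtype_injective
    refine Finset.sum_bij (fun x _ => x.out • i) (fun x _ => ?_) (fun x _ y _ h => ?_)
      (fun j hj => ?_) (fun x _ => hb.rep_apply _ i)
    · simpa using! ⟨x.out, rfl⟩
    · rw [← QuotientGroup.out_eq' x, ← QuotientGroup.out_eq' y, QuotientGroup.eq, hmem, mul_smul,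
        ← h, inv_smul_smul]
    · obtain ⟨g, rfl⟩ := (Finset.mem_filter.1 hj).2
      refine ⟨QuotientGroup.mk g, Finset.mem_univ _, ?_⟩
      have h2 : QuotientGroup.mk (QuotientGroup.mk g :
        D ⧸ ((MulAction.stabilizer D i).map D.subtype).subgroupOf D).out = QuotientGroup.mk g :=
          QuotientGroup.out_eq' _
      rw [QuotientGroup.eq, hmem, mul_smul, inv_smul_eq_iff] at h2
      exact h2.symm

/-- A `D`-fixed vector has constant coordinates on `D`-orbits, hence is a combination of orbit sums.
A one-element orbit contributes a fixed basis element; any other orbit sum is a trace from a proper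
subgroup and dies in the quotient. -/
theorem span_Br_eq_top [Finite ι] (hb : Permutes ρ D b) :
    Submodule.span (ResidueField O)
      (Set.range fun i : {i // b i ∈ fixedPts ρ D} => Br ρ D ⟨b i, i.2⟩) = ⊤ := by
  classical
  have := Fintype.ofFinite ι
  let := hb.mulAction
  rw [eq_top_iff]
  rintro x -
  obtain ⟨v, rfl⟩ := Br_surjective ρ D x
  let c : ι → O := fun i => b.repr v i
  have hc : ∀ (g : D) i, c (g • i) = c i := fun g i => by
    have := hb.repr_rep g.2 (hb.rep_apply g i) v
    rwa [v.2 _ g.2] at this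
  let t : Quotient (MulAction.orbitRel D ι) → V := fun q =>
    ∑ j with MulAction.orbitRel D ι j q.out, b j
  have ht : ∀ q, t q ∈ fixedPts ρ D := fun q x hx => by
    rw [map_sum]
    refine Finset.sum_bij (fun j _ => (⟨x, hx⟩ : D) • j) (fun j hj => ?_)
      (fun j _ j' _ h => MulAction.injective _ h) (fun j hj => ?_)
      (fun j _ => hb.rep_apply ⟨x, hx⟩ j)
    · rw [Finset.mem_filter] at hj ⊢
      exact ⟨Finset.mem_univ _, (MulAction.orbitRel D ι).trans ⟨_, rfl⟩ hj.2⟩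
    · rw [Finset.mem_filter] at hj
      refine ⟨(⟨x, hx⟩ : D)⁻¹ • j, ?_, smul_inv_smul _ _⟩
      rw [Finset.mem_filter]
      exact ⟨Finset.mem_univ _, (MulAction.orbitRel D ι).trans ⟨_, rfl⟩ hj.2⟩
  have hv : v = ∑ q, c q.out • (⟨t q, ht q⟩ : fixedPts ρ D) := by
    apply Subtype.ext
    rw [AddSubmonoidClass.coe_finsetSum]
    conv_lhs => rw [← b.sum_repr (v : V)]
    rw [← Finset.sum_fiberwise Finset.univ (Quotient.mk (MulAction.orbitRel D ι))]
    refine Finset.sum_congr rfl fun q _ => ?_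
    rw [Submodule.coe_smul, Finset.smul_sum]
    refine Finset.sum_congr ?_ fun j hj => ?_
    · ext j
      simp only [Finset.mem_filter, Finset.mem_univ, true_and]
      rw [← Quotient.eq (r := MulAction.orbitRel D ι), Quotient.out_eq]
    · have h2 := (Finset.mem_filter.1 hj).2
      obtain ⟨g, hg⟩ := h2
      congr 1
      rw [← hg]
      exact hc _ _
  rw [hv, map_sum]
  refine Submodule.sum_mem _ fun q _ => ?_
  rw [map_smul, ← residue_smul]
  refine Submodule.smul_mem _ _ ?_
  obtain ⟨Q, hfix, hle, hD, hsum⟩ := sum_orbit_eq_relTrace hb q.out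
  by_cases h : D ≤ Q
  · refine Submodule.subset_span ⟨⟨q.out, hD h⟩, ?_⟩
    have hq : ∀ j, MulAction.orbitRel D ι j q.out ↔ j = q.out := fun j => by
      constructor
      · rintro ⟨g, rfl⟩
        exact b.injective ((hb.rep_apply g _).symm.trans (hD h _ g.2))
      · rintro rfl
        exact (MulAction.orbitRel D ι).refl _
    refine congrArg (Br ρ D) (Subtype.ext ?_)
    simp only [t]
    rw [Finset.filter_congr fun j _ => hq j, Finset.filter_eq' Finset.univ q.out,
      if_pos (Finset.mem_univ _), Finset.sum_singleton]
  · have : Br ρ D ⟨t q, ht q⟩ = 0 := by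
      refine (Submodule.Quotient.mk_eq_zero _).2 (Submodule.mem_sup_right
        (Submodule.mem_iSup_of_mem Q (Submodule.mem_iSup_of_mem (lt_of_le_not_ge hle h) ?_)))
      refine ⟨b q.out, hfix, ?_⟩
      rw [← hsum]
      rfl
    rw [this]
    exact Submodule.zero_mem _

/-- If `D` is a `p`-group that permutes the basis `b`, then the images of the fixed basis elements
form a basis of the Brauer construction. -/
def brauerBasis [Finite ι] (hD : IsPGroup p D) (hb : Permutes ρ D b) :
    Module.Basis {i // b i ∈ fixedPts ρ D} (ResidueField O) (Brauer ρ D) :=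
  Module.Basis.mk (v := fun i : {i // b i ∈ fixedPts ρ D} => Br ρ D ⟨b i, i.2⟩) (by
    classical
    -- The coordinates at the fixed basis elements survive in the quotient and send this family to
    -- the standard basis.
    refine LinearIndependent.of_comp (brauerCoord hD hb) ?_
    convert! Pi.linearIndependent_single_one {i // b i ∈ fixedPts ρ D} (ResidueField O) using 1
    ext i j
    rw [Function.comp_apply, brauerCoord_Br]
    simp only [Module.Basis.repr_self, Finsupp.single_apply, Pi.single_apply, Subtype.ext_iff]
    rw [apply_ite (residue O), map_one, map_zero]
    simp only [eq_comm]) (span_Br_eq_top hb).ge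

theorem brauerBasis_apply [Finite ι] (hD : IsPGroup p D) (hb : Permutes ρ D b)
    (i : {i // b i ∈ fixedPts ρ D}) : brauerBasis hD hb i = Br ρ D ⟨b i, i.2⟩ :=
  Module.Basis.mk_apply _ _ _

end BrauerBasis

end BPDecomp

namespace BPDecomp

open Representation IsLocalRing

/-! ### Coinvariants of a permutation module. -/

section CoinvariantsBasis

variable {k : Type*} [CommRing k] {B : Type*} [Group B] {U : Type*} [AddCommGroup U] [Module k U]
  {κ : Type*}

/-- The orbits of a group on a permuted basis. -/
@[reducible]
def basisOrbitRel (π : Representation k B U) (c : Module.Basis κ k U) : Setoid κ where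
  r i j := ∃ h, π h (c i) = c j
  iseqv :=
    { refl := fun i => ⟨1, by simp⟩
      symm := fun {i j} ⟨h, hh⟩ => ⟨h⁻¹, by rw [← hh, ← Module.End.mul_apply, ← map_mul]; simp⟩
      trans := fun {i j l} ⟨h, hh⟩ ⟨h', hh'⟩ =>
        ⟨h' * h, by rw [map_mul, Module.End.mul_apply, hh, hh']⟩ }

/-- The coinvariants of a permutation module have the orbits of the group on the permuted basis as
a basis. -/
def coinvariantsBasis {π : Representation k B U} {c : Module.Basis κ k U}
    (hc : Permutes π ⊤ c) :
    Module.Basis (Quotient (basisOrbitRel π c)) k (Coinvariants π) :=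
  .ofRepr <| LinearEquiv.ofLinearMap
    (Coinvariants.lift π (c.constr k fun i => Finsupp.single (Quotient.mk _ i) 1) fun h =>
      c.ext fun i => by
        obtain ⟨j, hj⟩ := hc h trivial i
        rw [LinearMap.comp_apply, hj, c.constr_basis, c.constr_basis]
        congr 1
        exact Quotient.sound (s := basisOrbitRel π c)
          ((basisOrbitRel π c).symm ⟨h, hj⟩))
    (Finsupp.linearCombination k
      (Quotient.lift (s := basisOrbitRel π c) (fun i => Coinvariants.mk π (c i)) fun i j ⟨h, hh⟩ =>
        by rw [← hh, Coinvariants.mk_self_apply]))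
    (by
      refine Finsupp.lhom_ext' fun q => LinearMap.ext_ring ?_
      induction q using Quotient.inductionOn with
      | h i => simp)
    (by
      refine Coinvariants.hom_ext (c.ext fun i => ?_)
      simp)

theorem coinvariantsBasis_mk {π : Representation k B U} {c : Module.Basis κ k U}
    (hc : Permutes π ⊤ c) (i : κ) :
    coinvariantsBasis hc (Quotient.mk _ i) = Coinvariants.mk π (c i) := by
  simp [coinvariantsBasis]

end CoinvariantsBasis

/-! ### Tensor products of permutation bimodules and their fixed basis elements. -/

section TensorBasis

variable {k : Type*} [CommRing k] {G H K : Type*} [Group G] [Group H] [Group K]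
  {V W : Type*} [AddCommGroup V] [Module k V] [AddCommGroup W] [Module k W] {ι κ : Type*}
  {ρ : Representation k (G × H) V} {τ : Representation k (H × K) W}
  {b : Module.Basis ι k V} {c : Module.Basis κ k W}

/-- `H` acts freely on the permuted basis `b` of an `(kG,kH)`-bimodule. -/
def RightFree (ρ : Representation k (G × H) V) (b : Module.Basis ι k V) : Prop :=
  ∀ (h : H) (i : ι), ρ (1, h) (b i) = b i → h = 1

theorem permutes_tensorProduct (hb : Permutes ρ ⊤ b) (hc : Permutes τ ⊤ c) :
    Permutes (midRep ρ τ) ⊤ (b.tensorProduct c) := by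
  rintro h - ⟨i, j⟩
  obtain ⟨i', hi⟩ := hb (1, h) trivial i
  obtain ⟨j', hj⟩ := hc (h, 1) trivial j
  refine ⟨(i', j'), ?_⟩
  rw [Module.Basis.tensorProduct_apply, Module.Basis.tensorProduct_apply, ← hi, ← hj]
  rfl

/-- The basis of `V ⊗_{kH} W` that comes from permuted bases of `V` and `W`. -/
def tensorBasis (hb : Permutes ρ ⊤ b) (hc : Permutes τ ⊤ c) :
    Module.Basis (Quotient (basisOrbitRel (midRep ρ τ) (b.tensorProduct c))) k (TensorOver ρ τ) :=
  coinvariantsBasis (permutes_tensorProduct hb hc)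

theorem tensorBasis_mk (hb : Permutes ρ ⊤ b) (hc : Permutes τ ⊤ c) (i : ι) (j : κ) :
    tensorBasis hb hc (Quotient.mk _ (i, j)) = Coinvariants.mk (midRep ρ τ) (b i ⊗ₜ c j) :=
  (coinvariantsBasis_mk _ (i, j)).trans (by rw [Module.Basis.tensorProduct_apply])

theorem permutes_tensorBasis (hb : Permutes ρ ⊤ b) (hc : Permutes τ ⊤ c) :
    Permutes (tensorRep ρ τ) ⊤ (tensorBasis hb hc) := by
  rintro ⟨g, l⟩ - q
  induction q using Quotient.inductionOn with
  | h x =>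
    obtain ⟨i, j⟩ := x
    obtain ⟨i', hi⟩ := hb (g, 1) trivial i
    obtain ⟨j', hj⟩ := hc (1, l) trivial j
    refine ⟨Quotient.mk _ (i', j'), ?_⟩
    rw [tensorBasis_mk, tensorBasis_mk, tensorRep_mk ρ τ g 1 l, hi, hj]

/-- Different `H`-orbits of pairs are different basis elements of the tensor product, so equal
tensors of basis elements come from one orbit. -/
theorem exists_of_mk_tmul_eq [Nontrivial k] (hb : Permutes ρ ⊤ b) (hc : Permutes τ ⊤ c) {i i' : ι}
    {j j' : κ} (h : Coinvariants.mk (midRep ρ τ) (b i ⊗ₜ c j) =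
      Coinvariants.mk (midRep ρ τ) (b i' ⊗ₜ c j')) :
    ∃ h : H, ρ (1, h) (b i) = b i' ∧ τ (h, 1) (c j) = c j' := by
  rw [← tensorBasis_mk hb hc, ← tensorBasis_mk hb hc] at h
  obtain ⟨l, hl⟩ := Quotient.exact ((tensorBasis hb hc).injective h)
  obtain ⟨i₁, hi⟩ := hb (1, l) trivial i
  obtain ⟨j₁, hj⟩ := hc (l, 1) trivial j
  have h2 : midRep ρ τ l (b.tensorProduct c (i, j)) = b.tensorProduct c (i₁, j₁) := by
    rw [Module.Basis.tensorProduct_apply, Module.Basis.tensorProduct_apply, ← hi, ← hj]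
    rfl
  obtain ⟨rfl, rfl⟩ := Prod.mk.inj ((b.tensorProduct c).injective (h2.symm.trans hl))
  exact ⟨l, hi, hj⟩

/-- The quotient (g,h)⁻¹(g,h') = (1, h⁻¹h') fixes b_i as well. Hence the stabilizer of b_i is the
graph of a partial map from `G` to `H`. -/
theorem RightFree.eq_of_fixed (hf : RightFree ρ b) {i : ι} {g : G} {h h' : H}
    (h1 : ρ (g, h) (b i) = b i) (h2 : ρ (g, h') (b i) = b i) : h = h' := by
  have : ρ (1, h⁻¹ * h') (b i) = b i := by
    have e : ((1 : G), h⁻¹ * h') = (g, h)⁻¹ * (g, h') := by simp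
    rw [e, map_mul, Module.End.mul_apply, h2]
    conv_lhs => rw [← h1]
    rw [← Module.End.mul_apply, ← map_mul, inv_mul_cancel, map_one, Module.End.one_apply]
  exact inv_mul_eq_one.1 (hf _ _ this)

/-- Applying (σ(r),1) and (1,r) to the two factors must be undone by some `h` in `H`. Freeness on
`b` makes `h` unique, so r ↦ h is multiplicative; freeness on `c` makes it injective. This
homomorphism is ψ, `Q` is its image and φ = σψ⁻¹. -/
theorem exists_twDiag_of_fixed [Nontrivial k] (hb : Permutes ρ ⊤ b) (hc : Permutes τ ⊤ c)
    (hbf : RightFree ρ b) (hcf : RightFree τ c) {P : Subgroup G} {R : Subgroup K} (σ : R ≃* P)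
    {i : ι} {j : κ}
    (h : Coinvariants.mk (midRep ρ τ) (b i ⊗ₜ c j) ∈ fixedPts (tensorRep ρ τ) (twDiag σ)) :
    ∃ (Q : Subgroup H) (φ : Q ≃* P) (ψ : R ≃* Q), ψ.trans φ = σ ∧
      b i ∈ fixedPts ρ (twDiag φ) ∧ c j ∈ fixedPts τ (twDiag ψ) := by
  have key : ∀ r : R, ∃ h : H, ρ ((σ r : G), h) (b i) = b i ∧ τ (h, (r : K)) (c j) = c j := by
    intro r
    obtain ⟨i', hi⟩ := hb ((σ r : G), 1) trivial i
    obtain ⟨j', hj⟩ := hc (1, (r : K)) trivial j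
    have h2 := h _ (mk_mem_twDiag σ r)
    rw [tensorRep_mk ρ τ _ 1, hi, hj] at h2
    obtain ⟨l, hl1, hl2⟩ := exists_of_mk_tmul_eq hb hc h2
    refine ⟨l, ?_, ?_⟩
    · rw [← hi, ← Module.End.mul_apply, ← map_mul] at hl1
      simpa using hl1
    · rw [← hj, ← Module.End.mul_apply, ← map_mul] at hl2
      simpa using hl2
  choose f hf1 hf2 using key
  have hmul : ∀ r s, f (r * s) = f r * f s := fun r s => by
    refine hbf.eq_of_fixed (hf1 (r * s)) ?_
    have e : ((σ (r * s) : G), f r * f s) = ((σ r : G), f r) * ((σ s : G), f s) := by simp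
    rw [e, map_mul, Module.End.mul_apply, hf1, hf1]
  let f' : R →* H := MonoidHom.mk' f hmul
  have hinj : Function.Injective f' := fun r s hrs => by
    have h1 := hf2 r
    rw [show f r = f s from hrs] at h1
    exact Subtype.ext (hcf.eq_of_fixed h1 (hf2 s))
  refine ⟨f'.range, (MonoidHom.ofInjective hinj).symm.trans σ, MonoidHom.ofInjective hinj, ?_, ?_,
    ?_⟩
  · ext r
    simp
  · rintro _ ⟨q, rfl⟩
    obtain ⟨r, rfl⟩ := (MonoidHom.ofInjective hinj).surjective q
    simpa using! hf1 r
  · rintro _ ⟨r, rfl⟩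
    exact hf2 r

/-- An `h` moving one pair to the other conjugates stabilizers, so (σ(r), hψ(r)h⁻¹) and (σ(r),
ψ'(r)) both fix b_{i'}; freeness identifies their second entries. -/
theorem conj_eq_of_mk_tmul_eq [Nontrivial k] (hb : Permutes ρ ⊤ b) (hc : Permutes τ ⊤ c) (hf : RightFree ρ b)
    {P : Subgroup G} {R : Subgroup K} {σ : R ≃* P}
    {Q Q' : Subgroup H} {φ : Q ≃* P} {ψ : R ≃* Q} (hσ : ψ.trans φ = σ) {φ' : Q' ≃* P}
    {ψ' : R ≃* Q'} (hσ' : ψ'.trans φ' = σ) {i i' : ι} {j j' : κ}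
    (hi : b i ∈ fixedPts ρ (twDiag φ)) (hi' : b i' ∈ fixedPts ρ (twDiag φ'))
    (h : Coinvariants.mk (midRep ρ τ) (b i ⊗ₜ c j) =
      Coinvariants.mk (midRep ρ τ) (b i' ⊗ₜ c j')) :
    ∃ h : H, ρ (1, h) (b i) = b i' ∧ τ (h, 1) (c j) = c j' ∧
      ∀ r, (ψ' r : H) = h * ψ r * h⁻¹ := by
  obtain ⟨l, hl1, hl2⟩ := exists_of_mk_tmul_eq hb hc h
  refine ⟨l, hl1, hl2, fun r => ?_⟩
  have e1 := hi _ (mk_mem_twDiag φ (ψ r))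
  have e2 := hi' _ (mk_mem_twDiag φ' (ψ' r))
  have e3 : φ (ψ r) = σ r := DFunLike.congr_fun hσ r
  have e4 : φ' (ψ' r) = σ r := DFunLike.congr_fun hσ' r
  rw [e3] at e1
  rw [e4] at e2
  refine hf.eq_of_fixed e2 ?_
  have e5 : ((σ r : G), l * (ψ r : H) * l⁻¹) = (1, l) * ((σ r : G), (ψ r : H)) * (1, l)⁻¹ := by
    simp
  rw [e5, ← hl1, ← Module.End.mul_apply, ← map_mul, inv_mul_cancel_right, map_mul,
    Module.End.mul_apply, e1]

end TensorBasis

end BPDecomp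

namespace BPDecomp

open Representation IsLocalRing

/-! ### Orthogonality and completeness of block idempotents. -/

section Blocks

variable {A : Type*} [Ring A]

/-- The product is a central idempotent lying below both factors; if it were not zero, primitivity
would make it equal to each of them. -/
theorem IsBlockIdempotent.mul_eq_zero {b c : A} (hb : IsBlockIdempotent b)
    (hc : IsBlockIdempotent c) (h : b ≠ c) : b * c = 0 := by
  have hcomm : b * c = c * b := Subring.mem_center_iff.1 hc.mem_center b
  have hidem : b * c * (b * c) = b * c := by
    rw [mul_assoc, ← mul_assoc c b c, ← hcomm, mul_assoc b c c, hc.idem, ← mul_assoc, hb.idem]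
  have hmem := Subring.mul_mem _ hb.mem_center hc.mem_center
  rcases hb.primitive _ hmem hidem (by rw [hcomm, mul_assoc, hb.idem]) with h1 | h1
  · exact h1
  rcases hc.primitive _ hmem hidem (by rw [mul_assoc, hc.idem]) with h2 | h2
  · exact h2
  exact absurd (h1.symm.trans h2) h

/-- An imprimitive `e` splits as c + (e - c) with both parts nonzero central idempotents, and cA and
(e - c)A have smaller dimension than eA. The bound `n` on that dimension drives the induction. -/
theorem exists_sum_blocks (F : Type*) [Field F] [Algebra F A] [FiniteDimensional F A] (n : ℕ) :
    ∀ e ∈ Subring.center A, e * e = e →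
      Module.finrank F (LinearMap.range (LinearMap.mulLeft F e)) ≤ n →
      ∃ s : Finset A, (∀ f ∈ s, IsBlockIdempotent f ∧ f * e = f) ∧ ∑ f ∈ s, f = e := by
  classical
  have lt : ∀ {c e : A}, c * c = c → c * e = c → e * c = c → c ≠ e →
      Module.finrank F (LinearMap.range (LinearMap.mulLeft F c)) <
        Module.finrank F (LinearMap.range (LinearMap.mulLeft F e)) := by
    intro c e hcc h1 h2 hne
    refine Submodule.finrank_lt_finrank_of_lt (lt_of_le_of_ne ?_ fun heq => hne ?_)
    · rintro _ ⟨a, rfl⟩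
      exact ⟨c * a, by simp [← mul_assoc, h2]⟩
    · have he : e ∈ LinearMap.range (LinearMap.mulLeft F c) := by
        rw [heq]
        exact ⟨1, mul_one e⟩
      obtain ⟨a, ha⟩ := he
      rw [← h1, ← ha, LinearMap.mulLeft_apply, ← mul_assoc, hcc]
  induction n with
  | zero =>
    intro e _ _ hr
    refine ⟨∅, by simp, ?_⟩
    have h0 : LinearMap.range (LinearMap.mulLeft F e) = ⊥ :=
      Submodule.finrank_eq_zero.1 (Nat.le_zero.1 hr)
    have : e * 1 ∈ LinearMap.range (LinearMap.mulLeft F e) := ⟨1, rfl⟩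
    rw [h0, Submodule.mem_bot, mul_one] at this
    simp [this]
  | succ n ih =>
    intro e he hi hr
    by_cases h0 : e = 0
    · exact ⟨∅, by simp, by simp [h0]⟩
    by_cases hp : ∀ c ∈ Subring.center A, c * c = c → c * e = c → c = 0 ∨ c = e
    · exact ⟨{e}, by simpa using ⟨⟨he, hi, h0, hp⟩, hi⟩, by simp⟩
    push Not at hp
    obtain ⟨c, hc, hci, hce, hc0, hcne⟩ := hp
    have hec : e * c = c := by rw [← Subring.mem_center_iff.1 he c, hce]
    have hd1 : (e - c) * e = e - c := by rw [sub_mul, hi, hce]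
    have hd2 : e * (e - c) = e - c := by rw [mul_sub, hi, hec]
    have hdd : (e - c) * (e - c) = e - c := by
      rw [mul_sub, hd1, sub_mul, hec, hci, sub_self, sub_zero]
    obtain ⟨s, hs, hsum⟩ := ih c hc hci (Nat.le_of_lt_succ ((lt hci hce hec hcne).trans_le hr))
    obtain ⟨t, ht, htsum⟩ := ih (e - c) (Subring.sub_mem _ he hc) hdd
      (Nat.le_of_lt_succ ((lt hdd hd1 hd2 fun h => hc0 (sub_eq_self.1 h)).trans_le hr))
    -- The union of finite sets has no multiplicities, so a repeated block would be lost in the sum.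
    -- A common `f` satisfies f = fc and f = f(e - c), which gives f = 0.
    have hdisj : Disjoint s t := Finset.disjoint_left.2 fun f hf hf' => by
      obtain ⟨hb, h1⟩ := hs f hf
      have h2 := (ht f hf').2
      rw [← h1, mul_assoc, mul_sub, hce, hci, sub_self, mul_zero, h1] at h2
      exact hb.ne_zero h2.symm
    refine ⟨s ∪ t, fun f hf => ?_, by rw [Finset.sum_union hdisj, hsum, htsum, add_sub_cancel]⟩
    rcases Finset.mem_union.1 hf with hf | hf
    · obtain ⟨hb, h1⟩ := hs f hf
      exact ⟨hb, by rw [← h1, mul_assoc, hce]⟩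
    · obtain ⟨hb, h1⟩ := ht f hf
      exact ⟨hb, by rw [← h1, mul_assoc, hd1]⟩

/-- The block idempotents of a finite-dimensional algebra sum to `1`. -/
theorem exists_sum_blocks_eq_one (F : Type*) [Field F] [Algebra F A] [FiniteDimensional F A] :
    ∃ s : Finset A, (∀ f ∈ s, IsBlockIdempotent f) ∧ ∑ f ∈ s, f = 1 := by
  obtain ⟨s, hs, hsum⟩ := exists_sum_blocks F (A := A) _ 1 (Subring.one_mem _) (one_mul 1) le_rfl
  exact ⟨s, fun f hf => (hs f hf).1, hsum⟩

end Blocks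

end BPDecomp

namespace BPDecomp

open Representation IsLocalRing

/-! ### Complementary subrepresentations. -/

section Complements

variable {k : Type*} [CommRing k] {Γ : Type*} [Group Γ] {V : Type*} [AddCommGroup V] [Module k V]
  {ρ : Representation k Γ V}

theorem isCompl_toSubmodule {U W : Subrepresentation ρ} (h : IsCompl U W) :
    IsCompl U.toSubmodule W.toSubmodule :=
  ⟨disjoint_iff.2 (congrArg Subrepresentation.toSubmodule h.inf_eq_bot),
    codisjoint_iff.2 (congrArg Subrepresentation.toSubmodule h.sup_eq_top)⟩

theorem isCompl_of_toSubmodule {U W : Subrepresentation ρ}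
    (h : IsCompl U.toSubmodule W.toSubmodule) : IsCompl U W :=
  ⟨disjoint_iff.2 (Subrepresentation.toSubmodule_injective h.inf_eq_bot),
    codisjoint_iff.2 (Subrepresentation.toSubmodule_injective h.sup_eq_top)⟩

theorem projection_commute {U W : Subrepresentation ρ}
    (h : IsCompl U.toSubmodule W.toSubmodule) (g : Γ) :
    Commute (U.toSubmodule.projection W.toSubmodule h) (ρ g) := by
  refine LinearMap.ext fun v => ?_
  obtain ⟨u, hu, w, hw, rfl⟩ := Submodule.mem_sup.1 (h.sup_eq_top.ge (Submodule.mem_top (x := v)))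
  have h1 := Submodule.projection_apply_left h ⟨u, hu⟩
  have h2 := Submodule.projection_apply_right h ⟨w, hw⟩
  have h3 := Submodule.projection_apply_left h ⟨_, U.apply_mem_toSubmodule g hu⟩
  have h4 := Submodule.projection_apply_right h ⟨_, W.apply_mem_toSubmodule g hw⟩
  simp only [Module.End.mul_apply, map_add] at *
  rw [h1, h2, h3, h4, map_zero]

/-- The inclusion of a subrepresentation. -/
def subrepIncl (U : Subrepresentation ρ) : U.toRepresentation.IntertwiningMap ρ :=
  LinearMap.intertwiningMap_of_isIntertwiningMap _ _ U.toSubmodule.subtype fun _ _ => rfl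

/-- The projection to a direct summand. -/
def subrepProj (U W : Subrepresentation ρ) (h : IsCompl U W) :
    ρ.IntertwiningMap U.toRepresentation :=
  LinearMap.intertwiningMap_of_isIntertwiningMap _ _
    (U.toSubmodule.projectionOnto W.toSubmodule (isCompl_toSubmodule h)) fun g v =>
      Subtype.ext (DFunLike.congr_fun (projection_commute (isCompl_toSubmodule h) g) v)

theorem subrepProj_incl (U W : Subrepresentation ρ) (h : IsCompl U W) :
    (subrepProj U W h).comp (subrepIncl U) = IntertwiningMap.id _ :=
  IntertwiningMap.ext (LinearMap.ext fun u =>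
    Submodule.projectionOnto_apply_left (isCompl_toSubmodule h) u)

theorem isPermutationRep_of_permutes {ι : Type*} [Finite ι] {b : Module.Basis ι k V}
    (hb : Permutes ρ ⊤ b) : IsPermutationRep ρ := by
  have := Fintype.ofFinite ι
  refine ⟨Fintype.card ι, b.reindex (Fintype.equivFin ι), fun g i => ?_⟩
  obtain ⟨j, hj⟩ := hb g trivial ((Fintype.equivFin ι).symm i)
  exact ⟨Fintype.equivFin ι j, by simpa using hj⟩

theorem isPermutationRep_of_isCompl {U W : Subrepresentation ρ} (h : IsCompl U W)
    (hU : IsPermutationRep U.toRepresentation) (hW : IsPermutationRep W.toRepresentation) :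
    IsPermutationRep ρ := by
  obtain ⟨n, b, hb⟩ := hU
  obtain ⟨m, c, hc⟩ := hW
  refine isPermutationRep_of_permutes (b := (b.prod c).map
    (Submodule.prodEquivOfIsCompl _ _ (isCompl_toSubmodule h))) ?_
  rintro g - (i | i)
  · obtain ⟨j, hj⟩ := hb g i
    refine ⟨Sum.inl j, ?_⟩
    have h2 : ρ g (b i : V) = b j := congrArg Subtype.val hj
    simpa using h2
  · obtain ⟨j, hj⟩ := hc g i
    refine ⟨Sum.inr j, ?_⟩
    have h2 : ρ g (c i : V) = c j := congrArg Subtype.val hj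
    simpa using h2

theorem exists_isCompl_of_not_isIndecomposable [Nontrivial V] (h : ¬ IsIndecomposable ρ) :
    ∃ U W : Subrepresentation ρ, IsCompl U W ∧ U ≠ ⊥ ∧ W ≠ ⊥ := by
  simp only [IsIndecomposable, not_and, not_forall, not_or] at h
  obtain ⟨U, W, h1, h2, h3⟩ := h inferInstance
  exact ⟨U, W, h1, h2, h3⟩

end Complements

/-! ### Fitting's lemma and locality of endomorphism rings. -/

section Fitting

variable {F : Type*} [Field F] {Γ : Type*} [Group Γ] {V : Type*} [AddCommGroup V] [Module F V]
  [FiniteDimensional F V] {ρ : Representation F Γ V}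

/-- Fitting: for large n the kernel and image of f^n are complementary subrepresentations, and
indecomposability makes one of them zero. -/
theorem isUnit_or_isNilpotent (hρ : IsIndecomposable ρ) {f : Module.End F V}
    (hf : ∀ g, Commute f (ρ g)) : IsUnit f ∨ IsNilpotent f := by
  -- The condition n ≥ 1 is needed to pass from invertibility of f^n to that of f.
  obtain ⟨n, hn1, hn⟩ := ((Filter.eventually_ge_atTop 1).and
    f.eventually_isCompl_ker_pow_range_pow).exists
  have hc : ∀ g v, (f ^ n) (ρ g v) = ρ g ((f ^ n) v) := fun g v =>
    DFunLike.congr_fun ((hf g).pow_left n) v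
  let U : Subrepresentation ρ := ⟨LinearMap.ker (f ^ n), fun g v hv => by
    rw [LinearMap.mem_ker] at hv ⊢
    rw [hc, hv, map_zero]⟩
  let W : Subrepresentation ρ := ⟨LinearMap.range (f ^ n), by
    rintro g _ ⟨v, rfl⟩
    exact ⟨ρ g v, hc g v⟩⟩
  rcases hρ.2 U W (isCompl_of_toSubmodule hn) with h | h
  · left
    have h1 : IsUnit (f ^ n) := (LinearMap.isUnit_iff_ker_eq_bot _).2
      (congrArg Subrepresentation.toSubmodule h)
    exact (isUnit_pow_iff (by omega)).1 h1
  · right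
    exact ⟨n, LinearMap.range_eq_bot.1 (congrArg Subrepresentation.toSubmodule h)⟩

/-- After division by the unit u = f + f' the two terms sum to 1; if u⁻¹f is nilpotent, then u⁻¹f' =
1 - u⁻¹f is invertible. -/
theorem isUnit_or_isUnit_of_isUnit_add (hρ : IsIndecomposable ρ) {f f' : Module.End F V}
    (hf : ∀ g, Commute f (ρ g)) (hf' : ∀ g, Commute f' (ρ g)) (h : IsUnit (f + f')) :
    IsUnit f ∨ IsUnit f' := by
  obtain ⟨u, hu⟩ := h
  have hcomm : ∀ g, Commute (↑u⁻¹ : Module.End F V) (ρ g) := fun g =>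
    Commute.units_inv_left (by rw [hu]; exact (hf g).add_left (hf' g))
  rcases isUnit_or_isNilpotent hρ fun g => (hcomm g).mul_left (hf g) with h1 | h1
  · exact Or.inl (by simpa using h1)
  · right
    have h2 := h1.isUnit_one_sub
    have h3 : 1 - ↑u⁻¹ * f = ↑u⁻¹ * f' := by
      rw [sub_eq_iff_eq_add', ← mul_add, ← hu, Units.inv_mul]
    rw [h3] at h2
    simpa using h2

theorem exists_isUnit_of_isUnit_sum (hρ : IsIndecomposable ρ) {α : Type*} (s : Finset α)
    (f : α → Module.End F V) (hf : ∀ a g, Commute (f a) (ρ g)) (h : IsUnit (∑ a ∈ s, f a)) :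
    ∃ a ∈ s, IsUnit (f a) := by
  classical
  have := hρ.1
  induction s using Finset.induction_on with
  | empty => simp at h
  | insert a s ha ih =>
    rw [Finset.sum_insert ha] at h
    rcases isUnit_or_isUnit_of_isUnit_add hρ (hf a)
      (fun g => Commute.sum_left _ _ _ fun a _ => hf a g) h with h | h
    · exact ⟨a, Finset.mem_insert_self _ _, h⟩
    · obtain ⟨a', ha', h'⟩ := ih h
      exact ⟨a', Finset.mem_insert_of_mem ha', h'⟩

end Fitting

/-! ### Direct summands of permutation modules for p-groups in characteristic p. -/

section PGroups

variable {p : ℕ} [Fact p.Prime] {F : Type*} [Field F] {Γ : Type*} [Group Γ]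
  {V : Type*} [AddCommGroup V] [Module F V]

/-- The field may be infinite, so points are counted in the span over `ZMod p` of a single orbit. It
is a finite set of order divisible by p on which the p-group acts with fixed point 0, so there is
another fixed point. -/
theorem exists_fixed_ne_zero_of_zmod [Finite Γ] (hΓ : IsPGroup p Γ) [Module (ZMod p) V]
    (ρ : Representation F Γ V) [Nontrivial V] : ∃ v : V, v ≠ 0 ∧ ∀ g, ρ g v = v := by
  obtain ⟨v, hv⟩ := exists_ne (0 : V)
  let S : Submodule (ZMod p) V := Submodule.span (ZMod p) (Set.range fun g => ρ g v)
  have : Module.Finite (ZMod p) S :=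
    Module.Finite.span_of_finite (ZMod p) (Set.finite_range fun g => ρ g v)
  have : Finite S := Module.finite_of_finite (ZMod p)
  have hS : ∀ g, ∀ w ∈ S, ρ g w ∈ S := fun g w hw => by
    induction hw using Submodule.span_induction with
    | mem x hx =>
      obtain ⟨h, rfl⟩ := hx
      exact Submodule.subset_span ⟨g * h, by simp⟩
    | zero => rw [map_zero]; exact S.zero_mem
    | add x y _ _ hx hy => rw [map_add]; exact S.add_mem hx hy
    | smul a x _ hx =>
      have : ρ g (a • x) = a • ρ g x := ZMod.map_smul (ρ g) a x
      rw [this]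
      exact S.smul_mem a hx
  let _ : MulAction Γ S :=
    { smul := fun g w => ⟨ρ g w, hS g w w.2⟩
      one_smul := fun w => Subtype.ext (by change ρ 1 (w : V) = w; simp)
      mul_smul := fun g h w => Subtype.ext (by
        change ρ (g * h) (w : V) = ρ g (ρ h w)
        simp) }
  have hvS : v ∈ S := Submodule.subset_span ⟨1, by simp⟩
  have hcard : p ∣ Nat.card S := by
    have h1 : addOrderOf (⟨v, hvS⟩ : S) = p := by
      refine addOrderOf_eq_prime ?_ fun h => hv (congrArg Subtype.val h)
      rw [← Nat.cast_smul_eq_nsmul (ZMod p), CharP.cast_eq_zero, zero_smul]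
    conv_lhs => rw [← h1]
    exact addOrderOf_dvd_natCard _
  obtain ⟨w, hw, hne⟩ := hΓ.exists_fixed_point_of_prime_dvd_card_of_fixed_point S hcard
    (a := 0) (fun g => Subtype.ext (map_zero (ρ g)))
  exact ⟨w, fun h => hne (Subtype.ext h.symm), fun g => congrArg Subtype.val (hw g)⟩

/-- A `p`-group has nonzero fixed points on a nonzero module in characteristic `p`. -/
theorem exists_fixed_ne_zero [Finite Γ] [CharP F p] (hΓ : IsPGroup p Γ)
    (ρ : Representation F Γ V) [Nontrivial V] : ∃ v : V, v ≠ 0 ∧ ∀ g, ρ g v = v := by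
  have hp : ∀ x : V, p • x = 0 := fun x => by
    rw [← Nat.cast_smul_eq_nsmul F, CharP.cast_eq_zero, zero_smul]
  let _ : Module (ZMod p) V := AddCommGroup.zmodModule hp
  exact exists_fixed_ne_zero_of_zmod hΓ ρ

variable {U : Type*} [AddCommGroup U] [Module F U] {ι : Type*} {π : Representation F Γ U}
  {b : Module.Basis ι F U}

open Classical in
/-- The projection to the span of one orbit of a permuted basis. -/
def orbitProj (π : Representation F Γ U) (b : Module.Basis ι F U)
    (q : Quotient (basisOrbitRel π b)) : Module.End F U :=
  b.constr F fun i => if Quotient.mk _ i = q then b i else 0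

theorem orbitProj_commute (hb : Permutes π ⊤ b) (q : Quotient (basisOrbitRel π b)) (g : Γ) :
    Commute (orbitProj π b q) (π g) := by
  refine b.ext fun i => ?_
  obtain ⟨j, hj⟩ := hb g trivial i
  have : (Quotient.mk (basisOrbitRel π b) j) = Quotient.mk _ i :=
    Quotient.sound (s := basisOrbitRel π b) ((basisOrbitRel π b).symm ⟨g, hj⟩)
  rw [Module.End.mul_apply, Module.End.mul_apply, hj, orbitProj, b.constr_basis, b.constr_basis,
    this]
  split_ifs
  · exact hj.symm
  · rw [map_zero]

theorem repr_orbitProj (q : Quotient (basisOrbitRel π b)) (v : U) (i : ι) :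
    b.repr (orbitProj π b q v) i =
      open Classical in if Quotient.mk _ i = q then b.repr v i else 0 := by
  classical
  have h : b.coord i ∘ₗ orbitProj π b q = if Quotient.mk _ i = q then b.coord i else 0 := by
    refine b.ext fun j => ?_
    rw [LinearMap.comp_apply, orbitProj, b.constr_basis]
    by_cases h : i = j
    · subst h
      split_ifs <;> simp
    · split_ifs <;> simp [Ne.symm h]
  refine (DFunLike.congr_fun h v).trans ?_
  split_ifs <;> rfl

theorem sum_orbitProj [Fintype (Quotient (basisOrbitRel π b))] :
    ∑ q, orbitProj π b q = 1 := by
  classical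
  refine b.ext fun i => ?_
  rw [LinearMap.sum_apply]
  simp [orbitProj]

/-- Nonzero fixed vectors in the span of one orbit of a permuted basis are unique up to scalars. -/
theorem exists_smul_of_fixed (hb : Permutes π ⊤ b) (q : Quotient (basisOrbitRel π b)) {u v : U}
    (hu : ∀ g, π g u = u) (hv : ∀ g, π g v = v) (hqu : orbitProj π b q u = u)
    (hqv : orbitProj π b q v = v) (hu0 : u ≠ 0) : ∃ c : F, v = c • u := by
  classical
  obtain ⟨j, hj⟩ : ∃ j, b.repr u j ≠ 0 := by
    by_contra! h
    exact hu0 (b.repr.map_eq_zero_iff.1 (Finsupp.ext h))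
  have hz : ∀ w, orbitProj π b q w = w → ∀ i, Quotient.mk _ i ≠ q → b.repr w i = 0 :=
    fun w hw i hi => by
      rw [← hw, repr_orbitProj, if_neg hi]
  have hjq : Quotient.mk _ j = q := by
    by_contra h
    exact hj (hz u hqu j h)
  refine ⟨b.repr v j / b.repr u j, b.repr.injective (Finsupp.ext fun i => ?_)⟩
  rw [map_smul, Finsupp.smul_apply, smul_eq_mul]
  by_cases hi : Quotient.mk _ i = q
  · obtain ⟨g, hg⟩ := Quotient.exact (hi.trans hjq.symm)
    have h1 := hb.repr_rep (g := g) trivial hg u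
    have h2 := hb.repr_rep (g := g) trivial hg v
    rw [hu] at h1
    rw [hv] at h2
    rw [← h1, ← h2, div_mul_cancel₀ _ hj]
  · rw [hz v hqv i hi, hz u hqu i hi, mul_zero]

/-- The identity is the sum over orbits q of s ∘ π_q ∘ i, with π_q the projection to the span of q,
so by locality one summand is invertible. For this q, `s` is an isomorphism from the span of q onto
the module, and it carries the orbit to a permuted basis. -/
theorem IsIndecomposable.isPermutationRep_of_retract [Finite Γ] [CharP F p] (hΓ : IsPGroup p Γ)
    {ρ : Representation F Γ V} [FiniteDimensional F V] (hρ : IsIndecomposable ρ) [Finite ι]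
    (hb : Permutes π ⊤ b) (i : ρ.IntertwiningMap π) (s : π.IntertwiningMap ρ)
    (hsi : s.comp i = IntertwiningMap.id ρ) : IsPermutationRep ρ := by
  classical
  have := Fintype.ofFinite (Quotient (basisOrbitRel π b))
  have := hρ.1
  have hs : ∀ g u, s (π g u) = ρ g (s u) := fun g u => s.isIntertwining _ _ g u
  have hi : ∀ g u, i (ρ g u) = π g (i u) := fun g u => i.isIntertwining _ _ g u
  have hq : ∀ q g u, orbitProj π b q (π g u) = π g (orbitProj π b q u) := fun q g u =>
    DFunLike.congr_fun (orbitProj_commute hb q g) u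
  obtain ⟨q, -, hunit⟩ := exists_isUnit_of_isUnit_sum hρ Finset.univ
    (fun q => s.toLinearMap ∘ₗ orbitProj π b q ∘ₗ i.toLinearMap)
    (fun q g => LinearMap.ext fun v => by
      change s (orbitProj π b q (i (ρ g v))) = ρ g (s (orbitProj π b q (i v)))
      rw [hi, hq, hs]) (by
      have : ∑ q, s.toLinearMap ∘ₗ orbitProj π b q ∘ₗ i.toLinearMap = 1 := by
        refine LinearMap.ext fun v => ?_
        have h1 := DFunLike.congr_fun (sum_orbitProj (π := π) (b := b)) (i v)
        have h2 := congrArg (fun f : ρ.IntertwiningMap ρ => f v) hsi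
        rw [LinearMap.sum_apply] at h1 ⊢
        simp only [LinearMap.comp_apply]
        rw [← map_sum, IntertwiningMap.toLinearMap_apply]
        exact (congrArg s h1).trans h2
      rw [this]
      exact isUnit_one)
  have hinj := (LinearMap.isUnit_iff_ker_eq_bot _).1 hunit
  have hsurj := (LinearMap.isUnit_iff_range_eq_top _).1 hunit
  have hidem : ∀ u, orbitProj π b q (orbitProj π b q u) = orbitProj π b q u := fun u =>
    b.repr.injective (Finsupp.ext fun j => by simp only [repr_orbitProj]; split_ifs <;> rfl)
  -- the kernel of `s` on the span of the orbit
  let N : Subrepresentation π := ⟨LinearMap.ker s.toLinearMap ⊓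
      LinearMap.eqLocus (orbitProj π b q) LinearMap.id, fun g u hu => by
    refine ⟨?_, ?_⟩
    · have h1 : s u = 0 := hu.1
      change s (π g u) = 0
      rw [hs, h1, map_zero]
    · have h1 : orbitProj π b q u = u := hu.2
      change orbitProj π b q (π g u) = π g u
      rw [hq, h1]⟩
  -- If the kernel were nonzero it would contain a nonzero fixed vector `u`. Take a nonzero fixed
  -- `v` in the module: its component in the span of q is fixed, hence a multiple of `u`, hence
  -- killed by `s`. This contradicts injectivity of s ∘ π_q ∘ i.
  have hN : N.toSubmodule = ⊥ := by
    by_contra hne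
    have : Nontrivial N.toSubmodule := Submodule.nontrivial_iff_ne_bot.2 hne
    obtain ⟨u, hu0, hu⟩ := exists_fixed_ne_zero hΓ N.toRepresentation
    obtain ⟨v, hv0, hv⟩ := exists_fixed_ne_zero hΓ ρ
    obtain ⟨c, hc⟩ := exists_smul_of_fixed hb q (u := u) (v := orbitProj π b q (i v))
      (fun g => congrArg Subtype.val (hu g)) (fun g => by rw [← hq, ← hi, hv]) u.2.2
      (hidem _) fun h => hu0 (Subtype.ext h)
    have h1 : s (u : U) = 0 := u.2.1
    refine hv0 ((LinearMap.ker_eq_bot'.1 hinj) v ?_)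
    change s (orbitProj π b q (i v)) = 0
    rw [hc, map_smul, h1, smul_zero]
  have hbq : ∀ j : {j // Quotient.mk (basisOrbitRel π b) j = q}, orbitProj π b q (b j) = b j :=
    fun j => by rw [orbitProj, b.constr_basis, if_pos j.2]
  have hspan : Submodule.span F (Set.range fun j : {j // Quotient.mk (basisOrbitRel π b) j = q} =>
      b j) = LinearMap.range (orbitProj π b q) := by
    refine le_antisymm (Submodule.span_le.2 ?_) ?_
    · rintro _ ⟨j, rfl⟩
      exact ⟨_, hbq j⟩
    · rw [LinearMap.range_eq_map, ← b.span_eq, Submodule.map_span_le]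
      rintro _ ⟨j, rfl⟩
      rw [orbitProj, b.constr_basis]
      split_ifs with h
      · exact Submodule.subset_span ⟨⟨j, h⟩, rfl⟩
      · exact Submodule.zero_mem _
  -- The elements of the orbit are independent, and `s` is injective on their span because `N` is
  -- zero.
  have hli : LinearIndependent F fun j : {j // Quotient.mk (basisOrbitRel π b) j = q} =>
      s.toLinearMap (b j) := by
    refine (b.linearIndependent.comp _ Subtype.val_injective).map (f := s.toLinearMap) ?_
    rw [Submodule.disjoint_def]
    intro u hu hu'
    have h2 : u ∈ LinearMap.range (orbitProj π b q) := hspan.le hu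
    obtain ⟨w, rfl⟩ := h2
    have h3 : orbitProj π b q w ∈ N.toSubmodule := ⟨hu', hidem w⟩
    rwa [hN, Submodule.mem_bot] at h3
  refine isPermutationRep_of_permutes (b := Module.Basis.mk hli ?_) ?_
  · rw [← hsurj]
    rintro _ ⟨v, rfl⟩
    have h1 : orbitProj π b q (i v) ∈ LinearMap.range (orbitProj π b q) := ⟨_, rfl⟩
    rw [← hspan] at h1
    have h2 := Submodule.mem_map_of_mem (f := s.toLinearMap) h1
    rw [Submodule.map_span, ← Set.range_comp] at h2
    exact h2
  · rintro g - ⟨j, hj⟩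
    obtain ⟨j', hj'⟩ := hb g trivial j
    refine ⟨⟨j', ?_⟩, ?_⟩
    · rw [← hj]
      exact Quotient.sound (s := basisOrbitRel π b) ((basisOrbitRel π b).symm ⟨g, hj'⟩)
    · rw [Module.Basis.mk_apply, Module.Basis.mk_apply, ← hj']
      exact (hs g _).symm

/-- Induction on the dimension: both parts of a proper decomposition are again retracts of the same
permutation module `π`, so only the indecomposable case has content. -/
theorem isPermutationRep_of_retract_aux [Finite Γ] [CharP F p] (hΓ : IsPGroup p Γ) [Finite ι] (hb : Permutes π ⊤ b)
    (n : ℕ) : ∀ {V : Type*} [AddCommGroup V] [Module F V] [FiniteDimensional F V]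
      (ρ : Representation F Γ V) (i : ρ.IntertwiningMap π) (s : π.IntertwiningMap ρ),
      s.comp i = IntertwiningMap.id ρ → Module.finrank F V ≤ n → IsPermutationRep ρ := by
  induction n with
  | zero =>
    intro V _ _ _ ρ _ _ _ hn
    have := Module.finrank_zero_iff.1 (Nat.le_zero.1 hn)
    exact ⟨0, Module.Basis.empty V, fun _ j => j.elim0⟩
  | succ n ih =>
    intro V _ _ _ ρ i s hsi hn
    rcases subsingleton_or_nontrivial V with hV | hV
    · exact ⟨0, Module.Basis.empty V, fun _ j => j.elim0⟩
    by_cases hρ : IsIndecomposable ρ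
    · exact hρ.isPermutationRep_of_retract hΓ hb i s hsi
    obtain ⟨A, B, hAB, hA, hB⟩ := exists_isCompl_of_not_isIndecomposable hρ
    have hc := isCompl_toSubmodule hAB
    have key : ∀ A B : Subrepresentation ρ, IsCompl A B → B ≠ ⊥ →
        IsPermutationRep A.toRepresentation := by
      intro A B hAB hB
      have hlt : A.toSubmodule < ⊤ := lt_top_iff_ne_top.2 fun h => hB
        (Subrepresentation.toSubmodule_injective (eq_bot_of_top_isCompl
          (h ▸ isCompl_toSubmodule hAB)))
      refine ih A.toRepresentation (i.comp (subrepIncl A)) ((subrepProj A B hAB).comp s) ?_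
        (Nat.le_of_lt_succ ((Submodule.finrank_lt hlt.ne).trans_le hn))
      refine IntertwiningMap.ext (LinearMap.ext fun v => ?_)
      have h1 := congrArg (fun f : ρ.IntertwiningMap ρ => f (v : V)) hsi
      have h2 := congrArg (fun f : IntertwiningMap _ _ => f v) (subrepProj_incl A B hAB)
      exact (congrArg (subrepProj A B hAB) h1).trans h2
    exact isPermutationRep_of_isCompl hAB (key A B hAB hB) (key B A hAB.symm hA)

/-- Over a field of characteristic `p`, direct summands of permutation modules for `p`-groups are
permutation modules. -/
theorem isPermutationRep_of_retract [Finite Γ] [CharP F p] (hΓ : IsPGroup p Γ) {ρ : Representation F Γ V}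
    (hπ : IsPermutationRep π) (i : ρ.IntertwiningMap π) (s : π.IntertwiningMap ρ)
    (hsi : s.comp i = IntertwiningMap.id ρ) : IsPermutationRep ρ := by
  obtain ⟨n, b, hb⟩ := hπ
  have : FiniteDimensional F U := Module.Finite.of_basis b
  have : FiniteDimensional F V := Module.Finite.of_surjective s.toLinearMap fun v =>
    ⟨i v, congrArg (fun f : ρ.IntertwiningMap ρ => f v) hsi⟩
  exact isPermutationRep_of_retract_aux hΓ (b := b) (fun g _ => hb g) _ ρ i s hsi le_rfl

end PGroups

end BPDecomp

namespace BPDecomp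

open Representation IsLocalRing

/-! ### Permutation modules induced from a subgroup, and averaging over cosets. -/

section CosetRep

variable {k : Type*} [CommRing k] {Γ : Type*} [Group Γ] {V : Type*} [AddCommGroup V] [Module k V]
  {ι : Type*}

/-- The relation on `Γ × ι` whose quotient is the `Γ`-set induced from the `E`-set `ι`, for a
basis `b` that is permuted by `E`. -/
@[reducible]
def indRel (ρ : Representation k Γ V) (E : Subgroup Γ) (b : Module.Basis ι k V) :
    Setoid (Γ × ι) where
  r x y := ∃ e ∈ E, y.1 = e * x.1 ∧ ρ e (b x.2) = b y.2
  iseqv :=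
    { refl := fun x => ⟨1, E.one_mem, by simp, by simp⟩
      symm := fun {x y} ⟨e, he, h1, h2⟩ => ⟨e⁻¹, E.inv_mem he, by simp [h1],
        by rw [← h2, ← Module.End.mul_apply, ← map_mul]; simp⟩
      trans := fun {x y z} ⟨e, he, h1, h2⟩ ⟨f, hf, h3, h4⟩ => ⟨f * e, E.mul_mem hf he,
        by rw [h3, h1, mul_assoc], by rw [map_mul, Module.End.mul_apply, h2, h4]⟩ }

variable (ρ : Representation k Γ V) (E : Subgroup Γ) (b : Module.Basis ι k V)

/-- The action of `Γ` on the induced set. -/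
def indShift (g : Γ) : Quotient (indRel ρ E b) → Quotient (indRel ρ E b) :=
  Quotient.map (fun x => (x.1 * g⁻¹, x.2)) fun _ _ ⟨e, he, h1, h2⟩ =>
    ⟨e, he, by simp [h1, mul_assoc], h2⟩

/-- The permutation module on the induced set. -/
def indPermRep : Representation k Γ (Quotient (indRel ρ E b) →₀ k) where
  toFun g := Finsupp.lmapDomain k k (indShift ρ E b g)
  map_one' := by
    refine Finsupp.lhom_ext' fun q => LinearMap.ext_ring ?_
    induction q using Quotient.inductionOn with
    | h x => simp [indShift]
  map_mul' g h := by
    refine Finsupp.lhom_ext' fun q => LinearMap.ext_ring ?_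
    induction q using Quotient.inductionOn with
    | h x => simp [indShift, mul_assoc]

theorem indPermRep_single (g h : Γ) (i : ι) (r : k) :
    indPermRep ρ E b g (Finsupp.single (Quotient.mk _ (h, i)) r) =
      Finsupp.single (Quotient.mk _ (h * g⁻¹, i)) r := by
  simp [indPermRep, indShift]

theorem permutes_indPermRep :
    Permutes (indPermRep ρ E b) ⊤ (Finsupp.basisSingleOne (R := k)) := by
  rintro g - q
  exact ⟨indShift ρ E b g q, by simp [indPermRep]⟩

/-- Stabilizers in an induced set are conjugate into the subgroup `E` from which one induces. Later
`E` lies in a twisted diagonal group, and freeness on the right follows. -/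
theorem mem_of_indPermRep_fixed [Nontrivial k] {g h : Γ} {i : ι}
    (hg : indPermRep ρ E b g (Finsupp.basisSingleOne (Quotient.mk _ (h, i))) =
      Finsupp.basisSingleOne (Quotient.mk _ (h, i))) : h * g * h⁻¹ ∈ E := by
  rw [Finsupp.coe_basisSingleOne, indPermRep_single] at hg
  obtain ⟨e, he, h1, -⟩ := Quotient.exact (Finsupp.single_left_injective one_ne_zero hg)
  have h1 : h = e * (h * g⁻¹) := h1
  have : h * g * h⁻¹ = e := by
    rw [mul_inv_eq_iff_eq_mul]
    conv_lhs => rw [h1]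
    simp [mul_assoc]
  exact this ▸ he

/-- The map `v ↦ g ⊗ v`. -/
def indPermMk (g : Γ) : V →ₗ[k] (Quotient (indRel ρ E b) →₀ k) :=
  b.constr k fun i => Finsupp.single (Quotient.mk _ (g, i)) 1

variable {ρ E b}

theorem indPermMk_mul (hb : Permutes ρ E b) {e : Γ} (he : e ∈ E) (g : Γ) (v : V) :
    indPermMk ρ E b (e * g) (ρ e v) = indPermMk ρ E b g v := by
  have : indPermMk ρ E b (e * g) ∘ₗ ρ e = indPermMk ρ E b g := by
    refine b.ext fun i => ?_
    obtain ⟨j, hj⟩ := hb e he i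
    rw [LinearMap.comp_apply, hj, indPermMk, indPermMk, b.constr_basis, b.constr_basis]
    congr 1
    exact Quotient.sound (s := indRel ρ E b) ((indRel ρ E b).symm ⟨e, he, rfl, hj⟩)
  exact DFunLike.congr_fun this v

theorem indPermRep_mk (g h : Γ) (v : V) :
    indPermRep ρ E b g (indPermMk ρ E b h v) = indPermMk ρ E b (h * g⁻¹) v := by
  have : indPermRep ρ E b g ∘ₗ indPermMk ρ E b h = indPermMk ρ E b (h * g⁻¹) := by
    refine b.ext fun i => ?_
    rw [LinearMap.comp_apply, indPermMk, indPermMk, b.constr_basis, b.constr_basis,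
      indPermRep_single]
  exact DFunLike.congr_fun this v

/-- The summands of the map `g ⊗ v ↦ ∑ d⁻¹ g ⊗ d⁻¹ v`. -/
def averageTerm (hb : Permutes ρ E b) (D : Subgroup Γ) (g : Γ) :
    D ⧸ E.subgroupOf D → V →ₗ[k] (Quotient (indRel ρ E b) →₀ k) :=
  Quotient.lift (s := QuotientGroup.leftRel _)
    (fun d => indPermMk ρ E b ((d : Γ)⁻¹ * g) ∘ₗ ρ (d : Γ)⁻¹) fun d d' h => by
      have h := QuotientGroup.leftRel_apply.1 h
      rw [Subgroup.mem_subgroupOf] at h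
      refine LinearMap.ext fun v => ?_
      have h1 := indPermMk_mul hb h ((d' : Γ)⁻¹ * g) (ρ (d' : Γ)⁻¹ v)
      simp only [LinearMap.comp_apply]
      rw [← h1, ← Module.End.mul_apply, ← map_mul]
      simp [mul_assoc]

theorem averageTerm_mk (hb : Permutes ρ E b) (D : Subgroup Γ) (g : Γ) (d : D) (v : V) :
    averageTerm hb D g (QuotientGroup.mk d) v =
      indPermMk ρ E b ((d : Γ)⁻¹ * g) (ρ (d : Γ)⁻¹ v) := rfl

open Classical in
/-- The map `g ⊗ v ↦ ∑ d⁻¹ g ⊗ d⁻¹ v`. -/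
def averageMap [Finite Γ] (hb : Permutes ρ E b) (D : Subgroup Γ) (g : Γ) :
    V →ₗ[k] (Quotient (indRel ρ E b) →₀ k) :=
  letI := Fintype.ofFinite (D ⧸ E.subgroupOf D)
  ∑ q, averageTerm hb D g q

/-- Left translation by d⁻¹ permutes the cosets of `E` in `D` and with them the summands. Thus
averaging respects the relations of induction from `D`, although each summand only respects those of
`E`. -/
theorem averageMap_mul [Finite Γ] (hb : Permutes ρ E b) (D : Subgroup Γ) (d : D) (g : Γ) (v : V) :
    averageMap hb D (d * g) (ρ d v) = averageMap hb D g v := by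
  classical
  let := Fintype.ofFinite (D ⧸ E.subgroupOf D)
  rw [averageMap, averageMap, LinearMap.sum_apply, LinearMap.sum_apply]
  refine Fintype.sum_equiv (MulAction.toPerm d⁻¹) _ _ fun q => ?_
  induction q using QuotientGroup.induction_on with
  | H c =>
    change _ = averageTerm hb D g (QuotientGroup.mk (d⁻¹ * c)) v
    rw [averageTerm_mk, averageTerm_mk, ← Module.End.mul_apply, ← map_mul]
    simp [mul_assoc]

theorem indPermRep_averageMap [Finite Γ] (hb : Permutes ρ E b) (D : Subgroup Γ) (g h : Γ) (v : V) :
    indPermRep ρ E b g (averageMap hb D h v) = averageMap hb D (h * g⁻¹) v := by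
  classical
  let := Fintype.ofFinite (D ⧸ E.subgroupOf D)
  rw [averageMap, averageMap, LinearMap.sum_apply, LinearMap.sum_apply, map_sum]
  refine Finset.sum_congr rfl fun q _ => ?_
  induction q using QuotientGroup.induction_on with
  | H c => rw [averageTerm_mk, averageTerm_mk, indPermRep_mk, mul_assoc]

end CosetRep

/-! ### Relative projectivity and factorization through permutation modules. -/

section RelativeProjectivity

variable {k : Type*} [CommRing k] {Γ : Type*} [Group Γ] {V : Type*} [AddCommGroup V] [Module k V]

theorem isRelProjective_top (ρ : Representation k Γ V) : IsRelProjective ρ ⊤ := by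
  refine ⟨LinearMap.intertwiningMap_of_isIntertwiningMap _ _ (IndV.mk _ _ 1) fun g v => ?_,
    indLift _ (IntertwiningMap.id _), IntertwiningMap.ext (LinearMap.ext fun v => ?_)⟩
  · rw [ind_mk, one_mul]
    have h := Coinvariants.mk_self_apply (tprod ((leftRegular k Γ).comp
      (⊤ : Subgroup Γ).subtype) (ρ.comp (⊤ : Subgroup Γ).subtype)) ⟨g, trivial⟩
        (MonoidAlgebra.single g⁻¹ 1 ⊗ₜ v)
    simpa using h
  · have h := indLift_mk (⊤ : Subgroup Γ).subtype
      (IntertwiningMap.id (ρ.comp (⊤ : Subgroup Γ).subtype)) 1 v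
    rw [inv_one, map_one] at h
    exact h

theorem exists_isVertex [Finite Γ] (ρ : Representation k Γ V) : ∃ D, IsVertex ρ D := by
  obtain ⟨D, -, hD⟩ := (Set.toFinite {D | IsRelProjective ρ D}).exists_le_minimal
    (isRelProjective_top ρ)
  exact ⟨D, hD⟩

theorem indV_mk_mul {Δ : Type*} [Group Δ] (i : Δ →* Γ) (υ : Representation k Δ V) (d : Δ) (g : Γ)
    (v : V) : IndV.mk i υ (i d * g) (υ d v) = IndV.mk i υ g v := by
  have h := Coinvariants.mk_self_apply (tprod ((leftRegular k Γ).comp i) υ) d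
    (MonoidAlgebra.single g 1 ⊗ₜ v)
  simpa using h

variable {ι : Type*} {ρ : Representation k Γ V} {A B : Subrepresentation ρ} {D E : Subgroup Γ}
  {b : Module.Basis ι k V}

/-- If a direct summand `A` of `ρ` is relatively `D`-projective and `E ≤ D` is of invertible index,
then the projection onto `A` factors through the permutation module induced from a basis permuted
by `E`. -/
theorem IsRelProjective.exists_factor [Finite Γ] (hD : IsRelProjective A.toRepresentation D)
    (hAB : IsCompl A B) (hb : Permutes ρ E b) (hED : E ≤ D)
    (hunit : IsUnit (Nat.card (D ⧸ E.subgroupOf D) : k)) :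
    ∃ (i : ρ.IntertwiningMap (indPermRep ρ E b)) (s : (indPermRep ρ E b).IntertwiningMap ρ),
      s.comp i = (subrepIncl A).comp (subrepProj A B hAB) := by
  classical
  let := Fintype.ofFinite (D ⧸ E.subgroupOf D)
  obtain ⟨i₀, s₀, h₀⟩ := hD
  obtain ⟨u, hu⟩ := hunit
  let υ := A.toRepresentation.comp D.subtype
  -- Averaging over D/E, divided by [D:E]. The values are formed with vectors of `V` and not of `A`,
  -- because only `V` is known to have a basis permuted by `E`.
  let α : (ind D.subtype υ).IntertwiningMap (indPermRep ρ E b) :=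
    ⟨Coinvariants.lift _ (TensorProduct.lift <| (Finsupp.lift _ _ _ fun g =>
        (↑u⁻¹ : k) • (averageMap hb D g ∘ₗ A.toSubmodule.subtype)) ∘ₗ
          (MonoidAlgebra.coeffLinearEquiv k).toLinearMap) fun d => by
        ext g x q
        have h : averageMap hb D (d * g) (υ d x : A.toSubmodule) q = averageMap hb D g x q :=
          DFunLike.congr_fun (averageMap_mul hb D d g (x : V)) q
        simp [h],
      fun g => by
        ext h x
        have h2 := indPermRep_averageMap hb D g h (x : V)
        simp [h2]⟩
  have hα : ∀ g (x : A.toSubmodule), α (IndV.mk D.subtype υ g x) =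
      (↑u⁻¹ : k) • averageMap hb D g (x : V) := fun g x => by simp [α]
  have hp : ∀ g v, subrepProj A B hAB (ρ g v) = A.toRepresentation g (subrepProj A B hAB v) :=
    fun g v => (subrepProj A B hAB).isIntertwining _ _ g v
  -- In the other direction: project `V` to `A` and read g ⊗ v over `D` instead of `E`.
  let β₀ : (Quotient (indRel ρ E b) →₀ k) →ₗ[k] IndV D.subtype υ :=
    Finsupp.linearCombination k (Quotient.lift (s := indRel ρ E b)
      (fun x => IndV.mk D.subtype υ x.1 (subrepProj A B hAB (b x.2))) fun x y ⟨e, he, h1, h2⟩ => by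
        rw [← h2, h1, hp]
        exact (indV_mk_mul D.subtype υ ⟨e, hED he⟩ x.1 _).symm)
  have hβ : ∀ g v, β₀ (indPermMk ρ E b g v) = IndV.mk D.subtype υ g (subrepProj A B hAB v) := by
    intro g v
    have : β₀ ∘ₗ indPermMk ρ E b g =
        IndV.mk D.subtype υ g ∘ₗ (subrepProj A B hAB).toLinearMap := by
      refine b.ext fun i => ?_
      rw [LinearMap.comp_apply, indPermMk, b.constr_basis]
      simp only [β₀, Finsupp.linearCombination_single, one_smul, Quotient.lift_mk]
      rfl
    exact DFunLike.congr_fun this v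
  let β : (indPermRep ρ E b).IntertwiningMap (ind D.subtype υ) := ⟨β₀, fun g => by
    refine Finsupp.lhom_ext' fun q => LinearMap.ext_ring ?_
    induction q using Quotient.inductionOn with
    | h x =>
      obtain ⟨h, i⟩ := x
      have h1 := indPermRep_single ρ E b g h i 1
      have h2 := ind_mk D.subtype υ g h (subrepProj A B hAB (b i))
      simp only [LinearMap.comp_apply, Finsupp.lsingle_apply, h1]
      simp only [β₀, Finsupp.linearCombination_single, one_smul, Quotient.lift_mk]
      exact h2.symm⟩
  -- Every coset contributes the same g ⊗ x to the unnormalized sum, so the total is [D:E] g ⊗ x and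
  -- the normalization gives the identity.
  have hβα : ∀ z, β (α z) = z := by
    intro z
    have : β.toLinearMap ∘ₗ α.toLinearMap = LinearMap.id := by
      refine IndV.hom_ext _ _ fun g => LinearMap.ext fun x => ?_
      have h1 : β₀ (averageMap hb D g (x : V)) =
          (Nat.card (D ⧸ E.subgroupOf D) : k) • IndV.mk D.subtype υ g x := by
        rw [averageMap, LinearMap.sum_apply, map_sum, Nat.card_eq_fintype_card,
          ← Finset.card_univ, Nat.cast_smul_eq_nsmul, ← Finset.sum_const]
        refine Finset.sum_congr rfl fun q _ => ?_
        induction q using QuotientGroup.induction_on with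
        | H c =>
          rw [averageTerm_mk, hβ, hp]
          have h2 : subrepProj A B hAB (x : V) = x :=
            congrArg (fun f : IntertwiningMap _ _ => f x) (subrepProj_incl A B hAB)
          rw [h2]
          exact indV_mk_mul D.subtype υ c⁻¹ g x
      change β₀ (α (IndV.mk D.subtype υ g x)) = IndV.mk D.subtype υ g x
      rw [hα, map_smul, h1, ← hu, smul_smul, Units.inv_mul, one_smul]
    exact DFunLike.congr_fun this z
  refine ⟨α.comp (i₀.comp (subrepProj A B hAB)), (subrepIncl A).comp (s₀.comp β), ?_⟩
  refine IntertwiningMap.ext (LinearMap.ext fun v => ?_)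
  change subrepIncl A (s₀ (β (α (i₀ (subrepProj A B hAB v))))) = _
  rw [hβα]
  exact congrArg (subrepIncl A)
    (congrArg (fun f : IntertwiningMap _ _ => f (subrepProj A B hAB v)) h₀)

end RelativeProjectivity

end BPDecomp

namespace BPDecomp

open Representation IsLocalRing

/-! ### Reduction to permutation bimodules that are free on the right. -/

section RightFree

universe uO uG uH uV

/-- The endomorphism `e` factors through a permutation bimodule with a finite permuted basis on
which the group on the right acts freely. -/
def FactorsRightFree {O : Type uO} [CommRing O] {G : Type uG} {H : Type uH} [Group G] [Group H]
    {V : Type uV} [AddCommGroup V] [Module O V] (ρ : Representation O (G × H) V)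
    (e : Module.End O V) : Prop :=
  ∃ (V' : Type max uO uG uH) (_ : AddCommGroup V') (_ : Module O V')
    (ρ' : Representation O (G × H) V') (n : ℕ) (b : Module.Basis (Fin n) O V')
    (i : ρ.IntertwiningMap ρ') (s : ρ'.IntertwiningMap ρ),
    Permutes ρ' ⊤ b ∧ RightFree ρ' b ∧ (s.comp i).toLinearMap = e

variable {O : Type uO} [CommRing O] {G : Type uG} {H : Type uH} [Group G] [Group H]
  {V : Type uV} [AddCommGroup V] [Module O V] {ρ : Representation O (G × H) V}

theorem FactorsRightFree.of_basis {V' : Type max uO uG uH} [AddCommGroup V'] [Module O V']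
    {ρ' : Representation O (G × H) V'} {ι : Type*} [Finite ι] {b : Module.Basis ι O V'}
    (hb : Permutes ρ' ⊤ b) (hf : RightFree ρ' b) (i : ρ.IntertwiningMap ρ')
    (s : ρ'.IntertwiningMap ρ) : FactorsRightFree ρ (s.comp i).toLinearMap := by
  have := Fintype.ofFinite ι
  refine ⟨V', _, _, ρ', Fintype.card ι, b.reindex (Fintype.equivFin ι), i, s, fun g _ j => ?_,
    fun h j hj => ?_, rfl⟩
  · obtain ⟨l, hl⟩ := hb g trivial ((Fintype.equivFin ι).symm j)
    exact ⟨Fintype.equivFin ι l, by simpa using hl⟩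
  · rw [Module.Basis.reindex_apply] at hj
    exact hf h _ hj

theorem factorsRightFree_zero : FactorsRightFree ρ 0 := by
  have h := FactorsRightFree.of_basis (ρ := ρ)
    (V' := PUnit.{(max uO uG uH) + 1}) (ρ' := 1) (b := Module.Basis.empty (ι := Fin 0) _)
    (fun _ _ j => Fin.elim0 j) (fun _ j => Fin.elim0 j) 0 0
  exact h

theorem FactorsRightFree.add {e f : Module.End O V} (he : FactorsRightFree ρ e)
    (hf : FactorsRightFree ρ f) : FactorsRightFree ρ (e + f) := by
  obtain ⟨V₁, _, _, ρ₁, n₁, b₁, i₁, s₁, hb₁, hf₁, rfl⟩ := he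
  obtain ⟨V₂, _, _, ρ₂, n₂, b₂, i₂, s₂, hb₂, hf₂, rfl⟩ := hf
  have h := FactorsRightFree.of_basis (ρ := ρ) (ρ' := ρ₁.prod ρ₂) (b := b₁.prod b₂) ?_ ?_
    (i₁.prod i₂) (s₁.comp (IntertwiningMap.fst O ρ₁ ρ₂) + s₂.comp (IntertwiningMap.snd O ρ₁ ρ₂))
  · exact h
  · rintro g - (j | j)
    · obtain ⟨l, hl⟩ := hb₁ g trivial j
      exact ⟨Sum.inl l, by simp [hl]⟩
    · obtain ⟨l, hl⟩ := hb₂ g trivial j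
      exact ⟨Sum.inr l, by simp [hl]⟩
  · rintro h (j | j) hj
    · exact hf₁ h j (by simpa using hj)
    · exact hf₂ h j (by simpa using hj)

theorem IsTwistedDiagonal.eq_one {D : Subgroup (G × H)} (hD : IsTwistedDiagonal D) {h : H}
    (hh : ((1 : G), h) ∈ D) : h = 1 := by
  obtain ⟨P, Q, φ, rfl⟩ := hD
  obtain ⟨y, hy⟩ := hh
  obtain ⟨h1, rfl⟩ := Prod.mk.inj hy
  have : y = 1 := φ.injective (by rw [map_one]; exact Subtype.ext h1)
  simp [this]

theorem isUnit_natCast_of_not_dvd [IsLocalRing O] {p : ℕ} [CharP (ResidueField O) p] {n : ℕ}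
    (hn : ¬ p ∣ n) : IsUnit (n : O) := by
  rw [← residue_ne_zero_iff_isUnit, map_natCast, Ne, CharP.cast_eq_zero_iff (ResidueField O) p]
  exact hn

variable {p : ℕ} [Fact p.Prime]

/-- The p-permutation hypothesis applies to p-groups only, hence the passage to a Sylow p-subgroup
`E` of `D`; its index is prime to p and so invertible in `O`. Point stabilizers lie in conjugates of
E ≤ D, and a twisted diagonal group meets 1 × H trivially. -/
theorem factorsRightFree_of_isRelProjective [IsLocalRing O] [CharP (ResidueField O) p] [Finite G]
    [Finite H] (hρ : IsPPermutation p ρ) {A B : Subrepresentation ρ} (hAB : IsCompl A B)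
    {D : Subgroup (G × H)} (hD : IsRelProjective A.toRepresentation D)
    (hDt : IsTwistedDiagonal D) :
    FactorsRightFree ρ ((subrepIncl A).comp (subrepProj A B hAB)).toLinearMap := by
  let E₀ : Sylow p D := default
  let E : Subgroup (G × H) := (E₀ : Subgroup D).map D.subtype
  have hED : E ≤ D := Subgroup.map_subtype_le _
  have hE : E.subgroupOf D = E₀ := Subgroup.comap_map_eq_self_of_injective D.subtype_injective _
  obtain ⟨n, b, hb⟩ := hρ E (E₀.isPGroup'.map _)
  have hb' : Permutes ρ E b := fun g hg => hb ⟨g, hg⟩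
  obtain ⟨i, s, his⟩ := hD.exists_factor hAB hb' hED (by
    refine isUnit_natCast_of_not_dvd (p := p) ?_
    rw [hE]
    exact E₀.not_dvd_index)
  rw [← his]
  refine FactorsRightFree.of_basis (permutes_indPermRep ρ E b) (fun h q hq => ?_) i s
  induction q using Quotient.inductionOn with
  | h x =>
    obtain ⟨⟨g, l⟩, j⟩ := x
    have h1 := hED (mem_of_indPermRep_fixed ρ E b hq)
    have h2 := hDt.eq_one (h := l * h * l⁻¹) (by simpa using h1)
    simpa using h2

/-- A decomposition of the summand `A` regroups V = A ⊕ B as U ⊕ (U' ⊕ B) and U' ⊕ (U ⊕ B). The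
strict inclusions say that both new complements are larger than `B`, as needed for a Noetherian
induction. -/
theorem isCompl_map_sup {A B : Subrepresentation ρ} (hAB : IsCompl A B)
    {C C' : Subrepresentation A.toRepresentation} (hC : IsCompl C C') :
    ∃ U U' : Subrepresentation ρ, IsCompl U (U' ⊔ B) ∧ IsCompl U' (U ⊔ B) ∧
      U.toSubmodule ⊔ U'.toSubmodule = A.toSubmodule ∧
      (C' ≠ ⊥ → B.toSubmodule < (U' ⊔ B).toSubmodule) ∧
      (C ≠ ⊥ → B.toSubmodule < (U ⊔ B).toSubmodule) := by
  let img : Subrepresentation A.toRepresentation → Subrepresentation ρ := fun C =>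
    ⟨C.toSubmodule.map A.toSubmodule.subtype, by
      rintro g _ ⟨a, ha, rfl⟩
      exact ⟨_, C.apply_mem_toSubmodule g ha, rfl⟩⟩
  have hAB' := isCompl_toSubmodule hAB
  have key : ∀ C C' : Subrepresentation A.toRepresentation, IsCompl C C' →
      IsCompl (img C) (img C' ⊔ B) ∧ (img C).toSubmodule ⊔ (img C').toSubmodule = A.toSubmodule ∧
      (C' ≠ ⊥ → B.toSubmodule < (img C' ⊔ B).toSubmodule) := by
    intro C C' hC
    have hC' := isCompl_toSubmodule hC
    have hsup : (img C).toSubmodule ⊔ (img C').toSubmodule = A.toSubmodule := by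
      rw [← Submodule.map_sup, hC'.sup_eq_top, Submodule.map_subtype_top]
    have hdisj : Disjoint (img C).toSubmodule (img C').toSubmodule :=
      Submodule.disjoint_map A.toSubmodule.subtype_injective hC'.disjoint
    refine ⟨isCompl_of_toSubmodule ⟨?_, ?_⟩, hsup, fun hne => ?_⟩
    · exact hdisj.disjoint_sup_right_of_disjoint_sup_left (hsup ▸ hAB'.disjoint)
    · refine codisjoint_iff.2 ?_
      rw [Subrepresentation.toSubmodule_sup, ← sup_assoc, hsup, hAB'.sup_eq_top]
    · refine lt_of_le_of_ne le_sup_right fun heq => hne ?_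
      have h1 : (img C').toSubmodule ≤ B.toSubmodule := le_sup_left.trans heq.ge
      have h2 : (img C').toSubmodule ≤ A.toSubmodule := le_sup_right.trans hsup.le
      have h3 := hAB'.disjoint h2 h1
      exact Subrepresentation.toSubmodule_injective
        (Submodule.map_injective_of_injective A.toSubmodule.subtype_injective
          ((le_bot_iff.1 h3).trans (Submodule.map_bot _).symm))
  obtain ⟨h1, h2, h3⟩ := key C C' hC
  obtain ⟨h4, -, h6⟩ := key C' C hC.symm
  exact ⟨img C, img C', h1, h4, h2, h3, h6⟩

theorem projection_add {k E : Type*} [Ring k] [AddCommGroup E] [Module k E] {p q : Submodule k E}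
    (h : IsCompl p q) {u w : E} (hu : u ∈ p) (hw : w ∈ q) : p.projection q h (u + w) = u := by
  rw [map_add, Submodule.projection_apply_left h ⟨u, hu⟩,
    Submodule.projection_apply_right h ⟨w, hw⟩, add_zero]

/-- Induction on the complement, from larger to smaller, takes the place of a decomposition into
finitely many indecomposable summands: an indecomposable `A` has a twisted diagonal vertex, and a
decomposable one has parts with larger complements. -/
theorem factorsRightFree_projection [IsDomain O] [IsDiscreteValuationRing O]
    [CharP (ResidueField O) p] [Finite G] [Finite H] (hρ : IsPPermutation p ρ)
    (hρv : HasTwistedDiagonalVertices ρ) [IsNoetherian O V] (B : Submodule O V) :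
    ∀ A B' : Subrepresentation ρ, B'.toSubmodule = B → ∀ hAB : IsCompl A B',
      FactorsRightFree ρ ((subrepIncl A).comp (subrepProj A B' hAB)).toLinearMap := by
  induction B using WellFoundedGT.induction with
  | ind B ih =>
    rintro A B rfl hAB
    rcases subsingleton_or_nontrivial A.toSubmodule with hA | hA
    · convert! factorsRightFree_zero (ρ := ρ)
      refine LinearMap.ext fun v => ?_
      change ((subrepProj A B hAB v : A.toSubmodule) : V) = 0
      rw [Subsingleton.elim (subrepProj A B hAB v) 0]
      rfl
    by_cases hind : IsIndecomposable A.toRepresentation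
    · obtain ⟨D, hD⟩ := exists_isVertex A.toRepresentation
      exact factorsRightFree_of_isRelProjective hρ hAB hD.1 (hρv A B hAB hind D hD)
    obtain ⟨C, C', hC, hC0, hC0'⟩ := exists_isCompl_of_not_isIndecomposable hind
    obtain ⟨U, U', h1, h2, h3, h4, h5⟩ := isCompl_map_sup hAB hC
    -- The projection onto U ⊕ U' along `B` is the sum of the projections onto `U` along U' ⊕ B and
    -- onto `U'` along U ⊕ B.
    convert! (ih _ (h4 hC0') U _ rfl h1).add (ih _ (h5 hC0) U' _ rfl h2) using 1
    refine LinearMap.ext fun v => ?_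
    obtain ⟨a, ha, w, hw, rfl⟩ := Submodule.mem_sup.1
      ((isCompl_toSubmodule hAB).sup_eq_top.ge (Submodule.mem_top (x := v)))
    rw [← h3] at ha
    obtain ⟨u, hu, u', hu', rfl⟩ := Submodule.mem_sup.1 ha
    have e1 := projection_add (isCompl_toSubmodule hAB) (h3.le ha) hw
    have e2 := projection_add (isCompl_toSubmodule h1) hu
      (Submodule.add_mem_sup hu' hw : u' + w ∈ (U' ⊔ B).toSubmodule)
    have e3 := projection_add (isCompl_toSubmodule h2) hu'
      (Submodule.add_mem_sup hu hw : u + w ∈ (U ⊔ B).toSubmodule)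
    refine e1.trans ?_
    rw [LinearMap.add_apply]
    refine congrArg₂ (· + ·) ?_ ?_
    · rw [add_assoc]
      exact e2.symm
    · rw [add_comm u u', add_assoc]
      exact e3.symm

/-- A `p`-permutation bimodule whose indecomposable direct summands have twisted diagonal vertices
is a direct summand of a permutation bimodule on which the group on the right acts freely. -/
theorem exists_retract_rightFree [IsDomain O] [IsDiscreteValuationRing O]
    [CharP (ResidueField O) p] [Finite G] [Finite H] (hρ : IsPPermutation p ρ)
    (hρv : HasTwistedDiagonalVertices ρ) :
    FactorsRightFree ρ LinearMap.id := by
  -- The trivial subgroup already provides a finite basis, so `V` is Noetherian and the induction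
  -- above applies.
  obtain ⟨n, b, -⟩ := hρ ⊥ IsPGroup.of_bot
  have := Module.Finite.of_basis b
  have h : IsCompl (⊤ : Subrepresentation ρ) ⊥ := isCompl_top_bot
  convert! factorsRightFree_projection hρ hρv _ ⊤ ⊥ rfl h
  refine LinearMap.ext fun v => ?_
  have := projection_add (isCompl_toSubmodule h) (u := v) (w := 0) trivial (Submodule.zero_mem _)
  rw [add_zero] at this
  exact this.symm

end RightFree

end BPDecomp

namespace BPDecomp

open Representation IsLocalRing

/-! ### The antipode and the elements e ⊗ f^*. -/

section Antipode

variable {F : Type*} [Field F] {A : Type*} [Group A]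

theorem antipode_add (a b : MonoidAlgebra F A) : antipode (a + b) = antipode a + antipode b :=
  MonoidAlgebra.mapDomain_add _ _ _

theorem antipode_zero : antipode (0 : MonoidAlgebra F A) = 0 := by simp [antipode]

theorem antipode_mul (a b : MonoidAlgebra F A) : antipode (a * b) = antipode b * antipode a := by
  induction a using MonoidAlgebra.induction_linear with
  | zero => simp [antipode_zero]
  | add u v hu hv => simp only [add_mul, mul_add, antipode_add, hu, hv]
  | single c r =>
    induction b using MonoidAlgebra.induction_linear with
    | zero => simp [antipode_zero]
    | add u v hu hv => simp only [add_mul, mul_add, antipode_add, hu, hv]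
    | single d s =>
      simp [antipode, MonoidAlgebra.mapDomain_single, MonoidAlgebra.single_mul_single, mul_comm]

variable {G H : Type*} [Group G] [Group H] {P : Subgroup G} {Q : Subgroup H}

/-- The contributions of C_G(P) and C_H(Q) commute, and the antipode reverses products, whence the
order `f' * f`. -/
theorem tensorElt_mul [Finite G] [Finite H] (φ : Q ≃* P) (e e' : MonoidAlgebra F (Subgroup.centralizer (P : Set G)))
    (f f' : MonoidAlgebra F (Subgroup.centralizer (Q : Set H))) :
    tensorElt φ e f * tensorElt φ e' f' = tensorElt φ (e * e') (f' * f) := by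
  rw [tensorElt, tensorElt, tensorElt, antipode_mul, mapDomain_hom_mul, mapDomain_hom_mul,
    mul_assoc, ← mul_assoc (MonoidAlgebra.mapDomain (inrC φ) _), ← inlC_mul_inrC]
  simp only [mul_assoc]

theorem tensorElt_zero_right (φ : Q ≃* P)
    (e : MonoidAlgebra F (Subgroup.centralizer (P : Set G))) : tensorElt φ e 0 = 0 := by
  simp [tensorElt, antipode_zero]

end Antipode

/-! ### The summand eV(P): projection and conjugation. -/

section Cut

variable {O : Type*} [CommRing O] [IsLocalRing O] {Γ : Type*} [Group Γ] [Finite Γ]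
  {V : Type*} [AddCommGroup V] [Module O V] (ρ : Representation O Γ V)

/-- The projection `V(P) → e V(P)`, `v ↦ e v`. -/
def cutProj (x : LocalPair (ResidueField O) Γ) :
    Brauer ρ x.P →ₗ[ResidueField O] cut ρ x :=
  LinearMap.rangeRestrict (brauerAct ρ x.P x.e)

variable {ρ}

theorem coe_cutProj (x : LocalPair (ResidueField O) Γ) (v : Brauer ρ x.P) :
    (cutProj ρ x v : Brauer ρ x.P) = brauerAct ρ x.P x.e v := rfl

theorem cutProj_coe {x : LocalPair (ResidueField O) Γ} (hx : x.e * x.e = x.e) (a : cut ρ x) :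
    cutProj ρ x a = a := by
  obtain ⟨_, v, rfl⟩ := a
  refine Subtype.ext ?_
  change brauerAct ρ x.P x.e (brauerAct ρ x.P x.e v) = brauerAct ρ x.P x.e v
  rw [← Module.End.mul_apply, ← map_mul, hx]

theorem cutProj_brauerRep (x : LocalPair (ResidueField O) Γ) (g : pairStab x)
    (v : Brauer ρ x.P) :
    cutProj ρ x (brauerRep ρ x.P (Subgroup.inclusion (pairStab_le_normalizer x) g) v) =
      cutRep ρ x g (cutProj ρ x v) := by
  refine Subtype.ext ?_
  rw [coe_cutRep, coe_cutProj, coe_cutProj, brauerRep_brauerAct, mapDomain_conjCent]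

theorem brauerMap_conj_brauerAct (γ : Γ) (P : Subgroup Γ)
    (a : MonoidAlgebra (ResidueField O) (Subgroup.centralizer (P : Set Γ))) (v : Brauer ρ P)
    (h : ∀ (x : P) (v : V), ρ γ (ρ x v) = ρ (Subgroup.equivSMul (MulAut.conj γ) P x) (ρ γ v)) :
    brauerMap (ρ := ρ) (ρ' := ρ) (Subgroup.equivSMul (MulAut.conj γ) P) (ρ γ) h
        (brauerAct ρ P a v) =
      brauerAct ρ (MulAut.conj γ • P : Subgroup Γ)
        (MonoidAlgebra.mapDomain (conjCentralizer γ P) a)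
        (brauerMap (ρ := ρ) (ρ' := ρ) (Subgroup.equivSMul (MulAut.conj γ) P) (ρ γ) h v) := by
  induction a using MonoidAlgebra.induction_linear with
  | zero =>
    rw [map_zero, LinearMap.zero_apply, map_zero, MonoidAlgebra.mapDomain_zero]
    exact (LinearMap.congr_fun (map_zero (brauerAct ρ (MulAut.conj γ • P : Subgroup Γ))) _).symm
  | add x y hx hy => simp only [MonoidAlgebra.mapDomain_add, map_add, LinearMap.add_apply, hx, hy]
  | single c r =>
    rw [MonoidAlgebra.mapDomain_single, brauerAct_single, brauerAct_single, map_smul]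
    congr 1
    obtain ⟨v, rfl⟩ := Br_surjective ρ P v
    rw [brauerRep_Br, brauerMap_Br, brauerMap_Br, brauerRep_Br]
    refine congrArg (Br ρ _) (Subtype.ext ?_)
    change ρ γ (ρ c v) = ρ (conjCentralizer γ P c : Γ) (ρ γ v)
    rw [coe_conjCentralizer, ← Module.End.mul_apply, ← Module.End.mul_apply, ← map_mul, ← map_mul]
    simp

/-- Acting by γ is an isomorphism from V(P) to the Brauer construction at the conjugate of P, and it
takes e to its conjugate. An arbitrary pair `x'` with an equation is admitted because the pairs of a
moved triple are conjugates only up to a proved equality. -/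
theorem exists_Br_mem_cut_smul {x x' : LocalPair (ResidueField O) Γ} (γ : Γ) (hx : x' = γ • x)
    (v : fixedPts ρ x.P) (hv : Br ρ x.P v ∈ cut ρ x) :
    ∃ hv' : ρ γ v ∈ fixedPts ρ x'.P, Br ρ x'.P ⟨ρ γ v, hv'⟩ ∈ cut ρ x' := by
  subst hx
  have h : ∀ (y : x.P) (v : V), ρ γ (ρ y v) =
      ρ (Subgroup.equivSMul (MulAut.conj γ) x.P y) (ρ γ v) := fun y v => by
    have : (Subgroup.equivSMul (MulAut.conj γ) x.P y : Γ) = γ * y * γ⁻¹ := rfl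
    rw [this, ← Module.End.mul_apply, ← Module.End.mul_apply, ← map_mul, ← map_mul]
    simp
  refine ⟨map_mem_fixedPts (Subgroup.equivSMul (MulAut.conj γ) x.P) (ρ γ) h v v.2, ?_⟩
  obtain ⟨m, hm⟩ := hv
  refine ⟨brauerMap (ρ := ρ) (ρ' := ρ) (Subgroup.equivSMul (MulAut.conj γ) x.P) (ρ γ) h m, ?_⟩
  refine (brauerMap_conj_brauerAct γ x.P x.e m h).symm.trans ?_
  rw [hm]
  rfl

end Cut

/-! ### Triples, their conjugates and a change of block. -/

section OmegaLemmas

variable {F : Type*} [Field F] {p : ℕ} {G H K : Type*} [Group G] [Group H] [Group K]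

namespace Omega

variable {P : Subgroup G} {R : Subgroup K} {σ : R ≃* P}

/-- Replace the block of the Brauer pair in a triple. -/
def setBlock (ω : Omega p F H σ) (f : MonoidAlgebra F (Subgroup.centralizer (ω.y.P : Set H)))
    (hf : IsBlockIdempotent f) : Omega p F H σ where
  y := { P := ω.y.P, e := f, isPGroup := ω.y.isPGroup, isBlock := hf }
  φ := ω.φ
  ψ := ω.ψ
  comp := ω.comp

/-- The map ψ determines Q as its image and φ as σψ⁻¹, so only the block is left to vary. -/
theorem exists_eq_setBlock (ω ω' : Omega p F H σ) (h : ∀ r, (ω.ψ r : H) = ω'.ψ r) :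
    ∃ f hf, ω' = ω.setBlock f hf := by
  obtain ⟨⟨⟨Q, e⟩, h1, h2⟩, φ, ψ, hc⟩ := ω
  obtain ⟨⟨⟨Q', e'⟩, h1', h2'⟩, φ', ψ', hc'⟩ := ω'
  obtain rfl : Q = Q' := by
    ext q
    constructor
    · intro hq
      obtain ⟨r, hr⟩ := ψ.surjective ⟨q, hq⟩
      have := h r
      simp only [hr] at this
      rw [this]
      exact (ψ' r).2
    · intro hq
      obtain ⟨r, hr⟩ := ψ'.surjective ⟨q, hq⟩
      have := h r
      simp only [hr] at this
      rw [← this]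
      exact (ψ r).2
  exact ⟨e', h2', (ext_val rfl fun r => (h r).symm)⟩

theorem coe_smul_ψ (a : Subgroup.normalizer (twDiag σ : Set (G × K)) × H) (ω : Omega p F H σ)
    (r r' : R) (hr : (r' : K) = (a.1 : G × K).2 * r * (a.1 : G × K).2⁻¹) :
    ((a • ω).ψ r' : H) = a.2 * ω.ψ r * a.2⁻¹ := by
  rw [smul_ψ]
  have : R.normalizerMonoidHom ⟨(a.1 : G × K).2, snd_mem_normalizer a.1.2⟩ r = r' :=
    Subtype.ext hr.symm
  rw [← this, MulAut.inv_apply_self]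

theorem coe_smul_φ (a : Subgroup.normalizer (twDiag σ : Set (G × K)) × H) (ω : Omega p F H σ)
    (q : ω.y.P) (q' : (a • ω).y.P) (hq : (q' : H) = a.2 * q * a.2⁻¹) :
    ((a • ω).φ q' : G) = (a.1 : G × K).1 * ω.φ q * (a.1 : G × K).1⁻¹ := by
  have : Subgroup.equivSMul (MulAut.conj a.2) ω.y.P q = q' := Subtype.ext hq.symm
  rw [← this]
  change (P.normalizerMonoidHom _ (ω.φ ((Subgroup.equivSMul (MulAut.conj a.2) ω.y.P).symm
    (Subgroup.equivSMul (MulAut.conj a.2) ω.y.P q))) : G) = _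
  rw [MulEquiv.symm_apply_apply]
  rfl

theorem isPGroup_twDiag_φ (ω : Omega p F H σ) : IsPGroup p (twDiag ω.φ) :=
  ω.y.isPGroup.of_equiv (twDiagEquiv ω.φ)

theorem isPGroup_twDiag_ψ (ω : Omega p F H σ) : IsPGroup p (twDiag ω.ψ) :=
  (ω.y.isPGroup.of_equiv ω.ψ.symm).of_equiv (twDiagEquiv ω.ψ)

end Omega

/-- As `g` stabilizes (P,e), conjugation by (g,h) leaves the left factor of e ⊗ f^* alone and only
moves f. The condition on `φ'` is put on elements to avoid transport along `y' = h • y`. -/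
theorem tensorPair_smul {x : LocalPair F G} {y y' : LocalPair F H} {φ : y.P ≃* x.P}
    {φ' : y'.P ≃* x.P} {g : G} {h : H} (hy : y' = h • y) (hg : g ∈ pairStab x)
    (hφ : ∀ (q : y.P) (q' : y'.P), (q' : H) = h * q * h⁻¹ → (φ' q' : G) = g * φ q * g⁻¹) :
    tensorPair x y' φ' = (g, h) • tensorPair x y φ := by
  subst hy
  refine LocalPair.ext_emb ?_ ?_
  · ext w
    rw [LocalPair.smul_P]
    constructor
    · rintro ⟨q', rfl⟩
      obtain ⟨q, rfl⟩ := (Subgroup.equivSMul (MulAut.conj h) y.P).surjective q'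
      exact ⟨_, mk_mem_twDiag φ q, Prod.ext (hφ q _ rfl).symm rfl⟩
    · rintro ⟨_, ⟨q, rfl⟩, rfl⟩
      exact ⟨Subgroup.equivSMul (MulAut.conj h) y.P q, Prod.ext (hφ q _ rfl) rfl⟩
  · rw [LocalPair.smul_emb, emb_tensorPair, emb_tensorPair, LocalPair.smul_emb]
    symm
    refine (mapDomain_hom_mul (MulAut.conj (g, h)).toMonoidHom _ _).trans ?_
    congr 1
    · conv_rhs => rw [← (mem_pairStab.1 hg).2]
      rw [mapDomain_mapDomain, mapDomain_mapDomain]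
      congr 1
      ext a <;> simp
    · rw [antipode, antipode, mapDomain_mapDomain, mapDomain_mapDomain, mapDomain_mapDomain,
        mapDomain_mapDomain]
      congr 1
      ext a <;> simp [mul_assoc]

theorem tensorPair_smul' {y y' : LocalPair F H} {z : LocalPair F K} {ψ : z.P ≃* y.P}
    {ψ' : z.P ≃* y'.P} {h : H} {k : K} (hy : y' = h • y) (hk : k ∈ pairStab z)
    (hψ : ∀ r r' : z.P, (r' : K) = k * r * k⁻¹ → (ψ' r' : H) = h * ψ r * h⁻¹) :
    tensorPair y' z ψ' = (h, k) • tensorPair y z ψ := by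
  subst hy
  have hkn := pairStab_le_normalizer _ hk
  refine LocalPair.ext_emb ?_ ?_
  · ext w
    rw [LocalPair.smul_P]
    constructor
    · rintro ⟨r', rfl⟩
      obtain ⟨r, rfl⟩ := (z.P.normalizerMonoidHom ⟨k, hkn⟩).surjective r'
      exact ⟨_, mk_mem_twDiag ψ r, Prod.ext (hψ r _ rfl).symm rfl⟩
    · rintro ⟨_, ⟨r, rfl⟩, rfl⟩
      exact ⟨z.P.normalizerMonoidHom ⟨k, hkn⟩ r, Prod.ext (hψ r _ rfl) rfl⟩
  · rw [LocalPair.smul_emb, emb_tensorPair, emb_tensorPair, LocalPair.smul_emb]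
    symm
    refine (mapDomain_hom_mul (MulAut.conj (h, k)).toMonoidHom _ _).trans ?_
    congr 1
    · rw [mapDomain_mapDomain, mapDomain_mapDomain]
      congr 1
      ext a <;> simp
    · conv_rhs => rw [← (mem_pairStab.1 hk).2]
      rw [antipode, antipode, mapDomain_mapDomain, mapDomain_mapDomain, mapDomain_mapDomain,
        mapDomain_mapDomain]
      congr 1
      ext a <;> simp [mul_assoc]

end OmegaLemmas

end BPDecomp

namespace BPDecomp

open Representation IsLocalRing

/-! ### Compatibility of Φ with the middle idempotent. -/

section PhiLemmas

variable {O : Type*} [CommRing O] [IsLocalRing O] {G H K : Type*} [Group G] [Group H] [Group K]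
  [Finite G] [Finite H] [Finite K] {V W : Type*} [AddCommGroup V] [Module O V] [AddCommGroup W]
  [Module O W] {ρ : Representation O (G × H) V} {τ : Representation O (H × K) W}

/-- The right action of a on m is the action of (1, a^*), so this is the relation ma ⊗ n = m ⊗ an.
On a group element c it is equivariance under (1, c⁻¹, 1), applied to the pair with second entry c
n. -/
theorem Phi_mid {P : Subgroup G} {Q : Subgroup H} {R : Subgroup K} {φ : Q ≃* P} {ψ : R ≃* Q}
    {σ : R ≃* P} (hσ : ψ.trans φ = σ)
    (a : MonoidAlgebra (ResidueField O) (Subgroup.centralizer (Q : Set H)))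
    (x : Brauer ρ (twDiag φ)) (y : Brauer τ (twDiag ψ)) :
    Phi hσ (brauerAct ρ _ (MonoidAlgebra.mapDomain (inrC φ) (antipode a)) x) y =
      Phi hσ x (brauerAct τ _ (MonoidAlgebra.mapDomain (inlC ψ) a) y) := by
  induction a using MonoidAlgebra.induction_linear with
  | zero => simp [antipode_zero]
  | add u v hu hv =>
    simp only [antipode_add, MonoidAlgebra.mapDomain_add, map_add, LinearMap.add_apply, hu, hv]
  | single c r =>
    rw [antipode, MonoidAlgebra.mapDomain_single, MonoidAlgebra.mapDomain_single,
      MonoidAlgebra.mapDomain_single, brauerAct_single, brauerAct_single, map_smul, map_smul,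
      LinearMap.smul_apply]
    congr 1
    have h := Phi_equivariant hσ (ρ := ρ) (τ := τ) (g := 1) (h := ((c⁻¹ : _) : H)) (k := 1)
      (Subgroup.centralizer_le_normalizer _ (inrC φ c⁻¹).2)
      (Subgroup.centralizer_le_normalizer _ (inlC ψ c⁻¹).2) (Subgroup.one_mem _) x
      (brauerRep τ _ ⟨_, Subgroup.centralizer_le_normalizer _ (inlC ψ c).2⟩ y)
    have h1 : brauerRep (tensorRep ρ τ) (twDiag σ) ⟨((1 : G), (1 : K)), Subgroup.one_mem _⟩ = 1 :=
      map_one _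
    rw [h1, ← Module.End.mul_apply (brauerRep τ _ _), ← map_mul] at h
    have h2 : (⟨(((c⁻¹ : _) : H), 1),
        Subgroup.centralizer_le_normalizer _ (inlC ψ c⁻¹).2⟩ : Subgroup.normalizer
          (twDiag ψ : Set (H × K))) *
        ⟨(inlC ψ c : H × K), Subgroup.centralizer_le_normalizer _ (inlC ψ c).2⟩ = 1 := by
      ext <;> simp [inlC]
    rw [h2, map_one] at h
    exact h

variable {x : LocalPair (ResidueField O) G} {y : LocalPair (ResidueField O) H}
  {z : LocalPair (ResidueField O) K} {φ : y.P ≃* x.P} {ψ : z.P ≃* y.P} {σ : z.P ≃* x.P}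

/-- The outer factors e and d^* pass through Φ, the factor f^* on the left moves across to f on the
right, and it is absorbed there by f² = f. -/
theorem cutProj_Phi (hσ : ψ.trans φ = σ) (hy : y.e * y.e = y.e) (m : Brauer ρ (twDiag φ))
    (n : Brauer τ (twDiag ψ)) :
    cutProj (tensorRep ρ τ) (tensorPair x z σ)
        (Phi hσ m (brauerAct τ _ (MonoidAlgebra.mapDomain (inlC ψ) y.e) n)) =
      cutPhi ρ τ hσ (cutProj ρ (tensorPair x y φ) m) (cutProj τ (tensorPair y z ψ) n) := by
  refine Subtype.ext ?_
  have h1 : ∀ w, brauerAct (tensorRep ρ τ) (twDiag σ) (tensorElt σ x.e z.e) w =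
      brauerAct (tensorRep ρ τ) _ (MonoidAlgebra.mapDomain (inlC σ) x.e)
        (brauerAct (tensorRep ρ τ) _ (MonoidAlgebra.mapDomain (inrC σ) (antipode z.e)) w) :=
    DFunLike.congr_fun (map_mul (brauerAct (tensorRep ρ τ) (twDiag σ)) _ _)
  have h2 : ∀ w, brauerAct ρ (twDiag φ) (tensorElt φ x.e y.e) w =
      brauerAct ρ _ (MonoidAlgebra.mapDomain (inlC φ) x.e)
        (brauerAct ρ _ (MonoidAlgebra.mapDomain (inrC φ) (antipode y.e)) w) :=
    DFunLike.congr_fun (map_mul (brauerAct ρ (twDiag φ)) _ _)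
  have h3 : ∀ w, brauerAct τ (twDiag ψ) (tensorElt ψ y.e z.e) w =
      brauerAct τ _ (MonoidAlgebra.mapDomain (inrC ψ) (antipode z.e))
        (brauerAct τ _ (MonoidAlgebra.mapDomain (inlC ψ) y.e) w) := fun w => by
    refine Eq.trans ?_ (DFunLike.congr_fun (map_mul (brauerAct τ (twDiag ψ)) _ _) w)
    rw [← inlC_mul_inrC]
    rfl
  have h4 : brauerAct τ (twDiag ψ) (MonoidAlgebra.mapDomain (inlC ψ) y.e) n =
      brauerAct τ (twDiag ψ) (MonoidAlgebra.mapDomain (inlC ψ) y.e)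
        (brauerAct τ (twDiag ψ) (MonoidAlgebra.mapDomain (inlC ψ) y.e) n) := by
    rw [← Module.End.mul_apply, ← map_mul, ← mapDomain_hom_mul, hy]
  change brauerAct (tensorRep ρ τ) (twDiag σ) (tensorElt σ x.e z.e) _ =
    Phi hσ (brauerAct ρ (twDiag φ) (tensorElt φ x.e y.e) m)
      (brauerAct τ (twDiag ψ) (tensorElt ψ y.e z.e) n)
  rw [h1, h2, h3, Phi_left, Phi_right, Phi_mid, ← h4]

end PhiLemmas

/-! ### Moving the image of Φ_ω along the action on triples. -/

section Transport

variable {p : ℕ} {O : Type*} [CommRing O] [IsLocalRing O] {G H K : Type*} [Group G] [Group H]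
  [Group K] [Finite G] [Finite H] [Finite K] {V W : Type*} [AddCommGroup V] [Module O V]
  [AddCommGroup W] [Module O W] (ρ : Representation O (G × H) V) (τ : Representation O (H × K) W)
  {x : BrauerPair (ResidueField O) p G} {z : BrauerPair (ResidueField O) p K} {σ : z.P ≃* x.P}

/-- On representatives, (g,k)(v ⊗ w) = (g,h)v ⊗ (h,k)w for the chosen h, and the two new factors
belong to the modules of the moved triple. Existence of preimages suffices, so no isomorphism
between the sources for ω and `a • ω` is set up. -/
theorem exists_cutPhi_smul (ω : Omega p (ResidueField O) H σ)
    (a : Subgroup.normalizer (twDiag σ : Set (G × K)) × H)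
    (hg : (a.1 : G × K).1 ∈ pairStab x.toLocalPair) (hk : (a.1 : G × K).2 ∈ pairStab z.toLocalPair)
    (hgk : (a.1 : G × K) ∈ pairStab (tensorPair x.toLocalPair z.toLocalPair σ))
    (m : cut ρ (tensorPair x.toLocalPair ω.y.toLocalPair ω.φ))
    (n : cut τ (tensorPair ω.y.toLocalPair z.toLocalPair ω.ψ)) :
    ∃ m' n', cutRep (tensorRep ρ τ) (tensorPair x.toLocalPair z.toLocalPair σ) ⟨_, hgk⟩
      (cutPhi ρ τ ω.comp m n) = cutPhi ρ τ (a • ω).comp m' n' := by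
  obtain ⟨⟨⟨g, k⟩, hn⟩, h⟩ := a
  obtain ⟨m, hm⟩ := m
  obtain ⟨n, hn⟩ := n
  obtain ⟨v, rfl⟩ := Br_surjective ρ _ m
  obtain ⟨w, rfl⟩ := Br_surjective τ _ n
  obtain ⟨hv1, hv2⟩ := exists_Br_mem_cut_smul (g, h)
    (tensorPair_smul (φ' := ((⟨⟨(g, k), by assumption⟩, h⟩ :
      Subgroup.normalizer (twDiag σ : Set (G × K)) × H) • ω).φ) rfl hg
      fun q q' hq => ω.coe_smul_φ _ q q' hq) v hm
  obtain ⟨hw1, hw2⟩ := exists_Br_mem_cut_smul (h, k)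
    (tensorPair_smul' (ψ' := ((⟨⟨(g, k), by assumption⟩, h⟩ :
      Subgroup.normalizer (twDiag σ : Set (G × K)) × H) • ω).ψ) rfl hk
      fun r r' hr => ω.coe_smul_ψ _ r r' hr) w hn
  refine ⟨⟨_, hv2⟩, ⟨_, hw2⟩, Subtype.ext (congrArg (Br _ _) (Subtype.ext ?_))⟩
  exact tensorRep_mk ρ τ g h k (v : V) (w : W)

theorem TensorOver.induction {k A B C : Type*} [CommRing k] [Group A] [Group B] [Group C]
    {V W : Type*} [AddCommGroup V] [Module k V] [AddCommGroup W] [Module k W]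
    {ρ : Representation k (A × B) V} {τ : Representation k (B × C) W} {q : TensorOver ρ τ → Prop}
    (t : TensorOver ρ τ) (h0 : q 0)
    (h1 : ∀ v w, q (Coinvariants.mk _ (v ⊗ₜ w))) (h2 : ∀ s t, q s → q t → q (s + t)) : q t := by
  obtain ⟨t, rfl⟩ := Coinvariants.mk_surjective _ t
  induction t using TensorProduct.induction_on with
  | zero => rwa [map_zero]
  | tmul v w => exact h1 v w
  | add s t hs ht => rw [map_add]; exact h2 _ _ hs ht

variable (x z) in
/-- The element `h` of `H`, acting on triples. -/
abbrev inH (σ : z.P ≃* x.P) (h : H) : Subgroup.normalizer (twDiag σ : Set (G × K)) × H := (1, h)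

/-- An element of `H` alone acts trivially on the target, so the image of Φ_ω depends only on the
`H`-orbit of ω. -/
theorem PhiBimod_mem_range_smul (ω : Omega p (ResidueField O) H σ) (h : H)
    (t : TensorOver (bimodRep ρ x ω.y ω.φ) (bimodRep τ ω.y z ω.ψ)) :
    PhiBimod ρ τ ω t ∈ LinearMap.range (PhiBimod ρ τ (inH x z σ h • ω)).toLinearMap := by
  induction t using TensorOver.induction with
  | h0 => rw [map_zero]; exact Submodule.zero_mem _
  | h2 s t hs ht => rw [map_add]; exact Submodule.add_mem _ hs ht
  | h1 m n =>
    obtain ⟨m', n', h'⟩ := exists_cutPhi_smul ρ τ ω (inH x z σ h) (Subgroup.one_mem _)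
      (Subgroup.one_mem _) (Subgroup.one_mem _) m n
    refine ⟨Coinvariants.mk _ (m' ⊗ₜ n'), ?_⟩
    have h1 : cutRep (tensorRep ρ τ) (tensorPair x.toLocalPair z.toLocalPair σ)
      ⟨(1 : G × K), Subgroup.one_mem _⟩ = 1 := map_one _
    exact h'.symm.trans (DFunLike.congr_fun h1 _)

end Transport

/-! ### Naturality, and passage to direct summands. -/

section Naturality

variable {p : ℕ} {O : Type*} [CommRing O] [IsLocalRing O] {G H K : Type*} [Group G] [Group H]
  [Group K] [Finite G] [Finite H] [Finite K] {V V' W W' : Type*} [AddCommGroup V] [Module O V]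
  [AddCommGroup V'] [Module O V'] [AddCommGroup W] [Module O W] [AddCommGroup W'] [Module O W']
  {ρ : Representation O (G × H) V} {ρ' : Representation O (G × H) V'}
  {τ : Representation O (H × K) W} {τ' : Representation O (H × K) W'}

theorem cutMap_cutPhi {x : LocalPair (ResidueField O) G} {y : LocalPair (ResidueField O) H}
    {z : LocalPair (ResidueField O) K} {φ : y.P ≃* x.P} {ψ : z.P ≃* y.P} {σ : z.P ≃* x.P}
    (hσ : ψ.trans φ = σ) (α : ρ.IntertwiningMap ρ') (β : τ.IntertwiningMap τ')
    (m : cut ρ (tensorPair x y φ)) (n : cut τ (tensorPair y z ψ)) :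
    cutMap (tensorMap α β) (tensorPair x z σ) (cutPhi ρ τ hσ m n) =
      cutPhi ρ' τ' hσ (cutMap α _ m) (cutMap β _ n) := by
  obtain ⟨m, hm⟩ := m
  obtain ⟨n, hn⟩ := n
  obtain ⟨v, rfl⟩ := Br_surjective ρ _ m
  obtain ⟨w, rfl⟩ := Br_surjective τ _ n
  rfl

theorem cutMap_comp_eq_self {Γ : Type*} [Group Γ] [Finite Γ] {U U' : Type*} [AddCommGroup U]
    [Module O U] [AddCommGroup U'] [Module O U'] {π : Representation O Γ U}
    {π' : Representation O Γ U'} (i : π.IntertwiningMap π') (s : π'.IntertwiningMap π)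
    (h : ∀ u, s (i u) = u) (x : LocalPair (ResidueField O) Γ) (a : cut π x) :
    cutMap s x (cutMap i x a) = a := by
  obtain ⟨a, ha⟩ := a
  obtain ⟨v, rfl⟩ := Br_surjective π _ a
  exact Subtype.ext (congrArg (Br π x.P) (Subtype.ext (h v)))

variable {x : BrauerPair (ResidueField O) p G} {z : BrauerPair (ResidueField O) p K}
  {σ : z.P ≃* x.P}

theorem bimodMap_PhiBimod (α : ρ.IntertwiningMap ρ') (β : τ.IntertwiningMap τ')
    (ω : Omega p (ResidueField O) H σ)
    (t : TensorOver (bimodRep ρ x ω.y ω.φ) (bimodRep τ ω.y z ω.ψ)) :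
    bimodMap (tensorMap α β) x z σ (PhiBimod ρ τ ω t) =
      PhiBimod ρ' τ' ω (tensorMap (bimodMap α x ω.y ω.φ) (bimodMap β ω.y z ω.ψ) t) := by
  induction t using TensorOver.induction with
  | h0 => simp only [map_zero]
  | h2 s t hs ht => simp only [map_add, hs, ht]
  | h1 m n => exact cutMap_cutPhi ω.comp α β m n

theorem tensorMap_comp_eq_self {k A B C : Type*} [CommRing k] [Group A] [Group B] [Group C]
    {V W V' W' : Type*} [AddCommGroup V] [Module k V] [AddCommGroup W] [Module k W]
    [AddCommGroup V'] [Module k V'] [AddCommGroup W'] [Module k W']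
    {ρ : Representation k (A × B) V} {τ : Representation k (B × C) W}
    {ρ' : Representation k (A × B) V'} {τ' : Representation k (B × C) W'}
    {i : ρ.IntertwiningMap ρ'} {s : ρ'.IntertwiningMap ρ} (h : ∀ v, s (i v) = v)
    {i' : τ.IntertwiningMap τ'} {s' : τ'.IntertwiningMap τ} (h' : ∀ w, s' (i' w) = w)
    (t : TensorOver ρ τ) : tensorMap s s' (tensorMap i i' t) = t := by
  induction t using TensorOver.induction with
  | h0 => simp only [map_zero]
  | h2 a b ha hb => simp only [map_add, ha, hb]
  | h1 v w => rw [tensorMap_mk, tensorMap_mk, h, h']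

/-- The maps `Φ_ω` have separating retractions and jointly span their target. -/
structure PhiSplit (ρ : Representation O (G × H) V) (τ : Representation O (H × K) W)
    (x : BrauerPair (ResidueField O) p G) (z : BrauerPair (ResidueField O) p K)
    (σ : z.P ≃* x.P) : Prop where
  sep : ∀ ω : Omega p (ResidueField O) H σ,
    ∃ L : cut (tensorRep ρ τ) (tensorPair x.toLocalPair z.toLocalPair σ) →ₗ[ResidueField O]
        TensorOver (bimodRep ρ x ω.y ω.φ) (bimodRep τ ω.y z ω.ψ),
      (∀ t, L (PhiBimod ρ τ ω t) = t) ∧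
      ∀ ω' : Omega p (ResidueField O) H σ, (∀ h : H, ω' ≠ inH x z σ h • ω) →
        ∀ t, L (PhiBimod ρ τ ω' t) = 0
  span : ⨆ ω : Omega p (ResidueField O) H σ, LinearMap.range (PhiBimod ρ τ ω).toLinearMap = ⊤

/-- By naturality the Φ_ω commute with `i`, `i'` and with `s`, `s'`. Retractions are compressed, via
L ↦ (s ⊗ s') ∘ L ∘ (i ⊗ i'), and a spanning family is pushed forward along the surjection induced by
`s` and `s'`. -/
theorem PhiSplit.of_retract (h : PhiSplit ρ' τ' x z σ) {i : ρ.IntertwiningMap ρ'}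
    {s : ρ'.IntertwiningMap ρ} (hs : ∀ v, s (i v) = v) {i' : τ.IntertwiningMap τ'}
    {s' : τ'.IntertwiningMap τ} (hs' : ∀ w, s' (i' w) = w) : PhiSplit ρ τ x z σ where
  sep ω := by
    obtain ⟨L, hL1, hL2⟩ := h.sep ω
    refine ⟨(tensorMap (bimodMap s x ω.y ω.φ) (bimodMap s' ω.y z ω.ψ)).toLinearMap ∘ₗ L ∘ₗ
      (bimodMap (tensorMap i i') x z σ).toLinearMap, fun t => ?_, fun ω' h' t => ?_⟩
    · change tensorMap _ _ (L (bimodMap (tensorMap i i') x z σ (PhiBimod ρ τ ω t))) = t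
      rw [bimodMap_PhiBimod, hL1]
      exact tensorMap_comp_eq_self (cutMap_comp_eq_self i s hs _) (cutMap_comp_eq_self i' s' hs' _) t
    · change tensorMap _ _ (L (bimodMap (tensorMap i i') x z σ (PhiBimod ρ τ ω' t))) = 0
      rw [bimodMap_PhiBimod, hL2 ω' h', map_zero]
  span := by
    rw [eq_top_iff]
    intro v _
    have h1 : bimodMap (tensorMap i i') x z σ v ∈ (⊤ : Submodule (ResidueField O) _) := trivial
    rw [← h.span] at h1
    have h2 := Submodule.mem_map_of_mem (f := (bimodMap (tensorMap s s') x z σ).toLinearMap) h1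
    have h3 : (bimodMap (tensorMap s s') x z σ).toLinearMap
        (bimodMap (tensorMap i i') x z σ v) = v :=
      cutMap_comp_eq_self (tensorMap i i') (tensorMap s s') (tensorMap_comp_eq_self hs hs') _ v
    rw [h3, Submodule.map_iSup] at h2
    refine SetLike.le_def.1 (iSup_mono fun ω => ?_) h2
    rintro _ ⟨_, ⟨t, rfl⟩, rfl⟩
    exact ⟨_, (bimodMap_PhiBimod s s' ω t).symm⟩

end Naturality

end BPDecomp

namespace BPDecomp

open Representation IsLocalRing

/-! ### The splitting for right-free permutation bimodules. -/

section PermutationCase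

variable {p : ℕ} {O : Type*} [CommRing O] [IsLocalRing O] {G H K : Type*} [Group G] [Group H]
  [Group K] [Finite G] [Finite H] [Finite K] {V W : Type*} [AddCommGroup V] [Module O V]
  [AddCommGroup W] [Module O W] {ρ : Representation O (G × H) V} {τ : Representation O (H × K) W}
  {x : BrauerPair (ResidueField O) p G} {z : BrauerPair (ResidueField O) p K} {σ : z.P ≃* x.P}
  {ι κ : Type*} {b : Module.Basis ι O V} {c : Module.Basis κ O W}

theorem tensorPair_idem {y : BrauerPair (ResidueField O) p H} (φ : y.P ≃* x.P) :
    (tensorPair x.toLocalPair y.toLocalPair φ).e * (tensorPair x.toLocalPair y.toLocalPair φ).e =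
      (tensorPair x.toLocalPair y.toLocalPair φ).e :=
  (tensorElt_mul φ x.e x.e y.e y.e).trans (by rw [x.isBlock.idem, y.isBlock.idem]; rfl)

variable (ρ x) in
/-- The inclusion `eM(Δ(P,φ,Q))f → M(Δ(P,φ,Q))`. -/
def cutIncl (y : BrauerPair (ResidueField O) p H) (φ : y.P ≃* x.P) :
    cut ρ (tensorPair x.toLocalPair y.toLocalPair φ) →ₗ[ResidueField O] Brauer ρ (twDiag φ) :=
  Submodule.subtype _

variable (ρ x) in
/-- The projection `M(Δ(P,φ,Q)) → eM(Δ(P,φ,Q))f`. -/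
def pairProj (y : BrauerPair (ResidueField O) p H) (φ : y.P ≃* x.P) :
    Brauer ρ (twDiag φ) →ₗ[ResidueField O] cut ρ (tensorPair x.toLocalPair y.toLocalPair φ) :=
  cutProj ρ (tensorPair x.toLocalPair y.toLocalPair φ)

theorem pairProj_cutIncl (y : BrauerPair (ResidueField O) p H) (φ : y.P ≃* x.P)
    (m : cut ρ (tensorPair x.toLocalPair y.toLocalPair φ)) :
    pairProj ρ x y φ (cutIncl ρ x y φ m) = m :=
  cutProj_coe (tensorPair_idem φ) m

variable (ρ τ) in
/-- The map `(m, n) ↦ (e ⊗ f^*) m ⊗ (f ⊗ d^*) n`. -/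
def tensorMk (ω : Omega p (ResidueField O) H σ) :
    Brauer ρ (twDiag ω.φ) →ₗ[ResidueField O] Brauer τ (twDiag ω.ψ) →ₗ[ResidueField O]
      TensorOver (bimodRep ρ x ω.y ω.φ) (bimodRep τ ω.y z ω.ψ) :=
  ((TensorProduct.mk (ResidueField O) _ _).compl₁₂ (pairProj ρ x ω.y ω.φ)
    (pairProj τ ω.y z ω.ψ)).compr₂ (Coinvariants.mk _)

theorem tensorMk_apply (ω : Omega p (ResidueField O) H σ) (m : Brauer ρ (twDiag ω.φ))
    (n : Brauer τ (twDiag ω.ψ)) :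
    tensorMk ρ τ ω m n = Coinvariants.mk _
      (pairProj ρ x ω.y ω.φ m ⊗ₜ pairProj τ ω.y z ω.ψ n) := rfl

theorem tensorMk_brauerRep (ω : Omega p (ResidueField O) H σ)
    {h : H} (hh : h ∈ Subgroup.centralizer (ω.y.P : Set H))
    (h1 : ((1 : G), h) ∈ Subgroup.normalizer (twDiag ω.φ : Set (G × H)))
    (h2 : (h, (1 : K)) ∈ Subgroup.normalizer (twDiag ω.ψ : Set (H × K)))
    (m : Brauer ρ (twDiag ω.φ)) (n : Brauer τ (twDiag ω.ψ)) :
    tensorMk ρ τ ω (brauerRep ρ _ ⟨_, h1⟩ m) (brauerRep τ _ ⟨_, h2⟩ n) = tensorMk ρ τ ω m n := by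
  rw [tensorMk_apply, tensorMk_apply]
  refine Eq.trans ?_ (Coinvariants.mk_self_apply (midRep (bimodRep ρ x ω.y ω.φ)
    (bimodRep τ ω.y z ω.ψ)) ⟨h, hh⟩ _)
  refine congrArg (Coinvariants.mk _) ?_
  refine congrArg₂ (fun u v => u ⊗ₜ[ResidueField O] v) ?_ ?_
  · exact cutProj_brauerRep (tensorPair x.toLocalPair ω.y.toLocalPair ω.φ)
      (centHom x ω.y ω.φ (1, ⟨h, hh⟩)) m
  · exact cutProj_brauerRep (tensorPair ω.y.toLocalPair z.toLocalPair ω.ψ)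
      (centHom ω.y z ω.ψ (⟨h, hh⟩, 1)) n

/-- An element `l` taking one pair to the other satisfies c_l ψ = ψ, so it centralizes Q and is
absorbed by the tensor product over F[C_H(Q)]. This makes the choice of a representative in
`tensorMkInv` harmless. -/
theorem tensorMk_Br_eq (hb : Permutes ρ ⊤ b) (hc : Permutes τ ⊤ c) (hf : RightFree ρ b)
    (ω : Omega p (ResidueField O) H σ) {i i' : ι} {j j' : κ}
    (hi : b i ∈ fixedPts ρ (twDiag ω.φ)) (hi' : b i' ∈ fixedPts ρ (twDiag ω.φ))
    (hj : c j ∈ fixedPts τ (twDiag ω.ψ)) (hj' : c j' ∈ fixedPts τ (twDiag ω.ψ))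
    (h : Coinvariants.mk (midRep ρ τ) (b i ⊗ₜ c j) =
      Coinvariants.mk (midRep ρ τ) (b i' ⊗ₜ c j')) :
    tensorMk ρ τ ω (Br ρ _ ⟨b i, hi⟩) (Br τ _ ⟨c j, hj⟩) =
      tensorMk ρ τ ω (Br ρ _ ⟨b i', hi'⟩) (Br τ _ ⟨c j', hj'⟩) := by
  obtain ⟨l, hl1, hl2, hl⟩ := conj_eq_of_mk_tmul_eq hb hc hf ω.comp ω.comp hi hi' h
  have hlC : l ∈ Subgroup.centralizer (ω.y.P : Set H) := by
    refine Subgroup.mem_centralizer_iff.2 fun q hq => ?_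
    obtain ⟨r, hr⟩ := ω.ψ.surjective ⟨q, hq⟩
    have := hl r
    rw [hr] at this
    simp only at this
    rw [eq_mul_inv_iff_mul_eq] at this
    exact this
  rw [← tensorMk_brauerRep ω hlC (Subgroup.centralizer_le_normalizer _ (inrC ω.φ ⟨l, hlC⟩).2)
    (Subgroup.centralizer_le_normalizer _ (inlC ω.ψ ⟨l, hlC⟩).2) (Br ρ _ ⟨b i, hi⟩),
    brauerRep_Br, brauerRep_Br]
  simp only [hl1, hl2]

/-- Insert 1 = ∑ f, the sum of the blocks of F[C_H(Q)], in the middle: the term with f comes from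
the triple (φ,(Q,f),ψ). -/
theorem pairProj_Phi_mem {Q : Subgroup H} {φ : Q ≃* x.P} {ψ : z.P ≃* Q} (hQ : IsPGroup p Q)
    (hσ : ψ.trans φ = σ) (m : Brauer ρ (twDiag φ)) (n : Brauer τ (twDiag ψ)) :
    pairProj (tensorRep ρ τ) x z σ (Phi hσ m n) ∈
      ⨆ ω : Omega p (ResidueField O) H σ, LinearMap.range (PhiBimod ρ τ ω).toLinearMap := by
  obtain ⟨s, hs1, hs2⟩ := exists_sum_blocks_eq_one (ResidueField O)
    (A := MonoidAlgebra (ResidueField O) (Subgroup.centralizer (Q : Set H)))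
  have h1 : n = ∑ f ∈ s, brauerAct τ (twDiag ψ) (MonoidAlgebra.mapDomain (inlC ψ) f) n := by
    have h2 : MonoidAlgebra.mapDomainRingHom (ResidueField O) (inlC ψ) (∑ f ∈ s, f) = 1 := by
      rw [hs2, map_one]
    have h3 := congrArg (fun a => brauerAct τ (twDiag ψ) a n) h2
    simp only [map_sum, map_one, LinearMap.sum_apply] at h3
    exact h3.symm
  rw [h1, map_sum, map_sum]
  refine Submodule.sum_mem _ fun f hf => ?_
  let ω : Omega p (ResidueField O) H σ :=
    { y := { P := Q, e := f, isPGroup := hQ, isBlock := hs1 f hf }, φ := φ, ψ := ψ, comp := hσ }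
  refine Submodule.mem_iSup_of_mem ω ⟨Coinvariants.mk _
    (pairProj ρ x ω.y ω.φ m ⊗ₜ pairProj τ ω.y z ω.ψ n), ?_⟩
  exact (cutProj_Phi (y := ω.y.toLocalPair) hσ (hs1 f hf).idem m n).symm

variable [Fact p.Prime] [CharP (ResidueField O) p] [Finite ι] [Finite κ]

open Classical in
/-- The map `Br(m ⊗ n) ↦ (e ⊗ f^*) Br(m) ⊗ (f ⊗ d^*) Br(n)`, for elements `m` and `n` of the
permuted bases that are fixed by `Δ(P,φ,Q)` and by `Δ(Q,ψ,R)`; the other elements of the basis of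
the Brauer construction go to `0`. -/
def tensorMkInv (hb : Permutes ρ ⊤ b) (hc : Permutes τ ⊤ c) (ω : Omega p (ResidueField O) H σ) :
    Brauer (tensorRep ρ τ) (twDiag σ) →ₗ[ResidueField O]
      TensorOver (bimodRep ρ x ω.y ω.φ) (bimodRep τ ω.y z ω.ψ) :=
  (brauerBasis (z.isPGroup.of_equiv (twDiagEquiv σ))
      ((permutes_tensorBasis hb hc).mono le_top)).constr (ResidueField O) fun q =>
    -- The basis element is an `H`-orbit of pairs; the case distinction asks whether some pair in it
    -- is fixed by the two twisted diagonal groups of ω.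
    if h : ∃ ij : {i // b i ∈ fixedPts ρ (twDiag ω.φ)} × {j // c j ∈ fixedPts τ (twDiag ω.ψ)},
        Coinvariants.mk (midRep ρ τ) (b ij.1 ⊗ₜ c ij.2) = tensorBasis hb hc q then
      tensorMk ρ τ ω (Br ρ _ ⟨_, h.choose.1.2⟩) (Br τ _ ⟨_, h.choose.2.2⟩)
    else 0

/-- Φ_ω' sends a pair of fixed basis elements to the basis element labelled by its orbit, so the
value is given by the definition. It is zero for nonconjugate ψ and ψ' because a pair in that orbit
fixed for ω would make them conjugate. -/
theorem tensorMkInv_Br (hb : Permutes ρ ⊤ b) (hc : Permutes τ ⊤ c) (hf : RightFree ρ b)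
    (ω ω' : Omega p (ResidueField O) H σ) {i : ι} {j : κ}
    (hi : b i ∈ fixedPts ρ (twDiag ω'.φ)) (hj : c j ∈ fixedPts τ (twDiag ω'.ψ)) :
    (∀ (hi' : b i ∈ fixedPts ρ (twDiag ω.φ)) (hj' : c j ∈ fixedPts τ (twDiag ω.ψ)),
      tensorMkInv hb hc ω (Phi ω'.comp (Br ρ _ ⟨b i, hi⟩) (Br τ _ ⟨c j, hj⟩)) =
        tensorMk ρ τ ω (Br ρ _ ⟨b i, hi'⟩) (Br τ _ ⟨c j, hj'⟩)) ∧
    ((∀ h : H, ∃ r, (ω.ψ r : H) ≠ h * ω'.ψ r * h⁻¹) →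
      tensorMkInv hb hc ω (Phi ω'.comp (Br ρ _ ⟨b i, hi⟩) (Br τ _ ⟨c j, hj⟩)) = 0) := by
  have h1 := mk_mem_fixedPts ω'.comp ⟨b i, hi⟩ ⟨c j, hj⟩
  rw [← tensorBasis_mk hb hc] at h1
  have h2 : Phi ω'.comp (Br ρ _ ⟨b i, hi⟩) (Br τ _ ⟨c j, hj⟩) =
      brauerBasis (z.isPGroup.of_equiv (twDiagEquiv σ))
        ((permutes_tensorBasis hb hc).mono le_top) ⟨Quotient.mk _ (i, j), h1⟩ := by
    rw [brauerBasis_apply, Phi_Br]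
    exact congrArg (Br _ _) (Subtype.ext (tensorBasis_mk hb hc i j).symm)
  rw [h2, tensorMkInv, Module.Basis.constr_basis]
  refine ⟨fun hi' hj' => ?_, fun hne => ?_⟩
  · have hex : ∃ ij : {i // b i ∈ fixedPts ρ (twDiag ω.φ)} × {j // c j ∈ fixedPts τ (twDiag ω.ψ)},
        Coinvariants.mk (midRep ρ τ) (b ij.1 ⊗ₜ c ij.2) =
          tensorBasis hb hc (Quotient.mk _ (i, j)) :=
      ⟨(⟨i, hi'⟩, ⟨j, hj'⟩), (tensorBasis_mk hb hc i j).symm⟩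
    rw [dif_pos hex]
    exact tensorMk_Br_eq hb hc hf ω _ _ _ _ (hex.choose_spec.trans (tensorBasis_mk hb hc i j))
  · rw [dif_neg]
    rintro ⟨ij, h⟩
    obtain ⟨l, -, -, hl⟩ := conj_eq_of_mk_tmul_eq hb hc hf ω'.comp ω.comp hi ij.1.2
      ((tensorBasis_mk hb hc i j).symm.trans h.symm)
    obtain ⟨r, hr⟩ := hne l
    exact hr (hl r)

theorem tensorMkInv_Phi (hb : Permutes ρ ⊤ b) (hc : Permutes τ ⊤ c) (hf : RightFree ρ b)
    (ω : Omega p (ResidueField O) H σ) (m : Brauer ρ (twDiag ω.φ)) (n : Brauer τ (twDiag ω.ψ)) :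
    tensorMkInv hb hc ω (Phi ω.comp m n) = tensorMk ρ τ ω m n := by
  have h : (Phi ω.comp).compr₂ (tensorMkInv hb hc ω) = tensorMk ρ τ ω := by
    refine (brauerBasis ω.isPGroup_twDiag_φ (hb.mono le_top)).ext fun i =>
      (brauerBasis ω.isPGroup_twDiag_ψ (hc.mono le_top)).ext fun j => ?_
    rw [brauerBasis_apply, brauerBasis_apply]
    exact (tensorMkInv_Br hb hc hf ω ω i.2 j.2).1 i.2 j.2
  exact LinearMap.congr_fun₂ h m n

theorem tensorMkInv_Phi_eq_zero (hb : Permutes ρ ⊤ b) (hc : Permutes τ ⊤ c) (hf : RightFree ρ b)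
    (ω ω' : Omega p (ResidueField O) H σ) (h : ∀ h : H, ∃ r, (ω.ψ r : H) ≠ h * ω'.ψ r * h⁻¹)
    (m : Brauer ρ (twDiag ω'.φ)) (n : Brauer τ (twDiag ω'.ψ)) :
    tensorMkInv hb hc ω (Phi ω'.comp m n) = 0 := by
  have h : (Phi ω'.comp).compr₂ (tensorMkInv hb hc ω) =
      (0 : Brauer ρ (twDiag ω'.φ) →ₗ[ResidueField O] Brauer τ (twDiag ω'.ψ) →ₗ[ResidueField O]
        TensorOver (bimodRep ρ x ω.y ω.φ) (bimodRep τ ω.y z ω.ψ)) := by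
    refine (brauerBasis ω'.isPGroup_twDiag_φ (hb.mono le_top)).ext fun i =>
      (brauerBasis ω'.isPGroup_twDiag_ψ (hc.mono le_top)).ext fun j => ?_
    rw [brauerBasis_apply, brauerBasis_apply]
    exact (tensorMkInv_Br hb hc hf ω ω' i.2 j.2).2 h
  exact LinearMap.congr_fun₂ h m n

/-- With φ and ψ unchanged the map projects with the block of ω an element already cut by `f`;
distinct blocks are orthogonal. -/
theorem tensorMkInv_setBlock (hb : Permutes ρ ⊤ b) (hc : Permutes τ ⊤ c) (hf : RightFree ρ b)
    (ω : Omega p (ResidueField O) H σ)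
    {f : MonoidAlgebra (ResidueField O) (Subgroup.centralizer (ω.y.P : Set H))}
    (hfb : IsBlockIdempotent f) (hne : ω.y.e ≠ f)
    (t : TensorOver (bimodRep ρ x (ω.setBlock f hfb).y (ω.setBlock f hfb).φ)
      (bimodRep τ (ω.setBlock f hfb).y z (ω.setBlock f hfb).ψ)) :
    (tensorMkInv hb hc ω ∘ₗ cutIncl (tensorRep ρ τ) x z σ)
      (PhiBimod ρ τ (ω.setBlock f hfb) t) = 0 := by
  induction t using TensorOver.induction with
  | h0 => rw [map_zero, map_zero]
  | h2 s t hs ht => rw [map_add, map_add, hs, ht, add_zero]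
  | h1 m n =>
    refine (tensorMkInv_Phi hb hc hf ω m.1 n.1).trans ?_
    obtain ⟨_, m, rfl⟩ := m
    have h1 : ∀ m, pairProj ρ x ω.y ω.φ (brauerAct ρ (twDiag ω.φ) (tensorElt ω.φ x.e f) m) = 0 := by
      intro m
      refine Subtype.ext ?_
      change brauerAct ρ (twDiag ω.φ) (tensorElt ω.φ x.e ω.y.e) _ = 0
      rw [← Module.End.mul_apply, ← map_mul, tensorElt_mul, hfb.mul_eq_zero ω.y.isBlock hne.symm,
        tensorElt_zero_right, map_zero, LinearMap.zero_apply]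
    refine (congrArg (Coinvariants.mk _) (congrArg (fun u => u ⊗ₜ[ResidueField O] _) (h1 m))).trans ?_
    rw [TensorProduct.zero_tmul, map_zero]

/-- A triple outside the `H`-orbit of ω differs from ω in one of two ways: its ψ is not conjugate to
that of ω, or after conjugation only the block differs. Both kinds are killed by `tensorMkInv`.
Spanning holds because every fixed basis element of the tensor product comes from some pair (φ,ψ).
-/
theorem phiSplit_of_permutes (hb : Permutes ρ ⊤ b) (hc : Permutes τ ⊤ c) (hbf : RightFree ρ b)
    (hcf : RightFree τ c) : PhiSplit ρ τ x z σ where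
  sep ω := by
    refine ⟨tensorMkInv hb hc ω ∘ₗ cutIncl (tensorRep ρ τ) x z σ, fun t => ?_, fun ω' hω' t => ?_⟩
    · induction t using TensorOver.induction with
      | h0 => simp only [map_zero]
      | h2 s t hs ht => simp only [map_add, hs, ht]
      | h1 m n =>
        refine (tensorMkInv_Phi hb hc hbf ω m.1 n.1).trans ?_
        exact congrArg (Coinvariants.mk _) (congrArg₂ (fun u v => u ⊗ₜ[ResidueField O] v)
          (pairProj_cutIncl ω.y ω.φ m) (pairProj_cutIncl z ω.ψ n))
    · by_cases hc' : ∀ h : H, ∃ r, (ω.ψ r : H) ≠ h * ω'.ψ r * h⁻¹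
      · induction t using TensorOver.induction with
        | h0 => simp only [map_zero]
        | h2 s t hs ht => simp only [map_add, hs, ht, add_zero]
        | h1 m n => exact tensorMkInv_Phi_eq_zero hb hc hbf ω ω' hc' m.1 n.1
      · push Not at hc'
        obtain ⟨h, hh⟩ := hc'
        obtain ⟨f, hf, he⟩ := ω.exists_eq_setBlock (inH x z σ h • ω') fun r =>
          (hh r).trans (ω'.coe_smul_ψ (inH x z σ h) r r (by simp)).symm
        -- Equal blocks would put `ω'` in the `H`-orbit of ω.
        have hne : ω.y.e ≠ f := fun h1 => by
          refine hω' h⁻¹ ?_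
          have h2 : ω.setBlock f hf = ω := by subst h1; rfl
          rw [← h2, ← he, ← mul_smul]
          simp only [Prod.mk_mul_mk, inv_mul_cancel, one_mul]
          exact (one_smul _ ω').symm
        obtain ⟨s, hs⟩ := PhiBimod_mem_range_smul ρ τ ω' h t
        rw [← hs]
        -- The modules depend on the triple, so the claim is stated for a variable triple before the
        -- equation is substituted.
        have key : ∀ ω'', ω'' = ω.setBlock f hf → ∀ s : TensorOver (bimodRep ρ x ω''.y ω''.φ)
            (bimodRep τ ω''.y z ω''.ψ),
            (tensorMkInv hb hc ω ∘ₗ cutIncl (tensorRep ρ τ) x z σ) (PhiBimod ρ τ ω'' s) = 0 := by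
          rintro _ rfl s
          exact tensorMkInv_setBlock hb hc hbf ω hf hne s
        exact key _ he s
  span := by
    let N := ⨆ ω : Omega p (ResidueField O) H σ, LinearMap.range (PhiBimod ρ τ ω).toLinearMap
    have hB := (brauerBasis (z.isPGroup.of_equiv (twDiagEquiv σ))
      ((permutes_tensorBasis hb hc).mono le_top)).span_eq
    have h1 : (⊤ : Submodule (ResidueField O) (Brauer (tensorRep ρ τ) (twDiag σ))) ≤
        N.comap (pairProj (tensorRep ρ τ) x z σ) := by
      rw [← hB, Submodule.span_le]
      rintro _ ⟨⟨q, hq⟩, rfl⟩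
      rw [brauerBasis_apply]
      induction q using Quotient.inductionOn with
      | h ij =>
        obtain ⟨i, j⟩ := ij
        have hq' := hq
        rw [tensorBasis_mk] at hq'
        obtain ⟨Q, φ, ψ, hσ, hi, hj⟩ := exists_twDiag_of_fixed hb hc hbf hcf σ hq'
        have h2 : Br (tensorRep ρ τ) (twDiag σ) ⟨tensorBasis hb hc (Quotient.mk _ (i, j)), hq⟩ =
            Phi hσ (Br ρ _ ⟨b i, hi⟩) (Br τ _ ⟨c j, hj⟩) := by
          rw [Phi_Br]
          exact congrArg (Br _ _) (Subtype.ext (tensorBasis_mk hb hc i j))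
        rw [h2]
        exact pairProj_Phi_mem (z.isPGroup.of_equiv ψ) hσ _ _
    rw [eq_top_iff]
    intro v _
    have h2 := h1 (Submodule.mem_top (x := cutIncl (tensorRep ρ τ) x z σ v))
    rwa [Submodule.mem_comap, pairProj_cutIncl] at h2

end PermutationCase

theorem phiSplit {p : ℕ} [Fact p.Prime] {O : Type*} [CommRing O] [IsDomain O]
    [IsDiscreteValuationRing O] [CharP (ResidueField O) p] {G H K : Type*} [Group G] [Group H] [Group K] [Finite G] [Finite H]
    [Finite K] {V W : Type*} [AddCommGroup V] [Module O V] [AddCommGroup W] [Module O W]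
    {ρ : Representation O (G × H) V} {τ : Representation O (H × K) W}
    (hρ : IsPPermutation p ρ) (hρv : HasTwistedDiagonalVertices ρ) (hτ : IsPPermutation p τ)
    (hτv : HasTwistedDiagonalVertices τ) (x : BrauerPair (ResidueField O) p G)
    (z : BrauerPair (ResidueField O) p K) (σ : z.P ≃* x.P) : PhiSplit ρ τ x z σ := by
  obtain ⟨V', _, _, ρ', n, b, i, s, hb, hbf, his⟩ := exists_retract_rightFree hρ hρv
  obtain ⟨W', _, _, τ', m, c, i', s', hc, hcf, his'⟩ := exists_retract_rightFree hτ hτv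
  exact (phiSplit_of_permutes hb hc hbf hcf).of_retract (fun v => LinearMap.congr_fun his v)
    (fun w => LinearMap.congr_fun his' w)

end BPDecomp

namespace BPDecomp

open Representation IsLocalRing

/-! ### Direct sums with separating retractions. -/

section SumLift

variable {k : Type*} [CommRing k] {Γ : Type*} [Group Γ] {W W' : Type*} [AddCommGroup W]
  [Module k W] [AddCommGroup W'] [Module k W'] {ι : Type*} {U U' : ι → Type*}
  [∀ i, AddCommGroup (U i)] [∀ i, Module k (U i)] [∀ i, AddCommGroup (U' i)]
  [∀ i, Module k (U' i)] {ρ : ∀ i, Representation k Γ (U i)} {ρ' : ∀ i, Representation k Γ (U' i)}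
  {σ : Representation k Γ W} {σ' : Representation k Γ W'}

open Classical in
theorem sumLift_of (f : ∀ i, (ρ i).IntertwiningMap σ) (i : ι) (u : U i) :
    sumLift f (DirectSum.lof k ι U i u) = f i u :=
  DirectSum.toModule_lof k i u

theorem comp_sumLift {f : ∀ i, (ρ i).IntertwiningMap σ} {f' : ∀ i, (ρ' i).IntertwiningMap σ'}
    {g : σ.IntertwiningMap σ'} {α : ∀ i, (ρ i).IntertwiningMap (ρ' i)}
    (h : ∀ i u, g (f i u) = f' i (α i u)) : g.comp (sumLift f) = (sumLift f').comp (sumMap α) := by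
  classical
  refine IntertwiningMap.ext (DirectSum.linearMap_ext _ fun i => LinearMap.ext fun u => ?_)
  change g (sumLift f (DirectSum.lof k ι U i u)) =
    sumLift f' (DirectSum.lmap (fun i => (α i).toLinearMap) (DirectSum.lof k ι U i u))
  rw [DirectSum.lmap_lof, sumLift_of, h]
  exact (sumLift_of f' i _).symm

/-- Composing with L_i reads off the i-th component, which gives injectivity; surjectivity is the
spanning hypothesis. -/
theorem sumLift_bijective (f : ∀ i, (ρ i).IntertwiningMap σ) (L : ∀ i, W →ₗ[k] U i)
    (h1 : ∀ i u, L i (f i u) = u) (h2 : ∀ i j, i ≠ j → ∀ u, L i (f j u) = 0)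
    (h3 : ⨆ i, LinearMap.range (f i).toLinearMap = ⊤) : Function.Bijective (sumLift f) := by
  classical
  have key : ∀ i, L i ∘ₗ (sumLift f).toLinearMap = DirectSum.component k ι U i := fun i => by
    refine DirectSum.linearMap_ext _ fun j => LinearMap.ext fun u => ?_
    change L i (sumLift f (DirectSum.lof k ι U j u)) =
      DirectSum.component k ι U i (DirectSum.lof k ι U j u)
    rw [sumLift_of]
    by_cases hij : i = j
    · subst hij
      rw [h1, DirectSum.component.lof_self]
    · rw [h2 i j hij, DirectSum.component.of, dif_neg (Ne.symm hij)]
  constructor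
  · intro v w h
    refine DirectSum.ext_component k fun i => ?_
    rw [← key, LinearMap.comp_apply, LinearMap.comp_apply]
    exact congrArg (L i) h
  · intro w
    have hw : w ∈ (⊤ : Submodule k W) := trivial
    have h4 : ⨆ i, LinearMap.range (f i).toLinearMap ≤ LinearMap.range (sumLift f).toLinearMap := by
      refine iSup_le fun i => ?_
      rintro _ ⟨u, rfl⟩
      exact ⟨_, sumLift_of f i u⟩
    rw [← h3] at hw
    exact h4 hw

end SumLift

/-! ### Retractions of maps out of induced modules. -/

section IndRetraction

variable {k : Type*} [CommRing k] {A B : Type*} [Group A] [Group B] {U W : Type*} [AddCommGroup U]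
  [Module k U] [AddCommGroup W] [Module k W] {υ : Representation k A U} {π : Representation k B W}

theorem IndV.induction (i : A →* B) {q : IndV i υ → Prop} (t : IndV i υ) (h0 : q 0)
    (h1 : ∀ b u, q (IndV.mk i υ b u)) (h2 : ∀ s t, q s → q t → q (s + t)) : q t := by
  obtain ⟨t, rfl⟩ := Coinvariants.mk_surjective _ t
  induction t using TensorProduct.induction_on with
  | zero => rwa [map_zero]
  | add s t hs ht => rw [map_add]; exact h2 _ _ hs ht
  | tmul a u =>
    induction a using MonoidAlgebra.induction_linear generalizing u with
    | zero => rwa [TensorProduct.zero_tmul, map_zero]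
    | add a b ha hb => rw [TensorProduct.add_tmul, map_add]; exact h2 _ _ (ha u) (hb u)
    | single b r =>
      have h : MonoidAlgebra.single b r ⊗ₜ[k] u = MonoidAlgebra.single b 1 ⊗ₜ (r • u) := by
        rw [← TensorProduct.smul_tmul, MonoidAlgebra.smul_single, smul_eq_mul, mul_one]
      rw [h]
      exact h1 b (r • u)

/-- A retraction of `U → W` that vanishes on `b U`, for `b` outside of the subgroup, extends to a
retraction of the map from the induced module. -/
theorem exists_indLift_retraction [Finite B] (i : A →* B) (f : υ.IntertwiningMap (π.comp i))
    (L : W →ₗ[k] U) (h1 : ∀ u, L (f u) = u) (h2 : ∀ b ∉ i.range, ∀ u, L (π b (f u)) = 0) :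
    ∃ L' : W →ₗ[k] IndV i υ, (∀ t, L' (indLift i f t) = t) ∧
      ∀ w, (∀ b, L (π b w) = 0) → L' w = 0 := by
  classical
  have := Fintype.ofFinite (B ⧸ i.range)
  -- The witness is w ↦ ∑ q⁻¹ ⊗ L(q⁻¹ w) over coset representatives; the inverses reflect that g ⊗ v
  -- is sent to g⁻¹ f(v). On b ⊗ u only the coset of b⁻¹ survives.
  refine ⟨∑ q : B ⧸ i.range, IndV.mk i υ (q.out)⁻¹ ∘ₗ L ∘ₗ π (q.out)⁻¹, fun t => ?_, fun w hw => ?_⟩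
  · induction t using IndV.induction with
    | h0 => rw [map_zero, map_zero]
    | h2 s t hs ht => rw [map_add, map_add, hs, ht]
    | h1 b u =>
      rw [indLift_mk, LinearMap.sum_apply, Finset.sum_eq_single (QuotientGroup.mk b⁻¹)]
      · set t := (QuotientGroup.mk b⁻¹ : B ⧸ i.range).out with ht
        have hq : (QuotientGroup.mk t : B ⧸ i.range) = QuotientGroup.mk b⁻¹ := by
          rw [ht, QuotientGroup.out_eq']
        rw [QuotientGroup.eq] at hq
        obtain ⟨a, ha⟩ := hq
        change IndV.mk i υ t⁻¹ (L (π t⁻¹ (π b⁻¹ (f u)))) = _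
        rw [← Module.End.mul_apply, ← map_mul, ← ha]
        have h3 : π (i a) (f u) = f (υ a u) := (f.isIntertwining _ _ a u).symm
        have h4 : t⁻¹ = i a * b := by rw [ha]; group
        rw [h3, h1, h4, indV_mk_mul]
      · intro q _ hq
        change IndV.mk i υ (q.out)⁻¹ (L (π (q.out)⁻¹ (π b⁻¹ (f u)))) = _
        rw [← Module.End.mul_apply, ← map_mul, h2, map_zero]
        rw [← QuotientGroup.eq, QuotientGroup.out_eq']
        exact hq
      · exact fun h => absurd (Finset.mem_univ _) h
  · rw [LinearMap.sum_apply]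
    refine Finset.sum_eq_zero fun q _ => ?_
    change IndV.mk i υ (q.out)⁻¹ (L (π (q.out)⁻¹ w)) = _
    rw [hw, map_zero]

theorem indLift_vanish (i : A →* B) (f : υ.IntertwiningMap (π.comp i)) {M : Type*} [AddCommGroup M]
    [Module k M] (L : W →ₗ[k] M) (h : ∀ b u, L (π b (f u)) = 0) (t : IndV i υ) (b : B) :
    L (π b (indLift i f t)) = 0 := by
  induction t using IndV.induction with
  | h0 => simp only [map_zero]
  | h2 s t hs ht => simp only [map_add, hs, ht, add_zero]
  | h1 c u => rw [indLift_mk, ← Module.End.mul_apply, ← map_mul, h]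

end IndRetraction

/-! ### Stabilizers of triples and X(ω) * Y(ω). -/

section Stabilizer

variable {p : ℕ} {O : Type*} [CommRing O] [IsLocalRing O] {G H K : Type*} [Group G] [Group H]
  [Group K] {x : BrauerPair (ResidueField O) p G} {z : BrauerPair (ResidueField O) p K}
  {σ : z.P ≃* x.P} {S : Subgroup G} {T : Subgroup K}

/-- If ((g,k),h) fixes ω, the pairs attached to ω are fixed by (g,h) and by (h,k), so `h` witnesses
that (g,k) lies in X(ω) * Y(ω). This is why one induces from that group. -/
theorem mem_starProd_of_smul_eq (hS : S ≤ pairStab x.toLocalPair) (hT : T ≤ pairStab z.toLocalPair)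
    {ω : Omega p (ResidueField O) H σ}
    {a : Subgroup.normalizer (twDiag σ : Set (G × K)) × H} (ha : (a.1 : G × K) ∈ S.prod T)
    (h : a • ω = ω) :
    ((a.1 : G × K).1, a.2) ∈ XSub S x ω.y ω.φ ∧ (a.2, (a.1 : G × K).2) ∈ YSub T ω.y z ω.ψ := by
  have h1 : tensorPair x.toLocalPair (a • ω).y.toLocalPair (a • ω).φ =
      ((a.1 : G × K).1, a.2) • tensorPair x.toLocalPair ω.y.toLocalPair ω.φ :=
    tensorPair_smul rfl (hS ha.1) fun q q' hq => ω.coe_smul_φ _ q q' hq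
  have h2 : tensorPair (a • ω).y.toLocalPair z.toLocalPair (a • ω).ψ =
      (a.2, (a.1 : G × K).2) • tensorPair ω.y.toLocalPair z.toLocalPair ω.ψ :=
    tensorPair_smul' rfl (hT ha.2) fun r r' hr => ω.coe_smul_ψ _ r r' hr
  rw [h] at h1 h2
  exact ⟨⟨⟨ha.1, trivial⟩, h1.symm⟩, ⟨trivial, ha.2⟩, h2.symm⟩

end Stabilizer

/-! ### Assembling the isomorphisms. -/

section Bimodules

variable {p : ℕ} {O : Type*} [CommRing O] [IsLocalRing O] {G H K : Type*} [Group G] [Group H]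
  [Group K] [Finite G] [Finite H] [Finite K] {V W : Type*} [AddCommGroup V] [Module O V]
  [AddCommGroup W] [Module O W] {ρ : Representation O (G × H) V} {τ : Representation O (H × K) W}
  {x : BrauerPair (ResidueField O) p G} {z : BrauerPair (ResidueField O) p K} {σ : z.P ≃* x.P}

theorem PhiBimod_mem (ω : Omega p (ResidueField O) H σ)
    (N : Submodule (ResidueField O) (cut (tensorRep ρ τ)
      (tensorPair x.toLocalPair z.toLocalPair σ)))
    (h : ∀ m n, cutPhi ρ τ ω.comp m n ∈ N)
    (t : TensorOver (bimodRep ρ x ω.y ω.φ) (bimodRep τ ω.y z ω.ψ)) : PhiBimod ρ τ ω t ∈ N := by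
  induction t using TensorOver.induction with
  | h0 => rw [map_zero]; exact Submodule.zero_mem _
  | h2 s t hs ht => rw [map_add]; exact Submodule.add_mem _ hs ht
  | h1 m n => exact h m n

/-- An arbitrary index type is used so that representatives in Ω and in Λ are both covered. -/
theorem sumLift_PhiBimod_bijective (hs : PhiSplit ρ τ x z σ) {ι : Type*}
    (ω : ι → Omega p (ResidueField O) H σ)
    (h1 : ∀ a : Omega p (ResidueField O) H σ, ∃ i, ∃ h : H, ω i = inH x z σ h • a)
    (h2 : ∀ i j, i ≠ j → ∀ h : H, ω j ≠ inH x z σ h • ω i) :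
    Function.Bijective (sumLift fun i => PhiBimod ρ τ (ω i)) := by
  choose L hL1 hL2 using fun i => hs.sep (ω i)
  refine sumLift_bijective _ L hL1 (fun i j hij => hL2 i (ω j) (h2 i j hij)) ?_
  rw [eq_top_iff, ← hs.span]
  refine iSup_le fun a => ?_
  obtain ⟨i, h, hi⟩ := h1 a
  refine le_trans ?_ (le_iSup _ i)
  rw [hi]
  rintro _ ⟨t, rfl⟩
  exact PhiBimod_mem_range_smul ρ τ a h t

/-! ### The induced modules for the normalizer. -/

section Big

variable {S : Subgroup G} {T : Subgroup K}

theorem ExtTensor.induction {k A B C : Type*} [CommRing k] [Group A] [Group B] [Group C]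
    {X : Subgroup (A × B)} {Y : Subgroup (B × C)}
    {V W : Type*} [AddCommGroup V] [Module k V] [AddCommGroup W] [Module k W]
    {ρ : Representation k X V} {τ : Representation k Y W} {q : ExtTensor ρ τ → Prop}
    (t : ExtTensor ρ τ) (h0 : q 0)
    (h1 : ∀ v w, q (Coinvariants.mk _ (v ⊗ₜ w))) (h2 : ∀ s t, q s → q t → q (s + t)) : q t := by
  obtain ⟨t, rfl⟩ := Coinvariants.mk_surjective _ t
  induction t using TensorProduct.induction_on with
  | zero => rwa [map_zero]
  | tmul v w => exact h1 v w
  | add s t hs ht => rw [map_add]; exact h2 _ _ hs ht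

variable (ρ τ S T) in
/-- The map from the tensor product over `F[C_H(Q)]` to the extended tensor product. -/
def toExt (ω : Omega p (ResidueField O) H σ) :
    TensorOver (bimodRep ρ x ω.y ω.φ) (bimodRep τ ω.y z ω.ψ) →ₗ[ResidueField O]
      ExtTensor (MRep ρ S x ω.y ω.φ) (NRep τ T ω.y z ω.ψ) :=
  Coinvariants.lift _ (Coinvariants.mk (extMidRep (MRep ρ S x ω.y ω.φ) (NRep τ T ω.y z ω.ψ)))
    fun c => by
      -- C_H(Q) is contained in k₂(X(ω)) ∩ k₁(Y(ω)), so the extended tensor product is a quotient of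
      -- the tensor product over F[C_H(Q)]. Only this inclusion is needed below.
      let c' : (k₂ (XSub S x ω.y ω.φ) ⊓ k₁ (YSub T ω.y z ω.ψ) : Subgroup H) :=
        ⟨c, ⟨⟨S.one_mem, trivial⟩, (centHom x ω.y ω.φ (1, c)).2⟩,
          ⟨trivial, T.one_mem⟩, (centHom ω.y z ω.ψ (c, 1)).2⟩
      exact LinearMap.ext fun t => Coinvariants.mk_self_apply
        (extMidRep (MRep ρ S x ω.y ω.φ) (NRep τ T ω.y z ω.ψ)) c' t

theorem toExt_mk (ω : Omega p (ResidueField O) H σ)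
    (m : cut ρ (tensorPair x.toLocalPair ω.y.toLocalPair ω.φ))
    (n : cut τ (tensorPair ω.y.toLocalPair z.toLocalPair ω.ψ)) :
    toExt ρ τ S T ω (Coinvariants.mk _ (m ⊗ₜ n)) = Coinvariants.mk _ (m ⊗ₜ n) := rfl

/-- An element of `N_{S × T}(Δ(P,σ,R)) × H`, acting on triples. -/
abbrev inNH (b : NST S σ T) (h : H) : Subgroup.normalizer (twDiag σ : Set (G × K)) × H :=
  (⟨b, b.2.2⟩, h)

theorem exists_PhiExt_smul (hS : S ≤ pairStab x.toLocalPair) (hT : T ≤ pairStab z.toLocalPair)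
    (ω : Omega p (ResidueField O) H σ) (b : NST S σ T) (h : H)
    (m : cut ρ (tensorPair x.toLocalPair ω.y.toLocalPair ω.φ))
    (n : cut τ (tensorPair ω.y.toLocalPair z.toLocalPair ω.ψ)) :
    ∃ t, NSTRep (tensorRep ρ τ) hS hT σ b (cutPhi ρ τ ω.comp m n) =
      PhiExt ρ τ hS hT (inNH b h • ω) t := by
  obtain ⟨m', n', h'⟩ := exists_cutPhi_smul ρ τ ω (inNH b h) (hS b.2.1.1)
    (hT b.2.1.2) (NST_le hS hT σ b.2) m n
  exact ⟨Coinvariants.mk _ (m' ⊗ₜ n'), h'⟩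

theorem exists_PhiBimod_smul (hS : S ≤ pairStab x.toLocalPair) (hT : T ≤ pairStab z.toLocalPair)
    (ω : Omega p (ResidueField O) H σ) (b : NST S σ T) (h : H)
    (m : cut ρ (tensorPair x.toLocalPair ω.y.toLocalPair ω.φ))
    (n : cut τ (tensorPair ω.y.toLocalPair z.toLocalPair ω.ψ)) :
    ∃ t, NSTRep (tensorRep ρ τ) hS hT σ b (cutPhi ρ τ ω.comp m n) =
      PhiBimod ρ τ (inNH b h • ω) t := by
  obtain ⟨m', n', h'⟩ := exists_cutPhi_smul ρ τ ω (inNH b h) (hS b.2.1.1)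
    (hT b.2.1.2) (NST_le hS hT σ b.2) m n
  exact ⟨Coinvariants.mk _ (m' ⊗ₜ n'), h'⟩

theorem PhiInd_mk (hS : S ≤ pairStab x.toLocalPair) (hT : T ≤ pairStab z.toLocalPair)
    (ω : Omega p (ResidueField O) H σ) (b : NST S σ T)
    (t : ExtTensor (MRep ρ S x ω.y ω.φ) (NRep τ T ω.y z ω.ψ)) :
    PhiInd ρ τ hS hT ω (IndV.mk _ _ b t) =
      NSTRep (tensorRep ρ τ) hS hT σ b⁻¹ (PhiExt ρ τ hS hT ω t) :=
  indLift_mk _ _ b t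

theorem PhiBimod_mem_range_PhiInd (hS : S ≤ pairStab x.toLocalPair)
    (hT : T ≤ pairStab z.toLocalPair) (ω : Omega p (ResidueField O) H σ) (b : NST S σ T) (h : H)
    {ω' : Omega p (ResidueField O) H σ} (hω : ω' = inNH b h • ω)
    (t : TensorOver (bimodRep ρ x ω.y ω.φ) (bimodRep τ ω.y z ω.ψ)) :
    PhiBimod ρ τ ω t ∈ LinearMap.range (PhiInd ρ τ hS hT ω').toLinearMap := by
  refine PhiBimod_mem ω _ (fun m n => ?_) t
  have h0 := exists_PhiExt_smul hS hT ω b h m n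
  rw [← hω] at h0
  obtain ⟨t, ht⟩ := h0
  have h1 := PhiInd_mk hS hT ω' b t
  have h2 := (NSTRep (tensorRep ρ τ) hS hT σ).inv_self_apply b (cutPhi ρ τ ω.comp m n)
  rw [ht] at h2
  exact ⟨_, h1.trans h2⟩

/-- The retraction L_i, followed by the map to the extended tensor product, kills the translate of
an image by b unless b moves the triple into the `H`-orbit of ω_i. For ω_i itself that forces b into
X * Y, and for j ≠ i it never happens, so the retractions extend to the induced modules and stay
separating. -/
theorem sumLift_PhiInd_bijective (hS : S ≤ pairStab x.toLocalPair)
    (hT : T ≤ pairStab z.toLocalPair) (hs : PhiSplit ρ τ x z σ) {ι : Type*}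
    (ω : ι → Omega p (ResidueField O) H σ)
    (h1 : ∀ a : Omega p (ResidueField O) H σ, ∃ i, ∃ b : NST S σ T, ∃ h : H, ω i = inNH b h • a)
    (h2 : ∀ i j, i ≠ j → ∀ (b : NST S σ T) (h : H), ω j ≠ inNH b h • ω i) :
    Function.Bijective (sumLift fun i => PhiInd ρ τ hS hT (ω i)) := by
  choose L hL1 hL2 using fun i => hs.sep (ω i)
  have hv : ∀ i (ω' : Omega p (ResidueField O) H σ) (b : NST S σ T),
      (∀ h : H, inNH b (1 : H) • ω' ≠ inH x z σ h • ω i) → ∀ t,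
      (toExt ρ τ S T (ω i) ∘ₗ L i) (NSTRep (tensorRep ρ τ) hS hT σ b (PhiExt ρ τ hS hT ω' t)) =
        0 := by
    intro i ω' b hb t
    induction t using ExtTensor.induction with
    | h0 => simp only [map_zero]
    | h2 s t hs ht => simp only [map_add, hs, ht, add_zero]
    | h1 m n =>
      rw [PhiExt_mk]
      obtain ⟨t, ht⟩ := exists_PhiBimod_smul hS hT ω' b 1 m n
      rw [ht, LinearMap.comp_apply, hL2 i _ hb, map_zero]
  have hr : ∀ i, _ := fun i => exists_indLift_retraction
    (Subgroup.inclusion (starProd_le_NST (S := S) (T := T) (ω i)))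
    (PhiExt ρ τ hS hT (ω i)) (toExt ρ τ S T (ω i) ∘ₗ L i) (fun t => by
      induction t using ExtTensor.induction with
      | h0 => simp only [map_zero]
      | h2 s t hs ht => simp only [map_add, hs, ht]
      | h1 m n =>
        rw [PhiExt_mk, ← PhiBimod_mk, LinearMap.comp_apply, hL1, toExt_mk])
    (fun b hb t => by
      refine hv i (ω i) b (fun h hh => hb ?_) t
      -- If b ω_i = h ω_i, then (b, h⁻¹) stabilizes ω_i, and b lies in the subgroup that was
      -- excluded.
      have h3 : inNH b h⁻¹ • ω i = ω i := by
        have h4 : inNH b h⁻¹ = inH x z σ h⁻¹ * inNH b (1 : H) := by simp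
        rw [h4, mul_smul, hh, ← mul_smul]
        simp only [Prod.mk_mul_mk, inv_mul_cancel, one_mul]
        exact one_smul _ _
      obtain ⟨h5, h6⟩ := mem_starProd_of_smul_eq hS hT b.2.1 h3
      exact ⟨⟨b, h⁻¹, h5, h6⟩, rfl⟩)
  choose L' hL1' hL2' using hr
  refine sumLift_bijective _ L' hL1' (fun i j hij t => hL2' i _ fun b => ?_) ?_
  · refine indLift_vanish _ (PhiExt ρ τ hS hT (ω j)) _ (fun b t => ?_) t b
    refine hv i (ω j) b (fun h hh => ?_) t
    refine h2 i j hij b⁻¹ h ?_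
    have h4 : inNH b⁻¹ h = (inNH b (1 : H))⁻¹ * inH x z σ h := by
      ext <;> simp
    rw [h4, mul_smul, ← hh, inv_smul_smul]
  · rw [eq_top_iff, ← hs.span]
    refine iSup_le fun a => ?_
    rintro _ ⟨t, rfl⟩
    obtain ⟨i, b, h, hi⟩ := h1 a
    exact Submodule.mem_iSup_of_mem i (PhiBimod_mem_range_PhiInd hS hT a b h hi t)

variable {V' W' : Type*} [AddCommGroup V'] [Module O V'] [AddCommGroup W'] [Module O W']
  {ρ' : Representation O (G × H) V'} {τ' : Representation O (H × K) W'}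

theorem NSTMap_PhiInd (hS : S ≤ pairStab x.toLocalPair) (hT : T ≤ pairStab z.toLocalPair)
    (α : ρ.IntertwiningMap ρ') (β : τ.IntertwiningMap τ') (ω : Omega p (ResidueField O) H σ)
    (t : IndV (Subgroup.inclusion (starProd_le_NST (S := S) (T := T) ω))
      (extTensorRep (MRep ρ S x ω.y ω.φ) (NRep τ T ω.y z ω.ψ))) :
    NSTMap (tensorMap α β) hS hT σ (PhiInd ρ τ hS hT ω t) =
      PhiInd ρ' τ' hS hT ω (indMap _ (extTensorMap (MMap α S x ω.y ω.φ) (NMap β T ω.y z ω.ψ)) t) := by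
  induction t using IndV.induction with
  | h0 => simp only [map_zero]
  | h2 s t hs ht => simp only [map_add, hs, ht]
  | h1 b t =>
    have e1 : PhiInd ρ τ hS hT ω (IndV.mk _ _ b t) =
        NSTRep (tensorRep ρ τ) hS hT σ b⁻¹ (PhiExt ρ τ hS hT ω t) := PhiInd_mk hS hT ω b t
    have e2 : PhiInd ρ' τ' hS hT ω (indMap _
          (extTensorMap (MMap α S x ω.y ω.φ) (NMap β T ω.y z ω.ψ)) (IndV.mk _ _ b t)) =
        NSTRep (tensorRep ρ' τ') hS hT σ b⁻¹ (PhiExt ρ' τ' hS hT ω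
          (extTensorMap (MMap α S x ω.y ω.φ) (NMap β T ω.y z ω.ψ) t)) := by
      rw [indMap_mk]
      exact PhiInd_mk hS hT ω b _
    rw [e1, e2]
    clear e1 e2
    refine ((NSTMap (tensorMap α β) hS hT σ).isIntertwining _ _ b⁻¹ _).trans
      (congrArg (NSTRep (tensorRep ρ' τ') hS hT σ b⁻¹) ?_)
    induction t using ExtTensor.induction with
    | h0 => simp only [map_zero]
    | h2 s t hs ht => simp only [map_add, hs, ht]
    | h1 m n => exact cutMap_cutPhi ω.comp α β m n

end Big

end Bimodules

end BPDecomp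

namespace BPDecomp

open Representation IsLocalRing

/-! ### M(ω) and N(ω) are p-permutation modules. -/

section PPermutation

variable {p : ℕ} [Fact p.Prime] {O : Type*} [CommRing O] [IsLocalRing O]
  [CharP (ResidueField O) p] {Γ : Type*} [Group Γ] [Finite Γ] {V : Type*} [AddCommGroup V]
  [Module O V] {ρ : Representation O Γ V}

/-- The image `D` of the p-group normalizes P, so DP is a p-group and permutes a basis of `V`. Then
`D` permutes its P-fixed elements, which form a basis of V(P), and eV(P) is a direct summand because
e is an idempotent fixed by `D`. -/
theorem isPermutationRep_cutRep (hρ : IsPPermutation p ρ) {x : LocalPair (ResidueField O) Γ}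
    (hx : IsPGroup p x.P) (he : x.e * x.e = x.e) {U : Type*} [Group U] [Finite U]
    (hU : IsPGroup p U) (j : U →* pairStab x) : IsPermutationRep ((cutRep ρ x).comp j) := by
  let j' : U →* Subgroup.normalizer (x.P : Set Γ) :=
    (Subgroup.inclusion (pairStab_le_normalizer x)).comp j
  let D : Subgroup Γ := ((Subgroup.subtype _).comp j').range
  have hD : IsPGroup p D := hU.of_surjective _ (MonoidHom.rangeRestrict_surjective _)
  have hDx : D ≤ Subgroup.normalizer (x.P : Set Γ) := by
    rintro _ ⟨u, rfl⟩
    exact (j' u).2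
  obtain ⟨n, b, hb⟩ := hρ (D ⊔ x.P) (hD.to_sup_of_normal_right' hx hDx)
  have hb' : Permutes ρ (D ⊔ x.P) b := fun g hg => hb ⟨g, hg⟩
  have hπ : IsPermutationRep ((brauerRep ρ x.P).comp j') := by
    refine isPermutationRep_of_permutes (b := brauerBasis hx (hb'.mono le_sup_right)) ?_
    rintro u - ⟨i, hi⟩
    obtain ⟨l, hl⟩ := hb' (j' u : Γ) ((le_sup_left : D ≤ _) ⟨u, rfl⟩) i
    have hl' : b l ∈ fixedPts ρ x.P := hl ▸ normalizer_map_mem (j' u).2 hi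
    refine ⟨⟨l, hl'⟩, ?_⟩
    rw [brauerBasis_apply, brauerBasis_apply, MonoidHom.comp_apply, brauerRep_Br]
    exact congrArg (Br ρ x.P) (Subtype.ext hl)
  refine isPermutationRep_of_retract (p := p) hU hπ
    ⟨(cut ρ x).subtype, fun u => rfl⟩
    ⟨cutProj ρ x, fun u => LinearMap.ext fun v => cutProj_brauerRep x (j u) v⟩ ?_
  exact IntertwiningMap.ext (LinearMap.ext fun a => cutProj_coe he a)

variable {G H K : Type*} [Group G] [Group H] [Finite G] [Finite H]

theorem isPPermutation_cutRep {ρ : Representation O (G × H) V} (hρ : IsPPermutation p ρ)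
    (x : BrauerPair (ResidueField O) p G) (y : BrauerPair (ResidueField O) p H) (φ : y.P ≃* x.P)
    {X : Subgroup (G × H)} (hX : X ≤ pairStab (tensorPair x.toLocalPair y.toLocalPair φ)) :
    IsPPermutation p ((cutRep ρ (tensorPair x.toLocalPair y.toLocalPair φ)).comp
      (Subgroup.inclusion hX)) := fun U hU =>
  isPermutationRep_cutRep hρ (y.isPGroup.of_equiv (twDiagEquiv φ)) (tensorPair_idem φ) hU
    ((Subgroup.inclusion hX).comp U.subtype)

end PPermutation

/-! ### Stabilizers of Brauer pairs, and the passage from Λ to Ω. -/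

section Stabilizers

variable {F : Type*} [Field F] {p : ℕ} {G H K : Type*} [Group G] [Group H] [Group K]

/-- Fixing ψ means centralizing its image Q; conversely C_H(Q) fixes f, which is central in
F[C_H(Q)]. -/
theorem Omega.stabilizer_comap_inr {P : Subgroup G} {R : Subgroup K} {σ : R ≃* P}
    (ω : Omega p F H σ) :
    (MulAction.stabilizer (Subgroup.normalizer (twDiag σ : Set (G × K)) × H) ω).comap
      (MonoidHom.inr _ H) = Subgroup.centralizer (ω.y.P : Set H) := by
  ext h
  have h1 : ∀ r : R, (((MonoidHom.inr (Subgroup.normalizer (twDiag σ : Set (G × K))) H h) • ω).ψ r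
      : H) = h * ω.ψ r * h⁻¹ := fun r => ω.coe_smul_ψ _ r r (by simp)
  rw [Subgroup.mem_comap, MulAction.mem_stabilizer_iff]
  constructor
  · intro hω
    rw [hω] at h1
    refine Subgroup.mem_centralizer_iff.2 fun q hq => ?_
    obtain ⟨r, hr⟩ := ω.ψ.surjective ⟨q, hq⟩
    have := h1 r
    rw [hr] at this
    exact eq_mul_inv_iff_mul_eq.1 this
  · intro hh
    refine ext_val (BrauerPair.toLocalPair_injective (centralizer_le_pairStab ω.y hh)) fun r => ?_
    rw [h1, mul_inv_eq_iff_eq_mul]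
    exact (Subgroup.mem_centralizer_iff.1 hh _ (ω.ψ r).2).symm

theorem coeff_inl_mul_inr (a : MonoidAlgebra F G) (b : MonoidAlgebra F H) (g : G) (h : H) :
    (MonoidAlgebra.mapDomain (MonoidHom.inl G H) a *
      MonoidAlgebra.mapDomain (MonoidHom.inr G H) b).coeff (g, h) = a.coeff g * b.coeff h := by
  classical
  induction a using MonoidAlgebra.induction_linear with
  | zero => simp
  | add u v hu hv =>
    simp only [MonoidAlgebra.mapDomain_add, add_mul, MonoidAlgebra.coeff_add, Finsupp.add_apply,
      hu, hv]
  | single c r =>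
    induction b using MonoidAlgebra.induction_linear with
    | zero => simp
    | add u v hu hv =>
      simp only [MonoidAlgebra.mapDomain_add, mul_add, MonoidAlgebra.coeff_add, Finsupp.add_apply,
        hu, hv]
    | single d s =>
      rw [MonoidAlgebra.mapDomain_single, MonoidAlgebra.mapDomain_single,
        MonoidAlgebra.single_mul_single, MonoidAlgebra.coeff_single, MonoidAlgebra.coeff_single,
        MonoidAlgebra.coeff_single, Finsupp.single_apply, Finsupp.single_apply,
        Finsupp.single_apply]
      by_cases h1 : c = g <;> by_cases h2 : d = h <;> simp [h1, h2]

theorem antipode_injective {A : Type*} [Group A] :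
    Function.Injective (antipode : MonoidAlgebra F A → MonoidAlgebra F A) :=
  MonoidAlgebra.mapDomain_injective inv_injective

/-- Once `g` fixes e, the equality of e ⊗ (hfh⁻¹)^* with e ⊗ f^* can be compared at a nonzero
coefficient of e, which cancels. -/
theorem snd_mem_pairStab {x : LocalPair F G} {y : LocalPair F H} {φ : y.P ≃* x.P} (hx : x.e ≠ 0)
    {g : G} {h : H} (hg : g ∈ pairStab x) (hgh : (g, h) ∈ pairStab (tensorPair x y φ)) :
    h ∈ pairStab y := by
  obtain ⟨hn, he⟩ := mem_pairStab.1 hgh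
  refine mem_pairStab.2 ⟨snd_mem_normalizer hn, antipode_injective ?_⟩
  have h1 : MonoidAlgebra.mapDomain (MonoidHom.inl G H) x.emb *
      MonoidAlgebra.mapDomain (MonoidHom.inr G H)
        (antipode (MonoidAlgebra.mapDomain (MulAut.conj h) y.emb)) =
      MonoidAlgebra.mapDomain (MonoidHom.inl G H) x.emb *
      MonoidAlgebra.mapDomain (MonoidHom.inr G H) (antipode y.emb) := by
    rw [← emb_tensorPair x y φ, ← he, emb_tensorPair]
    symm
    refine (mapDomain_hom_mul (MulAut.conj (g, h)).toMonoidHom _ _).trans ?_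
    congr 1
    · conv_rhs => rw [← (mem_pairStab.1 hg).2]
      rw [mapDomain_mapDomain, mapDomain_mapDomain]
      congr 1
      ext a <;> simp
    · rw [antipode, antipode, mapDomain_mapDomain, mapDomain_mapDomain, mapDomain_mapDomain,
        mapDomain_mapDomain]
      congr 1
      ext a <;> simp [mul_assoc]
  have h2 : x.emb ≠ 0 := fun h0 => hx (MonoidAlgebra.mapDomain_injective Subtype.val_injective
    (by rw [MonoidAlgebra.mapDomain_zero]; exact h0))
  obtain ⟨u, hu⟩ : ∃ u, x.emb.coeff u ≠ 0 := by
    by_contra! h3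
    exact h2 (MonoidAlgebra.coeff_injective (Finsupp.ext h3))
  refine MonoidAlgebra.coeff_injective (Finsupp.ext fun v => mul_left_cancel₀ hu ?_)
  rw [← coeff_inl_mul_inr, ← coeff_inl_mul_inr, h1]

theorem Lambda.coe_smul_φ {P : Subgroup G} (a : Subgroup.normalizer (P : Set G) × H)
    (l : Lambda p F H P) (q : l.y.P) (q' : (a • l).y.P) (hq : (q' : H) = a.2 * q * a.2⁻¹) :
    ((a • l).φ q' : G) = (a.1 : G) * l.φ q * (a.1 : G)⁻¹ := by
  have : Subgroup.equivSMul (MulAut.conj a.2) l.y.P q = q' := Subtype.ext hq.symm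
  rw [← this]
  change (P.normalizerMonoidHom _ (l.φ ((Subgroup.equivSMul (MulAut.conj a.2) l.y.P).symm
    (Subgroup.equivSMul (MulAut.conj a.2) l.y.P q))) : G) = _
  rw [MulEquiv.symm_apply_apply]
  rfl

/-- For σ = id the relation φψ = σ forces ψ = φ⁻¹, so triples are the same as elements of Λ. -/
theorem Omega.eq_toOmega {P : Subgroup G} (ω : Omega p F H (MulEquiv.refl P)) :
    ω = (⟨ω.y, ω.φ⟩ : Lambda p F H P).toOmega := by
  refine ext_val rfl fun r => ?_
  have h : ω.φ (ω.ψ r) = r := DFunLike.congr_fun ω.comp r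
  exact congrArg Subtype.val ((MulEquiv.eq_symm_apply ω.φ).2 h)

theorem Lambda.toOmega_injective {P : Subgroup G} :
    Function.Injective (toOmega : Lambda p F H P → Omega p F H (MulEquiv.refl P)) := fun _ _ h =>
  congrArg (fun ω : Omega p F H (MulEquiv.refl P) => (⟨ω.y, ω.φ⟩ : Lambda p F H P)) h

theorem Lambda.smul_toOmega {P : Subgroup G}
    (a : Subgroup.normalizer (twDiag (MulEquiv.refl P) : Set (G × G)) × H) (l : Lambda p F H P) :
    a • l.toOmega =
      (((⟨(a.1 : G × G).1, fst_mem_normalizer a.1.2⟩, a.2) :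
        Subgroup.normalizer (P : Set G) × H) • l).toOmega :=
  Omega.eq_toOmega _

/-- Diagonal elements realize the action of S on Λ inside the normalizer of Δ(P). -/
theorem diag_mem_normalizer {P : Subgroup G} {g : G} (hg : g ∈ Subgroup.normalizer (P : Set G)) :
    (g, g) ∈ Subgroup.normalizer (twDiag (MulEquiv.refl P) : Set (G × G)) := by
  refine Subgroup.mem_normalizer_iff.2 fun w => ?_
  have h := Subgroup.mem_normalizer_iff.1 hg
  constructor
  · rintro ⟨y, rfl⟩
    exact ⟨⟨g * y * g⁻¹, (h y).1 y.2⟩, rfl⟩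
  · rintro ⟨⟨y, hy⟩, hw⟩
    obtain ⟨w1, w2⟩ := w
    have h1 : y = g * w1 * g⁻¹ := congrArg Prod.fst hw
    have h2 : y = g * w2 * g⁻¹ := congrArg Prod.snd hw
    have h3 : w1 = w2 := by
      rw [h1] at h2
      exact mul_left_cancel (mul_right_cancel h2)
    subst h3
    exact ⟨⟨w1, (h w1).2 (h1 ▸ hy)⟩, rfl⟩

end Stabilizers

/-! ### The group X(λ) * Y(λ). -/

section StarProd

variable {p : ℕ} {O : Type*} [CommRing O] [IsLocalRing O] {G H : Type*} [Group G] [Group H]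
  [Finite G] [Finite H]

/-- An element (g,k) of the left side normalizes Δ(P), so g and k induce the same automorphism of P
and differ by an element of C_G(P). Conversely, c in C_G(P) may be adjoined on the left because it
acts trivially on P. -/
theorem starProd_XSub_YSub (x : BrauerPair (ResidueField O) p G) {S : Subgroup G}
    (hCS : Subgroup.centralizer (x.P : Set G) ≤ S) (hS : S ≤ pairStab x.toLocalPair)
    (l : Lambda p (ResidueField O) H x.P) :
    (starProd (XSub S x l.y l.φ) (YSub S l.y x l.φ.symm) : Set (G × G)) =
      {w | ∃ g ∈ NSub S l.φ (pairStab l.y.toLocalPair),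
        ∃ c ∈ Subgroup.centralizer (x.P : Set G), w = (g, g) * (c, 1)} := by
  ext ⟨g, k⟩
  constructor
  · rintro ⟨h, hX, hY⟩
    have hh : h ∈ pairStab l.y.toLocalPair :=
      snd_mem_pairStab x.isBlock.ne_zero (hS hX.1.1) hX.2
    have hn := (starProd_le_NST l.toOmega ⟨h, hX, hY⟩ : (g, k) ∈ NST S _ S).2
    -- The witness is h⁻¹: normalizing the twisted diagonal gives c_k φ c_h⁻¹ = φ, whereas `NSub`
    -- asks for c_g φ c_h = φ.
    refine ⟨k, ⟨hY.1.2, ⟨h⁻¹, pairStab_le_normalizer _ (Subgroup.inv_mem _ hh)⟩,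
      Subgroup.inv_mem _ hh, fun q => ?_⟩, k⁻¹ * g, ?_, by simp⟩
    · obtain ⟨r', h1, h2⟩ := conj_of_mem_normalizer (pairStab_le_normalizer _ hY.2)
        (l.φ (l.y.P.normalizerMonoidHom
          ⟨h⁻¹, pairStab_le_normalizer _ (Subgroup.inv_mem _ hh)⟩ q))
      rw [MulEquiv.symm_apply_apply] at h2
      rw [← h1]
      have h3 : l.φ.symm r' = q := Subtype.ext (h2.trans (by
        change h * (h⁻¹ * q * h⁻¹⁻¹) * h⁻¹ = q
        group))
      rw [← h3, MulEquiv.apply_symm_apply]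
    · refine Subgroup.mem_centralizer_iff.2 fun y hy => ?_
      obtain ⟨y', h1, h2⟩ := conj_of_mem_normalizer hn ⟨y, hy⟩
      have h3 : k * y * k⁻¹ = g * y * g⁻¹ := h1.symm.trans h2
      calc y * (k⁻¹ * g) = k⁻¹ * (k * y * k⁻¹) * g := by group
        _ = k⁻¹ * g * y := by rw [h3]; group
  · rintro ⟨g', ⟨hg', h, hh, hφ⟩, c, hc, he⟩
    obtain ⟨rfl, rfl⟩ := Prod.mk.inj he
    rw [mul_one] at *
    have hstab : l.y.toLocalPair = (h : H)⁻¹ • l.y.toLocalPair :=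
      (Subgroup.inv_mem _ hh : (h : H)⁻¹ ∈ pairStab _).symm
    have hc' : ∀ q : x.P, c * (q : G) * c⁻¹ = q := fun q => by
      rw [mul_inv_eq_iff_eq_mul]
      exact (Subgroup.mem_centralizer_iff.1 hc q q.2).symm
    have hφ' : ∀ q q' : l.y.P, (q' : H) = (h : H)⁻¹ * q * (h : H)⁻¹⁻¹ →
        (l.φ q' : G) = g' * l.φ q * g'⁻¹ := fun q q' hq => by
      have h1 : l.y.P.normalizerMonoidHom h q' = q := Subtype.ext (by
        change (h : H) * q' * (h : H)⁻¹ = q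
        rw [hq]
        group)
      rw [← hφ q', h1]
    refine ⟨(h : H)⁻¹, ⟨⟨S.mul_mem hg' (hCS hc), trivial⟩, ?_⟩, ⟨trivial, hg'⟩, ?_⟩
    · refine (tensorPair_smul hstab (hS (S.mul_mem hg' (hCS hc))) fun q q' hq => ?_).symm
      calc (l.φ q' : G) = g' * (c * l.φ q * c⁻¹) * g'⁻¹ := by rw [hc', hφ' q q' hq]
        _ = g' * c * l.φ q * (g' * c)⁻¹ := by group
    · refine (tensorPair_smul' hstab (hS hg') fun r r' hr => ?_).symm
      have h1 : (h : H)⁻¹ * l.φ.symm r * (h : H)⁻¹⁻¹ ∈ l.y.P :=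
        (Subgroup.mem_normalizer_iff.1 (Subgroup.inv_mem _ h.2) _).1 (l.φ.symm r).2
      have h2 := hφ' (l.φ.symm r) ⟨_, h1⟩ rfl
      rw [MulEquiv.apply_symm_apply, ← hr] at h2
      rw [← Subtype.ext h2, MulEquiv.symm_apply_apply]

end StarProd

end BPDecomp

namespace BPDecomp

open Representation IsLocalRing

/-! ### Orbit representatives. -/

section OrbitReps

variable {A α : Type*} [Group A] [MulAction A α] {Γ : Subgroup A} {T : Set α}

theorem IsOrbitReps.exists_eq_smul (hT : IsOrbitReps Γ T) (a : α) :
    ∃ i : T, ∃ γ ∈ Γ, (i : α) = γ • a := by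
  obtain ⟨b, ⟨hb, γ, hγ⟩, -⟩ := hT a
  exact ⟨⟨b, hb⟩, γ, γ.2, hγ.symm⟩

theorem IsOrbitReps.ne_smul (hT : IsOrbitReps Γ T) {i j : T} (hij : i ≠ j) {γ : A} (hγ : γ ∈ Γ) :
    (j : α) ≠ γ • (i : α) := fun h =>
  hij (Subtype.ext ((hT i).unique ⟨i.2, MulAction.mem_orbit_self _⟩ ⟨j.2, ⟨γ, hγ⟩, h.symm⟩))

end OrbitReps

/-! ### Orbit representatives in Ω and Λ as families of triples. -/

section Families

variable {p : ℕ} {O : Type*} [CommRing O] [IsLocalRing O] {G H K : Type*} [Group G] [Group H]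
  [Group K] {x : BrauerPair (ResidueField O) p G}

section General

variable {z : BrauerPair (ResidueField O) p K} {σ : z.P ≃* x.P} {S : Subgroup G} {T : Subgroup K}

theorem IsOrbitReps.inH {Ωt : Set (Omega p (ResidueField O) H σ)}
    (hΩ : IsOrbitReps ((⊥ : Subgroup (Subgroup.normalizer (twDiag σ : Set (G × K)))).prod
      (⊤ : Subgroup H)) Ωt) :
    (∀ a : Omega p (ResidueField O) H σ, ∃ i : Ωt, ∃ h : H, i.1 = BPDecomp.inH x z σ h • a) ∧
      ∀ i j : Ωt, i ≠ j → ∀ h : H, j.1 ≠ BPDecomp.inH x z σ h • i.1 := by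
  refine ⟨fun a => ?_, fun i j hij h => hΩ.ne_smul hij ⟨rfl, trivial⟩⟩
  obtain ⟨i, ⟨γ, h⟩, ⟨hγ, -⟩, hi⟩ := hΩ.exists_eq_smul a
  obtain rfl : γ = 1 := hγ
  exact ⟨i, h, hi⟩

theorem IsOrbitReps.inNH {Ωh : Set (Omega p (ResidueField O) H σ)}
    (hΩ : IsOrbitReps (((S.prod T).subgroupOf
      (Subgroup.normalizer (twDiag σ : Set (G × K)))).prod (⊤ : Subgroup H)) Ωh) :
    (∀ a : Omega p (ResidueField O) H σ, ∃ i : Ωh, ∃ b : NST S σ T, ∃ h : H,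
      i.1 = BPDecomp.inNH b h • a) ∧
      ∀ i j : Ωh, i ≠ j → ∀ (b : NST S σ T) (h : H), j.1 ≠ BPDecomp.inNH b h • i.1 := by
  refine ⟨fun a => ?_, fun i j hij b h => hΩ.ne_smul hij ⟨b.2.1, trivial⟩⟩
  obtain ⟨i, ⟨γ, h⟩, ⟨hγ, -⟩, hi⟩ := hΩ.exists_eq_smul a
  exact ⟨i, ⟨γ, hγ, γ.2⟩, h, hi⟩

end General

variable {S : Subgroup G}

theorem IsOrbitReps.toOmega_inH {Λt : Set (Lambda p (ResidueField O) H x.P)}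
    (hΛ : IsOrbitReps ((⊥ : Subgroup (Subgroup.normalizer (x.P : Set G))).prod
      (⊤ : Subgroup H)) Λt) :
    (∀ a : Omega p (ResidueField O) H (MulEquiv.refl x.P), ∃ l : Λt, ∃ h : H,
      l.1.toOmega = BPDecomp.inH x x (MulEquiv.refl x.P) h • a) ∧
      ∀ l m : Λt, l ≠ m → ∀ h : H,
        m.1.toOmega ≠ BPDecomp.inH x x (MulEquiv.refl x.P) h • l.1.toOmega := by
  refine ⟨fun a => ?_, fun i j hij h hj => ?_⟩
  · obtain ⟨i, ⟨γ, h⟩, ⟨hγ, -⟩, hi⟩ := hΛ.exists_eq_smul ⟨a.y, a.φ⟩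
    obtain rfl : γ = 1 := hγ
    refine ⟨i, h, ?_⟩
    rw [a.eq_toOmega, Lambda.smul_toOmega, hi]
    rfl
  · rw [Lambda.smul_toOmega] at hj
    exact hΛ.ne_smul hij (γ := (1, h)) ⟨rfl, trivial⟩ (Lambda.toOmega_injective hj)

theorem IsOrbitReps.toOmega_inNH {Λh : Set (Lambda p (ResidueField O) H x.P)}
    (hΛ : IsOrbitReps ((S.subgroupOf (Subgroup.normalizer (x.P : Set G))).prod
      (⊤ : Subgroup H)) Λh) :
    (∀ a : Omega p (ResidueField O) H (MulEquiv.refl x.P), ∃ l : Λh,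
      ∃ b : NST S (MulEquiv.refl x.P) S, ∃ h : H, l.1.toOmega = BPDecomp.inNH b h • a) ∧
      ∀ l m : Λh, l ≠ m → ∀ (b : NST S (MulEquiv.refl x.P) S) (h : H),
        m.1.toOmega ≠ BPDecomp.inNH b h • l.1.toOmega := by
  refine ⟨fun a => ?_, fun i j hij b h hj => ?_⟩
  · obtain ⟨i, ⟨γ, h⟩, ⟨hγ, -⟩, hi⟩ := hΛ.exists_eq_smul ⟨a.y, a.φ⟩
    -- Any lift of γ to the normalizer of Δ(P) in S × S would do, since the action on Λ only sees
    -- the first component; the diagonal one is at hand.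
    refine ⟨i, ⟨(γ, γ), ⟨hγ, hγ⟩, diag_mem_normalizer γ.2⟩, h, ?_⟩
    rw [a.eq_toOmega, Lambda.smul_toOmega, hi]
  · rw [Lambda.smul_toOmega] at hj
    exact hΛ.ne_smul hij (γ := (⟨_, _⟩, h)) ⟨b.2.1.1, trivial⟩ (Lambda.toOmega_injective hj)

end Families

end BPDecomp

/-! ### The theorem. -/

theorem mainTheorem8 {p : ℕ} [Fact p.Prime]
    {O : Type*} [CommRing O] [IsDomain O] [IsDiscreteValuationRing O] [CharZero O]
    [IsAdicComplete (IsLocalRing.maximalIdeal O) O] [CharP (IsLocalRing.ResidueField O) p]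
    {G H : Type*} [Group G] [Finite G] [Group H] [Finite H]
    (x : BPDecomp.BrauerPair (IsLocalRing.ResidueField O) p G) (S : Subgroup G)
    (hCS : Subgroup.centralizer (x.P : Set G) ≤ S) (hS : S ≤ BPDecomp.pairStab x.toLocalPair)
    {V : Type*} [AddCommGroup V] [Module O V] (ρ : Representation O (G × H) V)
    (hρ : BPDecomp.IsPPermutation p ρ) (hρv : BPDecomp.HasTwistedDiagonalVertices ρ) :
    -- the general situation, with a third group `K` and an isomorphism `σ`
    (∀ {K : Type*} [Group K] [Finite K]
        (z : BPDecomp.BrauerPair (IsLocalRing.ResidueField O) p K) (T : Subgroup K)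
        (_ : Subgroup.centralizer (z.P : Set K) ≤ T) (hT : T ≤ BPDecomp.pairStab z.toLocalPair)
        (σ : z.P ≃* x.P)
        {W : Type*} [AddCommGroup W] [Module O W] (τ : Representation O (H × K) W)
        (_ : BPDecomp.IsPPermutation p τ) (_ : BPDecomp.HasTwistedDiagonalVertices τ),
      -- the action on `Ω` and the stabilizers in `H`
      (∀ (a : Subgroup.normalizer (BPDecomp.twDiag σ : Set (G × K)) × H)
          (ω : BPDecomp.Omega p (IsLocalRing.ResidueField O) H σ),
        (a • ω).y = a.2 • ω.y ∧
        (∀ (q : ω.y.P) (q' : (a • ω).y.P), (q' : H) = a.2 * q * a.2⁻¹ →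
          ((a • ω).φ q' : G) = (a.1 : G × K).1 * ω.φ q * (a.1 : G × K).1⁻¹) ∧
        (∀ r r' : z.P, (r' : K) = (a.1 : G × K).2 * r * (a.1 : G × K).2⁻¹ →
          ((a • ω).ψ r' : H) = a.2 * ω.ψ r * a.2⁻¹)) ∧
      (∀ ω : BPDecomp.Omega p (IsLocalRing.ResidueField O) H σ,
        (MulAction.stabilizer (Subgroup.normalizer (BPDecomp.twDiag σ : Set (G × K)) × H) ω).comap
          (MonoidHom.inr _ H) = Subgroup.centralizer (ω.y.P : Set H)) ∧
      -- the isomorphism of bimodules and its naturality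
      (∀ Ωt : Set (BPDecomp.Omega p (IsLocalRing.ResidueField O) H σ),
        BPDecomp.IsOrbitReps
          ((⊥ : Subgroup (Subgroup.normalizer (BPDecomp.twDiag σ : Set (G × K)))).prod
            (⊤ : Subgroup H)) Ωt →
        Function.Bijective
          (BPDecomp.sumLift fun ω : Ωt => BPDecomp.PhiBimod ρ τ ω.1) ∧
        ∀ {V' W' : Type*} [AddCommGroup V'] [Module O V'] [AddCommGroup W'] [Module O W']
          (ρ' : Representation O (G × H) V') (τ' : Representation O (H × K) W')
          (α : ρ.IntertwiningMap ρ') (β : τ.IntertwiningMap τ'),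
          (BPDecomp.bimodMap (BPDecomp.tensorMap α β) x z σ).comp
              (BPDecomp.sumLift fun ω : Ωt => BPDecomp.PhiBimod ρ τ ω.1) =
            (BPDecomp.sumLift fun ω : Ωt => BPDecomp.PhiBimod ρ' τ' ω.1).comp
              (BPDecomp.sumMap fun ω : Ωt => BPDecomp.tensorMap
                (BPDecomp.bimodMap α x ω.1.y ω.1.φ) (BPDecomp.bimodMap β ω.1.y z ω.1.ψ))) ∧
      -- the isomorphism of modules for the normalizer and its naturality
      (∀ ω : BPDecomp.Omega p (IsLocalRing.ResidueField O) H σ,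
        BPDecomp.IsPPermutation p (BPDecomp.MRep ρ S x ω.y ω.φ) ∧
        BPDecomp.IsPPermutation p (BPDecomp.NRep τ T ω.y z ω.ψ)) ∧
      (∀ Ωh : Set (BPDecomp.Omega p (IsLocalRing.ResidueField O) H σ),
        BPDecomp.IsOrbitReps
          (((S.prod T).subgroupOf (Subgroup.normalizer (BPDecomp.twDiag σ : Set (G × K)))).prod
            (⊤ : Subgroup H)) Ωh →
        Function.Bijective
          (BPDecomp.sumLift fun ω : Ωh => BPDecomp.PhiInd ρ τ hS hT ω.1) ∧
        ∀ {V' W' : Type*} [AddCommGroup V'] [Module O V'] [AddCommGroup W'] [Module O W']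
          (ρ' : Representation O (G × H) V') (τ' : Representation O (H × K) W')
          (α : ρ.IntertwiningMap ρ') (β : τ.IntertwiningMap τ'),
          (BPDecomp.NSTMap (BPDecomp.tensorMap α β) hS hT σ).comp
              (BPDecomp.sumLift fun ω : Ωh => BPDecomp.PhiInd ρ τ hS hT ω.1) =
            (BPDecomp.sumLift fun ω : Ωh => BPDecomp.PhiInd ρ' τ' hS hT ω.1).comp
              (BPDecomp.sumMap fun ω : Ωh =>
                BPDecomp.indMap
                  (Subgroup.inclusion (BPDecomp.starProd_le_NST (S := S) (T := T) ω.1))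
                  (BPDecomp.extTensorMap (BPDecomp.MMap α S x ω.1.y ω.1.φ)
                    (BPDecomp.NMap β T ω.1.y z ω.1.ψ))))) ∧
    -- the special situation `K = G`, `(R,d) = (P,e)`, `T = S`, `σ = id`
    (∀ {W : Type*} [AddCommGroup W] [Module O W] (τ : Representation O (H × G) W)
        (_ : BPDecomp.IsPPermutation p τ) (_ : BPDecomp.HasTwistedDiagonalVertices τ),
      (∀ (a : Subgroup.normalizer (x.P : Set G) × H)
          (l : BPDecomp.Lambda p (IsLocalRing.ResidueField O) H x.P),
        (a • l).y = a.2 • l.y ∧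
        ∀ (q : l.y.P) (q' : (a • l).y.P), (q' : H) = a.2 * q * a.2⁻¹ →
          ((a • l).φ q' : G) = (a.1 : G) * l.φ q * (a.1 : G)⁻¹) ∧
      (∀ l : BPDecomp.Lambda p (IsLocalRing.ResidueField O) H x.P,
        BPDecomp.IsPPermutation p (BPDecomp.MRep ρ S x l.y l.φ) ∧
        BPDecomp.IsPPermutation p (BPDecomp.NRep τ S l.y x l.φ.symm)) ∧
      (∀ Λt : Set (BPDecomp.Lambda p (IsLocalRing.ResidueField O) H x.P),
        BPDecomp.IsOrbitReps
          ((⊥ : Subgroup (Subgroup.normalizer (x.P : Set G))).prod (⊤ : Subgroup H)) Λt →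
        Nonempty (Representation.Equiv
          (BPDecomp.bimodRep (BPDecomp.tensorRep ρ τ) x x (MulEquiv.refl x.P))
          (Representation.directSum fun l : Λt => BPDecomp.tensorRep
            (BPDecomp.bimodRep ρ x l.1.y l.1.φ) (BPDecomp.bimodRep τ l.1.y x l.1.φ.symm)))) ∧
      (∀ l : BPDecomp.Lambda p (IsLocalRing.ResidueField O) H x.P,
        (BPDecomp.starProd (BPDecomp.XSub S x l.y l.φ) (BPDecomp.YSub S l.y x l.φ.symm) :
            Set (G × G)) =
          {w | ∃ g ∈ BPDecomp.NSub S l.φ (BPDecomp.pairStab l.y.toLocalPair),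
            ∃ c ∈ Subgroup.centralizer (x.P : Set G), w = (g, g) * (c, 1)}) ∧
      (∀ Λh : Set (BPDecomp.Lambda p (IsLocalRing.ResidueField O) H x.P),
        BPDecomp.IsOrbitReps
          ((S.subgroupOf (Subgroup.normalizer (x.P : Set G))).prod (⊤ : Subgroup H)) Λh →
        Nonempty (Representation.Equiv
          (BPDecomp.NSTRep (BPDecomp.tensorRep ρ τ) hS hS (MulEquiv.refl x.P))
          (Representation.directSum fun l : Λh =>
            Representation.ind
              (Subgroup.inclusion (BPDecomp.starProd_le_NST (S := S) (T := S) l.1.toOmega))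
              (BPDecomp.extTensorRep (BPDecomp.MRep ρ S x l.1.y l.1.φ)
                (BPDecomp.NRep τ S l.1.y x l.1.φ.symm)))))) := by
  refine ⟨?_, ?_⟩
  · intro K _ _ z T _ hT σ W _ _ τ hτ hτv
    have hs := BPDecomp.phiSplit hρ hρv hτ hτv x z σ
    refine ⟨fun a ω => ⟨rfl, fun q q' hq => ω.coe_smul_φ a q q' hq,
      fun r r' hr => ω.coe_smul_ψ a r r' hr⟩, fun ω => ω.stabilizer_comap_inr, fun Ωt hΩ =>
      ⟨BPDecomp.sumLift_PhiBimod_bijective hs _ hΩ.inH.1 hΩ.inH.2, ?_⟩, fun ω =>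
      ⟨BPDecomp.isPPermutation_cutRep hρ x ω.y ω.φ inf_le_right,
        BPDecomp.isPPermutation_cutRep hτ ω.y z ω.ψ inf_le_right⟩, fun Ωh hΩ =>
      ⟨BPDecomp.sumLift_PhiInd_bijective hS hT hs _ hΩ.inNH.1 hΩ.inNH.2, ?_⟩⟩
    · intro V' W' _ _ _ _ ρ' τ' α β
      exact BPDecomp.comp_sumLift fun ω t => BPDecomp.bimodMap_PhiBimod α β ω.1 t
    · intro V' W' _ _ _ _ ρ' τ' α β
      exact BPDecomp.comp_sumLift fun ω t => BPDecomp.NSTMap_PhiInd hS hT α β ω.1 t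
  · intro W _ _ τ hτ hτv
    have hs := BPDecomp.phiSplit hρ hρv hτ hτv x x (MulEquiv.refl x.P)
    refine ⟨fun a l => ⟨rfl, fun q q' hq => l.coe_smul_φ a q q' hq⟩, fun l =>
      ⟨BPDecomp.isPPermutation_cutRep hρ x l.y l.φ inf_le_right,
        BPDecomp.isPPermutation_cutRep hτ l.y x l.φ.symm inf_le_right⟩, fun Λt hΛ => ?_,
      fun l => BPDecomp.starProd_XSub_YSub x hCS hS l, fun Λh hΛ => ?_⟩
    · exact ⟨(Representation.IntertwiningMap.ofBijective _
        (BPDecomp.sumLift_PhiBimod_bijective hs (fun l : Λt => l.1.toOmega)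
          hΛ.toOmega_inH.1 hΛ.toOmega_inH.2)).symm⟩
    · exact ⟨(Representation.IntertwiningMap.ofBijective _
        (BPDecomp.sumLift_PhiInd_bijective hS hS hs (fun l : Λh => l.1.toOmega)
          hΛ.toOmega_inNH.1 hΛ.toOmega_inNH.2)).symm⟩
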